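/- **Setting.** Let $\Gamma=\mathbb Z r_1+\mathbb Z r_2$ with $r_1=(\tfrac{\sqrt3}{2},\tfrac12)$, $r_2=(\tfrac{\sqrt3}{2},-\tfrac12)$, let $R$ be the matrix $\begin{pmatrix}-1/2&-\sqrt3/2\\ \sqrt3/2&-1/2\end{pmatrix}$, $\omega=e^{2\pi i/3}$ and $\mathbf K=\tfrac{4\pi}{3}(0,1)$. A real function $W$ on $\mathbb R^2$ has *honeycomb symmetry* if it is $\Gamma$-periodic with $W(-x)=W(x)=W(Rx)$. Let $\langle f,g\rangle=\int_{\mathbb R^2/\Gamma}\overline f g$. Let $V_L$ and $K$ have honeycomb symmetry and let $V(x,s)$ be real, $C^\infty$ on $\mathbb R^2\times[0,\infty)$ and $\Gamma$-periodic in $x$, with $V(x,s)=V_L(x)+K(x)s+O(s^2)$ as $s\to0$, uniformly in $x$. Assume that the lowest eigenvalue $E_0$ of $-(\nabla+i\mathbf K)^2+V_L$ on $L^2(\mathbb R^2/\Gamma)$ has a two-dimensional eigenspace, spanned by functions $\phi_0^a,\phi_0^b$ of norm one with $\widetilde R\phi_0^a=\omega\phi_0^a$, $\widetilde R\phi_0^b=\overline\omega\phi_0^b$,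 $\phi_0^a(x)=\overline{\phi_0^b(-x)}$, where $\widetilde Rf(x)=e^{-i\mathbf K\cdot x}e^{i\mathbf K\cdot Rx}f(Rx)$. Put $I_{one}=\int_{\mathbb R^2/\Gamma} K|\phi_0^a|^4$, $I_{int}=\int_{\mathbb R^2/\Gamma} K|\phi_0^a|^2|\phi_0^b|^2$ and assume $I_{one}\ne 2I_{int}$. For $M\in\mathbb R$ and $\epsilon>0$, a pair $(a,b)\in\mathbb C^2$ with $|a|^2+|b|^2=1$ is called *allowed* (at amplitude $\epsilon$, with bound $M$) if there are $\phi\in H^2(\mathbb R^2/\Gamma)$, $\phi\neq0$, and $E\in\mathbb C$ with $$-(\nabla+i\mathbf K)^2\phi+V(x,|\phi|^2)\phi=E\phi,\qquad |E-E_0|\le\epsilon,$$ $$\langle\phi_0^a,\phi\rangle=\epsilon a,\quad \langle\phi_0^b,\phi\rangle=\epsilon b,\quad \|\phi\|_{L^2}\le M\epsilon,\quad |\phi|\le M \text{ a.e.}$$ Two pairs $(a,b)$, $(c,d)$ are identified if $ad-bc=0$; the poles are $(1,0)$ and $(0,1)$. **Proposition (Radial Separability).** (1) For every $\delta>0$ and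 every $M$ there is $\epsilon_0>0$ such that for all $0<\epsilon<\epsilon_0$ the following holds. If $\alpha,\beta\in\mathbb R$ and $\theta,\theta'\in[0,\pi/2]$ are such that $(\cos\theta\,e^{i\alpha},\sin\theta\,e^{i\beta})$ and $(\cos\theta'e^{i\alpha},\sin\theta'e^{i\beta})$ are both allowed, and $\cos\theta,\sin\theta,\cos\theta',\sin\theta'\ge\delta$, then $\theta=\theta'$. (2) There is $\delta>0$ such that for every $M$ there is $\epsilon_0>0$ such that for all $0<\epsilon<\epsilon_0$ and all allowed pairs $(a_1,b_1)$, $(a_2,b_2)$: - if $a_1=0$ and $|a_2|\le\delta$, or $b_1=0$ and $|b_2|\le\delta$, then $(a_1,b_1)$ and $(a_2,b_2)$ are identified, that is, an allowed pole has a $\delta$-neighbourhood containing no other allowed pair; - if moreover $V(\cdot,s)$ has honeycomb symmetry for every $s\ge0$, and $a_1=0$ or $b_1=0$, and $|a_2|\le\delta$ or $|b_2|\le\delta$, then $(a_2,b_2)$ is identified with $(1,0)$ or $(0,1)$, that is, no allowed pair other than the poles lies $\delta$-close to either pole. -/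

import Mathlib

open scoped ContDiff
open MeasureTheory

noncomputable section

namespace Honeycomb

/-- The Euclidean plane. -/
abbrev Plane : Type := EuclideanSpace ℝ (Fin 2)

/-- First primitive vector of the honeycomb lattice. -/
def r₁ : Plane := !₂[Real.sqrt 3 / 2, 1 / 2]

/-- Second primitive vector of the honeycomb lattice. -/
def r₂ : Plane := !₂[Real.sqrt 3 / 2, -(1 / 2)]

/-- The Dirac point `K`. -/
def diracK : Plane := !₂[0, 4 * Real.pi / 3]

/-- Rotation by `2π/3`, with matrix `(-1/2, -√3/2; √3/2, -1/2)`. -/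
def rot (x : Plane) : Plane :=
  !₂[-(1 / 2) * x 0 - Real.sqrt 3 / 2 * x 1, Real.sqrt 3 / 2 * x 0 - 1 / 2 * x 1]

/-- Periodicity under the lattice `Γ = ℤ r₁ + ℤ r₂`: functions on the torus `ℝ²/Γ` are
lattice-periodic functions on the plane. -/
def Periodic {β : Type} (f : Plane → β) : Prop :=
  ∀ x, f (x + r₁) = f x ∧ f (x + r₂) = f x

/-- Honeycomb symmetry: lattice periodicity, inversion symmetry and `2π/3`-rotation symmetry. -/
structure IsHoneycomb (W : Plane → ℝ) : Prop where
  periodic : Periodic W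
  even : ∀ x, W (-x) = W x
  rot_inv : ∀ x, W (rot x) = W x

/-- A fundamental cell of the lattice. Integrals over `ℝ²/Γ` are integrals over this cell. -/
def cell : Set Plane :=
  {x | ∃ s ∈ Set.Ico (0 : ℝ) 1, ∃ t ∈ Set.Ico (0 : ℝ) 1, x = s • r₁ + t • r₂}

/-- The `L²(ℝ²/Γ)` inner product, antilinear in the first argument. -/
def inner₂ (f g : Plane → ℂ) : ℂ :=
  ∫ x in cell, (starRingEnd ℂ) (f x) * g x

/-- The `L²(ℝ²/Γ)` norm (of a square integrable function). -/
def norm₂ (f : Plane → ℂ) : ℝ :=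
  Real.sqrt (∫ x in cell, ‖f x‖ ^ 2)

/-- `f ∈ L²(ℝ²/Γ)`. -/
structure MemL2 (f : Plane → ℂ) : Prop where
  periodic : Periodic f
  memLp : MemLp f 2 (volume.restrict cell)

/-- `g` is the `i`-th weak partial derivative of `f` on the torus, both lying in `L²(ℝ²/Γ)`;
the test functions are the smooth functions on the torus. -/
structure HasWeakPartial (i : Fin 2) (f g : Plane → ℂ) : Prop where
  memL2 : MemL2 f
  memL2_partial : MemL2 g
  integral_eq : ∀ η : Plane → ℂ, ContDiff ℝ ∞ η → Periodic η →
    ∫ x in cell, f x * fderiv ℝ η x (EuclideanSpace.single i 1) = -∫ x in cell, g x * η x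

/-- `f ∈ H²(ℝ²/Γ)`, with weak gradient `g` and weak Hessian `h`. -/
structure HasH2Jet (f : Plane → ℂ) (g : Fin 2 → Plane → ℂ) (h : Fin 2 → Fin 2 → Plane → ℂ) :
    Prop where
  grad : ∀ i, HasWeakPartial i f (g i)
  hess : ∀ i j, HasWeakPartial j (g i) (h i j)

/-- `f ∈ H²(ℝ²/Γ)` is a nonzero solution of `-(∇ + iK)² f + W f = E f`, where
`(∇ + iK)² f = ∑ⱼ (∂ⱼ∂ⱼ f + 2 i Kⱼ ∂ⱼ f - Kⱼ² f)`. -/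
structure IsEigenfunction (W : Plane → ℝ) (E : ℂ) (f : Plane → ℂ) : Prop where
  ne_zero : ¬ (f =ᵐ[volume] 0)
  equation : ∃ g h, HasH2Jet f g h ∧ ∀ᵐ x,
    -(∑ j : Fin 2, (h j j x + 2 * Complex.I * (diracK j : ℂ) * g j x - (diracK j : ℂ) ^ 2 * f x))
      + (W x : ℂ) * f x = E * f x

/-- `ζ₃ = ω = e^{2πi/3}`. -/
def ζ₃ : ℂ := Complex.exp (2 * Real.pi * Complex.I / 3)

/-- The transformed rotation `f ↦ e^{-iK·x} [e^{iK·(·)} f](R x)`. -/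
def rotK (f : Plane → ℂ) (x : Plane) : ℂ :=
  Complex.exp (-(Complex.I * (inner ℝ diracK x : ℝ))) *
    (Complex.exp (Complex.I * (inner ℝ diracK (rot x) : ℝ)) * f (rot x))

/-- `E₀` is the lowest eigenvalue of `-(∇ + iK)² + V_L` on the torus, and its eigenspace is
two-dimensional, spanned by the normalized functions `φa`, `φb` lying in the `ω`- and
`ω̄`-eigenspaces of the transformed rotation, with `φa(x) = conj (φb(-x))`. -/
structure IsGroundPair (VL : Plane → ℝ) (E₀ : ℝ) (φa φb : Plane → ℂ) : Prop where
  eigen_a : IsEigenfunction VL E₀ φa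
  eigen_b : IsEigenfunction VL E₀ φb
  norm_a : norm₂ φa = 1
  norm_b : norm₂ φb = 1
  rot_a : ∀ᵐ x, rotK φa x = ζ₃ * φa x
  rot_b : ∀ᵐ x, rotK φb x = (starRingEnd ℂ) ζ₃ * φb x
  conj_inv : ∀ᵐ x, φa x = (starRingEnd ℂ) (φb (-x))
  span : ∀ f, IsEigenfunction VL E₀ f → ∃ c d : ℂ, ∀ᵐ x, f x = c * φa x + d * φb x
  lowest : ∀ (E : ℝ) (f : Plane → ℂ), IsEigenfunction VL E f → E₀ ≤ E

/-- `V(x, s)` is a nonlinear potential, smooth on `ℝ² × [0, ∞)` and lattice-periodic in `x`, with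
`V(x, s) = V_L(x) + K(x) s + O(s²)` as `s → 0`, where `V_L`, `K` have honeycomb symmetry. -/
structure IsNonlinearPotential (V : Plane → ℝ → ℝ) (VL K : Plane → ℝ) : Prop where
  smooth : ContDiffOn ℝ ∞ (fun p : Plane × ℝ => V p.1 p.2) (Set.univ ×ˢ Set.Ici 0)
  periodic : ∀ s, 0 ≤ s → Periodic fun x => V x s
  honeycomb_VL : IsHoneycomb VL
  honeycomb_K : IsHoneycomb K
  expansion : ∃ C r : ℝ, 0 < r ∧ ∀ x, ∀ s ∈ Set.Icc 0 r, |V x s - VL x - K x * s| ≤ C * s ^ 2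

/-- `I_one = ∫ K |φa|⁴`. -/
def Ione (K : Plane → ℝ) (φa : Plane → ℂ) : ℝ :=
  ∫ x in cell, K x * ‖φa x‖ ^ 4

/-- `I_int = ∫ K |φa|² |φb|²`. -/
def Iint (K : Plane → ℝ) (φa φb : Plane → ℂ) : ℝ :=
  ∫ x in cell, K x * (‖φa x‖ ^ 2 * ‖φb x‖ ^ 2)

/-- `(a, b)` with `|a|² + |b|² = 1` is an allowed pair at amplitude `ε`: some
`φ = ε (a φa + b φb) + φ₁ ∈ H²`, `φ₁ ⟂ φa, φb`, satisfies
`-(∇ + iK)² φ + V(x, |φ|²) φ = E φ` with `|E - E₀| ≤ ε`. The constant `M` bounds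
`‖φ‖_{L²} / ε` and the supremum of `|φ|`. -/
def Allowed (V : Plane → ℝ → ℝ) (E₀ : ℝ) (φa φb : Plane → ℂ) (M ε : ℝ) (a b : ℂ) : Prop :=
  ‖a‖ ^ 2 + ‖b‖ ^ 2 = 1 ∧
  ∃ (φ : Plane → ℂ) (E : ℂ),
    IsEigenfunction (fun x => V x (‖φ x‖ ^ 2)) E φ ∧ ‖E - E₀‖ ≤ ε ∧
    inner₂ φa φ = ε * a ∧ inner₂ φb φ = ε * b ∧
    norm₂ φ ≤ M * ε ∧ ∀ᵐ x, ‖φ x‖ ≤ M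

/-- Two pairs define the same point of the quotient parameter space: `a d - b c = 0`. -/
def SamePoint (a b c d : ℂ) : Prop := a * d - b * c = 0

end Honeycomb

end

/-! The argument is a Lyapunov–Schmidt reduction followed by a rigidity argument for the two reduced
equations. Put φ = εu and E − E₀ = ε²e. The operator −(∇+iK)² + V_L − E₀ has kernel spanned by φa
and φb. By compactness of the resolvent it is boundedly invertible on the orthogonal complement of
the kernel, from L² to L² ∩ L^∞ (`IsGroundPair.exists_isGapped`). Hence the part of u orthogonal to
the kernel is O(ε²), and projecting onto the kernel leaves e a = a (|a|² I_one + 2|b|² I_int) + r, e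
b = b (|b|² I_one + 2|a|² I_int) + q. The cubic terms have this form because rotation symmetry kills
every other overlap of four modes (`overlap_eq_zero`), while inversion makes I_one the same for φa
and φb.

The decisive point is that r and q are small also in the Lipschitz sense: for two solutions whose
pairs are at distance d, the remainders differ by at most τd, where τ is as small as desired once ε
is small (`reduced_equations`). Any two solutions are compared directly, so no solution map (a,b) ↦
u is constructed.

Eliminating e gives ab(|a|² − |b|²)(I_one − 2 I_int) = a q − b r. Away from the poles the right side
is small, so |a|² is close to |b|². There the left side varies at a definite rate along the radial
angle, faster than the remainders can, so at most one angle is possible (`radial_unique`).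

At a pole a = 0 the first remainder vanishes exactly. After a common phase change, the Lipschitz
bound makes r at most 2τ|a| for a nearby pair. If a ≠ 0, dividing by a shows that e is close to |a|²
I_one + 2|b|² I_int, while the second equation puts it close to |b|² I_one + 2|a|² I_int. These two
values are separated because I_one ≠ 2 I_int (`pole_isolated`). When V(·,s) is even, φ ↦ conj φ(−x)
exchanges the poles, so one allowed pole makes both allowed and isolated (`FourierAllowed.reflect`).
-/

noncomputable section

namespace Honeycomb

/-! ### The lattice, its fundamental cell, and the symmetries of the torus. -/

/-- The coordinates of a point of the plane with respect to `r₁, r₂`. -/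
def latticeCoords : Plane ≃ₗ[ℝ] (Fin 2 → ℝ) where
  toFun x := ![x 0 / Real.sqrt 3 + x 1, x 0 / Real.sqrt 3 - x 1]
  map_add' x y := by ext i; fin_cases i <;> (simp; ring)
  map_smul' c x := by ext i; fin_cases i <;> (simp; ring)
  invFun t := !₂[Real.sqrt 3 / 2 * (t 0 + t 1), (t 0 - t 1) / 2]
  left_inv x := by
    have h : Real.sqrt 3 ≠ 0 := by positivity
    ext i
    fin_cases i <;> simp <;> field_simp <;> ring
  right_inv t := by
    have h : Real.sqrt 3 ≠ 0 := by positivity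
    ext i
    fin_cases i <;> simp <;> field_simp <;> ring

/-- The basis `r₁, r₂` of the plane. -/
def latticeBasis : Module.Basis (Fin 2) ℝ Plane := Module.Basis.ofEquivFun latticeCoords

lemma latticeBasis_repr (x : Plane) (i : Fin 2) : latticeBasis.repr x i = latticeCoords x i := rfl

lemma latticeBasis_zero : latticeBasis 0 = r₁ := by
  rw [latticeBasis, Module.Basis.coe_ofEquivFun]
  ext i
  fin_cases i <;> simp [latticeCoords, r₁]

lemma latticeBasis_one : latticeBasis 1 = r₂ := by
  rw [latticeBasis, Module.Basis.coe_ofEquivFun]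
  ext i
  fin_cases i <;> simp [latticeCoords, r₂] <;> ring

lemma cell_eq : cell = ZSpan.fundamentalDomain latticeBasis := by
  ext x
  rw [ZSpan.mem_fundamentalDomain]
  constructor
  · rintro ⟨s, hs, t, ht, rfl⟩ i
    rw [← latticeBasis_zero, ← latticeBasis_one]
    fin_cases i <;> simp <;> simpa using ‹_›
  · intro h
    refine ⟨_, h 0, _, h 1, ?_⟩
    rw [← latticeBasis_zero, ← latticeBasis_one, ← Fin.sum_univ_two
      (fun i => latticeBasis.repr x i • latticeBasis i), latticeBasis.sum_repr x]

/-- The lattice `Γ`. -/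
abbrev lattice : Submodule ℤ Plane := Submodule.span ℤ (Set.range latticeBasis)

lemma r₁_mem : r₁ ∈ lattice := latticeBasis_zero ▸ Submodule.subset_span ⟨0, rfl⟩

lemma r₂_mem : r₂ ∈ lattice := latticeBasis_one ▸ Submodule.subset_span ⟨1, rfl⟩

/-- Reduction modulo the lattice to the fundamental cell. -/
abbrev wrap (x : Plane) : Plane := ZSpan.fract latticeBasis x

lemma wrap_add {γ : Plane} (hγ : γ ∈ lattice) (x : Plane) : wrap (γ + x) = wrap x :=
  ZSpan.fract_zSpan_add _ _ hγ

lemma wrap_mem (x : Plane) : wrap x ∈ cell :=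
  cell_eq ▸ ZSpan.fract_mem_fundamentalDomain _ x

lemma wrap_eq_self {x : Plane} (hx : x ∈ cell) : wrap x = x :=
  ZSpan.fract_eq_self.2 (cell_eq ▸ hx)

lemma wrap_periodic {β : Type} (f : Plane → β) : Periodic fun x => f (wrap x) := fun x => by
  beta_reduce
  rw [add_comm x r₁, add_comm x r₂, wrap_add r₁_mem, wrap_add r₂_mem]
  exact ⟨rfl, rfl⟩

lemma Periodic.add_lattice {β : Type} {f : Plane → β} (hf : Periodic f) {γ : Plane}
    (hγ : γ ∈ lattice) : ∀ x, f (x + γ) = f x := by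
  induction hγ using Submodule.span_induction with
  | mem y hy =>
    obtain ⟨i, rfl⟩ := hy
    intro x
    fin_cases i
    · simpa [latticeBasis_zero] using (hf x).1
    · simpa [latticeBasis_one] using (hf x).2
  | zero => simp
  | add y z _ _ hy hz => intro x; rw [← add_assoc, hz, hy]
  | smul n y _ hy =>
    intro x
    induction n using Int.induction_on generalizing x with
    | zero => simp
    | succ n ih => rw [add_smul, one_smul, ← add_assoc, hy, ih]
    | pred n ih => rw [sub_smul, one_smul, ← hy, add_assoc, sub_add_cancel, ih]

lemma Periodic.wrap {β : Type} {f : Plane → β} (hf : Periodic f) (x : Plane) :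
    f (wrap x) = f x := by
  rw [Honeycomb.wrap, ZSpan.fract_apply, sub_eq_add_neg]
  exact hf.add_lattice (neg_mem (Submodule.coe_mem _)) x

lemma measurable_wrap : Measurable wrap := by
  have h : wrap = fun x => latticeCoords.symm fun i => Int.fract (latticeCoords x i) := by
    funext x
    rw [LinearEquiv.eq_symm_apply]
    funext i
    exact ZSpan.repr_fract_apply latticeBasis x i
  rw [h]
  have h1 : Measurable latticeCoords := latticeCoords.toLinearMap.continuous_of_finiteDimensional.measurable
  have h2 : Measurable latticeCoords.symm :=
    latticeCoords.symm.toLinearMap.continuous_of_finiteDimensional.measurable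
  exact h2.comp (measurable_pi_lambda _ fun i =>
    measurable_fract.comp ((measurable_pi_apply i).comp h1))

/-- Lebesgue measure on the fundamental cell. -/
abbrev cellMeasure : Measure Plane := volume.restrict cell

lemma measurableSet_cell : MeasurableSet cell :=
  cell_eq ▸ ZSpan.fundamentalDomain_measurableSet _

instance vaddInvariantMeasure_lattice : VAddInvariantMeasure lattice Plane volume :=
  ⟨fun γ s _ => measure_preimage_add volume (γ : Plane) s⟩

lemma isAddFundamentalDomain_cell : IsAddFundamentalDomain lattice cell volume :=
  cell_eq ▸ ZSpan.isAddFundamentalDomain latticeBasis volume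

lemma isBounded_cell : Bornology.IsBounded cell :=
  cell_eq ▸ ZSpan.fundamentalDomain_isBounded _

instance isFiniteMeasure_cellMeasure : IsFiniteMeasure cellMeasure :=
  ⟨by rw [Measure.restrict_apply_univ]; exact isBounded_cell.measure_lt_top⟩

lemma volume_cell_ne_zero : volume cell ≠ 0 :=
  cell_eq ▸ ZSpan.measure_fundamentalDomain_ne_zero latticeBasis

/-- A measure preserving map normalizing the lattice descends to the torus. -/
lemma measurePreserving_wrap_comp {S : Plane → Plane} (hS : MeasurePreserving S volume volume)
    {e : lattice → lattice} (he : Function.Bijective e)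
    (hSe : ∀ (γ : lattice) x, S (e γ + x) = γ + S x) :
    MeasurePreserving (fun x => wrap (S x)) cellMeasure cellMeasure := by
  have hm : Measurable fun x => wrap (S x) := measurable_wrap.comp hS.measurable
  refine ⟨hm, ?_⟩
  ext A hA
  rw [Measure.map_apply hm hA, Measure.restrict_apply (hm hA), Measure.restrict_apply hA]
  -- The set S⁻¹(cell) is again a fundamental domain, and a lattice-invariant set meets any two
  -- fundamental domains in equal measure.
  have hfd : IsAddFundamentalDomain lattice (S ⁻¹' cell) volume :=
    isAddFundamentalDomain_cell.preimage_of_equiv hS.quasiMeasurePreserving he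
      (fun γ x => hSe γ x)
  rw [isAddFundamentalDomain_cell.measure_set_eq hfd (hm hA)]
  · have h : (fun x => wrap (S x)) ⁻¹' A ∩ S ⁻¹' cell = S ⁻¹' (A ∩ cell) := by
      ext x
      simp only [Set.mem_inter_iff, Set.mem_preimage]
      constructor
      · rintro ⟨h1, h2⟩; exact ⟨wrap_eq_self h2 ▸ h1, h2⟩
      · rintro ⟨h1, h2⟩; exact ⟨(wrap_eq_self h2).symm ▸ h1, h2⟩
    rw [h, hS.measure_preimage (hA.inter measurableSet_cell).nullMeasurableSet]
  · intro g
    obtain ⟨γ, rfl⟩ := he.2 g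
    ext x
    simp only [Set.mem_preimage]
    have : (e γ +ᵥ x : Plane) = e γ + x := rfl
    rw [this, hSe, wrap_add γ.2]

lemma measurePreserving_wrap_neg :
    MeasurePreserving (fun x => wrap (-x)) cellMeasure cellMeasure :=
  measurePreserving_wrap_comp (Measure.measurePreserving_neg _) neg_involutive.bijective
    (fun γ x => by simp [add_comm])

lemma measurePreserving_wrap_add (v : Plane) :
    MeasurePreserving (fun x => wrap (x + v)) cellMeasure cellMeasure :=
  measurePreserving_wrap_comp (measurePreserving_add_right _ v) Function.bijective_id
    (fun γ x => by simp [add_assoc])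

lemma rot_rot_rot (x : Plane) : rot (rot (rot x)) = x := by
  have h : Real.sqrt 3 ^ 2 = 3 := Real.sq_sqrt (by norm_num)
  ext i
  fin_cases i
  · simp [rot]; ring_nf
    rw [show Real.sqrt 3 ^ 3 = Real.sqrt 3 ^ 2 * Real.sqrt 3 by ring, h]; ring
  · simp [rot]; ring_nf
    rw [show Real.sqrt 3 ^ 3 = Real.sqrt 3 ^ 2 * Real.sqrt 3 by ring, h]; ring

/-- The rotation `rot` as a linear isometry. -/
def rotEquiv : Plane ≃ₗᵢ[ℝ] Plane where
  toFun := rot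
  invFun x := rot (rot x)
  left_inv := rot_rot_rot
  right_inv := rot_rot_rot
  map_add' x y := by ext i; fin_cases i <;> simp [rot] <;> ring
  map_smul' c x := by ext i; fin_cases i <;> simp [rot] <;> ring
  norm_map' x := by
    have h : Real.sqrt 3 ^ 2 = 3 := Real.sq_sqrt (by norm_num)
    rw [EuclideanSpace.norm_eq, EuclideanSpace.norm_eq]
    congr 1
    simp [Fin.sum_univ_two, rot]
    ring_nf
    rw [h]; ring

lemma rot_add (x y : Plane) : rot (x + y) = rot x + rot y := rotEquiv.map_add x y

lemma rot_r₁ : rot r₁ = -r₂ := by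
  have h : Real.sqrt 3 ^ 2 = 3 := Real.sq_sqrt (by norm_num)
  ext i
  fin_cases i
  · simp [rot, r₁, r₂]; ring
  · simp [rot, r₁, r₂]; ring_nf; rw [h]; ring

lemma rot_r₂ : rot r₂ = r₁ - r₂ := by
  have h : Real.sqrt 3 ^ 2 = 3 := Real.sq_sqrt (by norm_num)
  ext i
  fin_cases i
  · simp [rot, r₁, r₂]; ring
  · simp [rot, r₁, r₂]; ring_nf; rw [h]; ring

lemma rot_mem_lattice {γ : Plane} (hγ : γ ∈ lattice) : rot γ ∈ lattice := by
  have h : lattice ≤ lattice.comap (rotEquiv.toLinearEquiv.toLinearMap.restrictScalars ℤ) := by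
    rw [Submodule.span_le]
    rintro _ ⟨i, rfl⟩
    change rot _ ∈ lattice
    fin_cases i
    · simp only [Fin.zero_eta, latticeBasis_zero, rot_r₁]
      exact neg_mem r₂_mem
    · simp only [Fin.mk_one, latticeBasis_one, rot_r₂]
      exact sub_mem r₁_mem r₂_mem
  exact h hγ

lemma measurePreserving_wrap_rot :
    MeasurePreserving (fun x => wrap (rot x)) cellMeasure cellMeasure := by
  refine measurePreserving_wrap_comp rotEquiv.measurePreserving
    -- The lattice bijection has to be the inverse of `rot`, which is its square.
    (e := fun γ => ⟨rot (rot γ), rot_mem_lattice (rot_mem_lattice γ.2)⟩) ⟨?_, ?_⟩ ?_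
  · intro γ γ' h
    have := congrArg (fun z : lattice => rot z) h
    simpa [rot_rot_rot] using this
  · intro γ
    exact ⟨⟨rot γ, rot_mem_lattice γ.2⟩, Subtype.ext (rot_rot_rot γ)⟩
  · intro γ x
    rw [rot_add, rot_rot_rot]

/-- A lattice-invariant property which holds almost everywhere on the cell holds almost
everywhere. -/
lemma ae_of_ae_cell {p : Plane → Prop} (hp : Periodic p) (h : ∀ᵐ x ∂cellMeasure, p x) :
    ∀ᵐ x, p x := by
  rw [ae_iff]
  refine isAddFundamentalDomain_cell.measure_zero_of_invariant _ (fun γ => ?_) ?_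
  · ext x
    rw [Set.mem_vadd_set_iff_neg_vadd_mem]
    have : (-γ +ᵥ x : Plane) = x + -γ := by
      rw [add_comm]; rfl
    simp only [Set.mem_ofPred_eq, this]
    rw [hp.add_lattice (neg_mem γ.2)]
  · rw [ae_iff, Measure.restrict_apply'  measurableSet_cell] at h
    exact h

lemma ae_cell_of_ae {p : Plane → Prop} (h : ∀ᵐ x, p x) : ∀ᵐ x ∂cellMeasure, p x :=
  ae_restrict_of_ae h

/-- Invariance of integrals over the torus. -/
lemma integral_comp_wrap {S : Plane → Plane}
    (hS : MeasurePreserving (fun x => wrap (S x)) cellMeasure cellMeasure) {f : Plane → ℂ}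
    (hf : AEStronglyMeasurable f cellMeasure) (hp : Periodic f) :
    ∫ x in cell, f (S x) = ∫ x in cell, f x := by
  have h := integral_map hS.measurable.aemeasurable (f := f) (by rwa [hS.map_eq])
  rw [hS.map_eq] at h
  rw [h]
  simp only [hp.wrap]

end Honeycomb

end

/-! ### The Fourier basis of L² of the torus. -/

noncomputable section

namespace Honeycomb

open scoped ENNReal

/-- The Hilbert space `L²(ℝ²/Γ)`. -/
abbrev Hil : Type := Lp ℂ 2 cellMeasure

/-- The dual lattice vector with index `n`. -/
def freq (n : Fin 2 → ℤ) : Fin 2 → ℝ :=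
  ![2 * Real.pi * (n 0 + n 1) / Real.sqrt 3, 2 * Real.pi * (n 0 - n 1)]

/-- The exponential with index `n`. -/
def expo (n : Fin 2 → ℤ) (x : Plane) : ℂ :=
  Complex.exp (Complex.I * (freq n 0 * x 0 + freq n 1 * x 1 : ℝ))

lemma expo_add (n : Fin 2 → ℤ) (x y : Plane) : expo n (x + y) = expo n x * expo n y := by
  rw [expo, expo, expo, ← Complex.exp_add]
  congr 1
  simp
  ring

lemma freq_add (m n : Fin 2 → ℤ) : freq (m + n) = freq m + freq n := by
  ext i
  fin_cases i <;> simp [freq] <;> ring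

lemma freq_neg (n : Fin 2 → ℤ) : freq (-n) = -freq n := by
  ext i
  fin_cases i <;> simp [freq] <;> ring

lemma expo_mul (m n : Fin 2 → ℤ) (x : Plane) : expo (m + n) x = expo m x * expo n x := by
  rw [expo, expo, expo, ← Complex.exp_add, freq_add]
  congr 1
  simp
  ring

lemma norm_expo (n : Fin 2 → ℤ) (x : Plane) : ‖expo n x‖ = 1 := by
  rw [expo, mul_comm, Complex.norm_exp_ofReal_mul_I]

lemma conj_expo (n : Fin 2 → ℤ) (x : Plane) :
    (starRingEnd ℂ) (expo n x) = expo (-n) x := by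
  rw [expo, expo, ← Complex.exp_conj, freq_neg]
  congr 1
  simp
  ring

lemma expo_neg (n : Fin 2 → ℤ) (x : Plane) : expo n (-x) = expo (-n) x := by
  rw [expo, expo, freq_neg]
  congr 1
  simp

lemma contDiff_expo (n : Fin 2 → ℤ) : ContDiff ℝ ∞ (expo n) := by
  have h (i : Fin 2) : ContDiff ℝ ∞ fun x : Plane => x i :=
    (EuclideanSpace.proj (𝕜 := ℝ) i).contDiff
  unfold expo
  refine Complex.contDiff_exp.comp ?_
  refine contDiff_const.mul (Complex.ofRealCLM.contDiff.comp ?_)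
  exact (contDiff_const.mul (h 0)).add (contDiff_const.mul (h 1))

lemma continuous_expo (n : Fin 2 → ℤ) : Continuous (expo n) := (contDiff_expo n).continuous

/-- The projection of the plane to the torus `ℝ²/Γ`, identified with `(ℝ/ℤ)²`. -/
def toTorus (x : Plane) : UnitAddTorus (Fin 2) := fun i => (latticeCoords x i : UnitAddCircle)

lemma continuous_toTorus : Continuous toTorus := by
  have h : Continuous latticeCoords :=
    latticeCoords.toLinearMap.continuous_of_finiteDimensional
  exact continuous_pi fun i => (AddCircle.continuous_mk' 1).comp ((continuous_apply i).comp h)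

lemma expo_eq_mFourier (n : Fin 2 → ℤ) (x : Plane) :
    expo n x = UnitAddTorus.mFourier n (toTorus x) := by
  have h : UnitAddTorus.mFourier n (toTorus x)
      = fourier (n 0) (toTorus x 0) * fourier (n 1) (toTorus x 1) := by
    simp [UnitAddTorus.mFourier, Fin.prod_univ_two]
  simp only [h, toTorus]
  rw [fourier_coe_apply, fourier_coe_apply, ← Complex.exp_add, expo]
  congr 1
  simp [latticeCoords, freq]
  ring

lemma toTorus_add_lattice {γ : Plane} (hγ : γ = r₁ ∨ γ = r₂) (x : Plane) :
    toTorus (x + γ) = toTorus x := by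
  funext i
  have : latticeCoords γ i = (0 : ℤ) ∨ latticeCoords γ i = (1 : ℤ) := by
    rw [← latticeBasis_repr]
    rcases hγ with rfl | rfl
    · rw [← latticeBasis_zero]
      fin_cases i <;> simp
    · rw [← latticeBasis_one]
      fin_cases i <;> simp
  simp only [toTorus, map_add, Pi.add_apply]
  rcases this with h | h <;> rw [h] <;> simp

lemma periodic_expo (n : Fin 2 → ℤ) : Periodic (expo n) := fun x => by
  rw [expo_eq_mFourier, expo_eq_mFourier, expo_eq_mFourier,
    toTorus_add_lattice (Or.inl rfl), toTorus_add_lattice (Or.inr rfl)]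
  exact ⟨rfl, rfl⟩

/-- The inverse of the projection `toTorus` on the fundamental cell. -/
def ofTorus (τ : UnitAddTorus (Fin 2)) : Plane :=
  latticeCoords.symm fun i => (AddCircle.measurableEquivIco (1 : ℝ) 0 (τ i) : ℝ)

lemma measurable_ofTorus : Measurable ofTorus := by
  have h2 : Measurable latticeCoords.symm :=
    latticeCoords.symm.toLinearMap.continuous_of_finiteDimensional.measurable
  refine h2.comp (measurable_pi_lambda _ fun i => ?_)
  exact measurable_subtype_coe.comp
    ((AddCircle.measurableEquivIco (1 : ℝ) 0).measurable.comp (measurable_pi_apply i))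

lemma ofTorus_toTorus {x : Plane} (hx : x ∈ cell) : ofTorus (toTorus x) = x := by
  rw [ofTorus, LinearEquiv.symm_apply_eq]
  funext i
  have h : latticeCoords x i ∈ Set.Ico (0 : ℝ) 1 :=
    (ZSpan.mem_fundamentalDomain latticeBasis).1 (cell_eq ▸ hx) i
  change ((AddCircle.equivIco (1 : ℝ) 0 (latticeCoords x i : UnitAddCircle) : Set.Ico (0 : ℝ) (0 + 1)) : ℝ) = _
  rw [AddCircle.coe_equivIco_mk_apply]
  simp [Int.fract_eq_self.2 h]

/-- The area of the fundamental cell. -/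
def area : ℝ := volume.real cell

lemma area_pos : 0 < area :=
  ENNReal.toReal_pos volume_cell_ne_zero isBounded_cell.measure_lt_top.ne

lemma memLp_expo (n : Fin 2 → ℤ) : MemLp (expo n) 2 cellMeasure :=
  MemLp.of_bound (continuous_expo n).aestronglyMeasurable 1
    (Filter.Eventually.of_forall fun x => (norm_expo n x).le)

/-- Translation by v multiplies the integral by `expo n v` without changing it, so a single v with
`expo n v ≠ 1` suffices. A half period along an axis where the frequency is nonzero gives −1. -/
lemma integral_expo_eq_zero {n : Fin 2 → ℤ} (hn : n ≠ 0) : ∫ x in cell, expo n x = 0 := by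
  have key (v : Plane) : (∫ x in cell, expo n x) * expo n v = ∫ x in cell, expo n x := by
    rw [← integral_mul_const]
    simp only [← expo_add]
    exact integral_comp_wrap (measurePreserving_wrap_add v)
      (continuous_expo n).aestronglyMeasurable (periodic_expo n)
  have hex : ∃ v, expo n v ≠ 1 := by
    by_contra! h
    apply hn
    have hz (i : Fin 2) : freq n i = 0 := by
      by_contra h0
      have h1 := h (EuclideanSpace.single i (Real.pi / freq n i))
      have h2 : freq n 0 * (EuclideanSpace.single i (Real.pi / freq n i) : Plane) 0
          + freq n 1 * (EuclideanSpace.single i (Real.pi / freq n i) : Plane) 1 = Real.pi := by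
        fin_cases i
        · simp at h0 ⊢; field_simp
        · simp at h0 ⊢; field_simp
      rw [expo, h2, mul_comm, Complex.exp_pi_mul_I] at h1
      norm_num at h1
    have h0 := hz 0
    have h1 := hz 1
    have hs : Real.sqrt 3 ≠ 0 := by positivity
    simp [freq, Real.pi_ne_zero] at h0 h1
    norm_cast at h0 h1
    ext i
    fin_cases i
    · change n 0 = 0; omega
    · change n 1 = 0; omega
  obtain ⟨v, hv⟩ := hex
  have := key v
  by_contra h0
  exact hv (mul_left_cancel₀ h0 (by rw [this, mul_one]))

/-- The inner product in `L²` of two functions. -/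
lemma inner_toLp {f g : Plane → ℂ} (hf : MemLp f 2 cellMeasure) (hg : MemLp g 2 cellMeasure) :
    inner ℂ (hf.toLp f) (hg.toLp g) = ∫ x in cell, (starRingEnd ℂ) (f x) * g x := by
  rw [L2.inner_def]
  refine integral_congr_ae ?_
  filter_upwards [hf.coeFn_toLp, hg.coeFn_toLp] with x h1 h2
  rw [h1, h2, RCLike.inner_apply, mul_comm]

lemma sqrt_area_mul : ((Real.sqrt area : ℝ) : ℂ)⁻¹ * ((Real.sqrt area : ℝ) : ℂ)⁻¹ = (area : ℂ)⁻¹ := by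
  rw [← mul_inv, ← Complex.ofReal_mul, Real.mul_self_sqrt area_pos.le]

/-- The normalized exponentials. -/
def expoLp (n : Fin 2 → ℤ) : Hil := ((Real.sqrt area : ℝ) : ℂ)⁻¹ • (memLp_expo n).toLp (expo n)

lemma orthonormal_expoLp : Orthonormal ℂ expoLp := by
  rw [orthonormal_iff_ite]
  intro m n
  rw [expoLp, expoLp, inner_smul_left, inner_smul_right, inner_toLp, map_inv₀,
    Complex.conj_ofReal, ← mul_assoc, sqrt_area_mul]
  simp only [conj_expo, ← expo_mul]
  split_ifs with h
  · subst h
    have h1 : ∀ x, expo (-m + m) x = 1 := fun x => by simp [expo, freq]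
    simp only [h1]
    rw [integral_const, measureReal_restrict_apply_univ]
    change (area : ℂ)⁻¹ * (area • (1 : ℂ)) = 1
    have := area_pos.ne'
    simp [this]
  · rw [integral_expo_eq_zero, mul_zero]
    rw [neg_add_eq_sub]
    exact sub_ne_zero.2 (Ne.symm h)

/-- Completeness is transported from (ℝ/ℤ)². Trigonometric polynomials are uniformly dense in the
continuous functions there, hence dense in L² of any finite measure. The pushforward ν of the cell
measure therefore never has to be identified with Haar measure. -/
lemma expoLp_span_orthogonal : (Submodule.span ℂ (Set.range expoLp))ᗮ = ⊥ := by
  rw [eq_bot_iff]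
  intro f hf
  rw [Submodule.mem_bot]
  have hf0 (n : Fin 2 → ℤ) : ∫ x in cell, (starRingEnd ℂ) (expo n x) * f x = 0 := by
    have h1 : inner ℂ (expoLp n) f = 0 := hf _ (Submodule.subset_span ⟨n, rfl⟩)
    rw [expoLp, inner_smul_left, mul_eq_zero] at h1
    have h2 : (starRingEnd ℂ) ((Real.sqrt area : ℝ) : ℂ)⁻¹ ≠ 0 := by
      have := Real.sqrt_ne_zero'.2 area_pos
      simpa using this
    have h3 := h1.resolve_left h2
    have h4 : f = (Lp.memLp f).toLp f := (Lp.toLp_coeFn f _).symm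
    rw [h4, inner_toLp] at h3
    exact h3
  let ν : Measure (UnitAddTorus (Fin 2)) := cellMeasure.map toTorus
  have hψ : MeasurePreserving toTorus cellMeasure ν := ⟨continuous_toTorus.measurable, rfl⟩
  have : IsFiniteMeasure ν := Measure.isFiniteMeasure_map _ _
  let F : UnitAddTorus (Fin 2) → ℂ := fun τ => f (ofTorus τ)
  have hFψ : F ∘ toTorus =ᵐ[cellMeasure] f := by
    filter_upwards [ae_restrict_mem measurableSet_cell] with x hx
    simp only [F, Function.comp, ofTorus_toTorus hx]
  have hFm : AEStronglyMeasurable F ν :=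
    ((Lp.stronglyMeasurable f).comp_measurable measurable_ofTorus).aestronglyMeasurable
  have hF : MemLp F 2 ν := by
    rw [memLp_map_measure_iff hFm hψ.measurable.aemeasurable]
    exact (memLp_congr_ae hFψ).2 (Lp.memLp f)
  have hperp : hF.toLp F ∈ (Submodule.span ℂ (Set.range
      fun n => ContinuousMap.toLp (E := ℂ) 2 ν ℂ (UnitAddTorus.mFourier n)))ᗮ := by
    rw [Submodule.mem_orthogonal]
    intro u hu
    induction hu using Submodule.span_induction with
    | mem u hu =>
      obtain ⟨n, rfl⟩ := hu
      rw [L2.inner_def]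
      have h1 : ∫ τ, inner ℂ ((ContinuousMap.toLp (E := ℂ) 2 ν ℂ (UnitAddTorus.mFourier n)) τ)
          ((hF.toLp F) τ) ∂ν = ∫ τ, (starRingEnd ℂ) (UnitAddTorus.mFourier n τ) * F τ ∂ν := by
        refine integral_congr_ae ?_
        filter_upwards [hF.coeFn_toLp, ContinuousMap.coeFn_toLp (𝕜 := ℂ) (p := 2) ν
          (UnitAddTorus.mFourier n)] with x h1 h2
        rw [h1, h2, RCLike.inner_apply, mul_comm]
      rw [h1, integral_map hψ.measurable.aemeasurable, ← hf0 n]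
      · refine integral_congr_ae ?_
        filter_upwards [hFψ] with x hx
        rw [expo_eq_mFourier, ← hx]
        rfl
      · exact (Complex.continuous_conj.comp (map_continuous _)).aestronglyMeasurable.mul hFm
    | zero => simp
    | add x y _ _ hx hy => rw [inner_add_left, hx, hy, add_zero]
    | smul a x _ hx => rw [inner_smul_left, hx, mul_zero]
  have hdense : (Submodule.span ℂ (Set.range
      fun n => ContinuousMap.toLp (E := ℂ) 2 ν ℂ (UnitAddTorus.mFourier n))).topologicalClosure
      = ⊤ := by
    simpa only [Submodule.map_span, ContinuousLinearMap.coe_coe, ← Set.range_comp,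
      Function.comp_def] using
      (ContinuousMap.toLp_denseRange ℂ ν ℂ (p := 2) (by simp)).topologicalClosure_map_submodule
        (UnitAddTorus.span_mFourier_closure_eq_top (d := Fin 2))
  rw [Submodule.topologicalClosure_eq_top_iff.1 hdense, Submodule.mem_bot] at hperp
  have hF0 : F =ᵐ[ν] 0 := (hF.coeFn_toLp).symm.trans (by rw [hperp]; exact Lp.coeFn_zero _ _ _)
  rw [Lp.eq_zero_iff_ae_eq_zero]
  exact hFψ.symm.trans (hψ.quasiMeasurePreserving.ae_eq_comp hF0)

/-- The Fourier basis of `L²(ℝ²/Γ)`. -/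
def fourierHB : HilbertBasis (Fin 2 → ℤ) ℂ Hil :=
  HilbertBasis.mkOfOrthogonalEqBot orthonormal_expoLp expoLp_span_orthogonal

lemma fourierHB_apply (n : Fin 2 → ℤ) : fourierHB n = expoLp n := by
  rw [fourierHB, HilbertBasis.coe_mkOfOrthogonalEqBot]

/-- The (unnormalized) Fourier coefficients of a function. -/
def coef (f : Plane → ℂ) (n : Fin 2 → ℤ) : ℂ := ∫ x in cell, (starRingEnd ℂ) (expo n x) * f x

lemma repr_toLp {f : Plane → ℂ} (hf : MemLp f 2 cellMeasure) (n : Fin 2 → ℤ) :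
    fourierHB.repr (hf.toLp f) n = ((Real.sqrt area : ℝ) : ℂ)⁻¹ * coef f n := by
  rw [HilbertBasis.repr_apply_apply, fourierHB_apply, expoLp, inner_smul_left, inner_toLp, map_inv₀,
    Complex.conj_ofReal, coef]

lemma coef_congr {f g : Plane → ℂ} (h : f =ᵐ[cellMeasure] g) (n : Fin 2 → ℤ) :
    coef f n = coef g n :=
  integral_congr_ae (h.mono fun x hx => by simp only [hx])

lemma coef_eq_repr {f : Plane → ℂ} {u : Hil} (h : f =ᵐ[cellMeasure] u) (n : Fin 2 → ℤ) :
    coef f n = (Real.sqrt area : ℝ) * fourierHB.repr u n := by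
  have h1 := repr_toLp (Lp.memLp u) n
  rw [Lp.toLp_coeFn] at h1
  have := Real.sqrt_ne_zero'.2 area_pos
  rw [h1, coef_congr h, ← mul_assoc, mul_inv_cancel₀ (by exact_mod_cast this), one_mul]

end Honeycomb

end

/-! ### Weak derivatives and the eigenvalue equation in Fourier coefficients. -/

noncomputable section

namespace Honeycomb

open scoped ENNReal

lemma isCompact_closure_cell : IsCompact (closure cell) := isBounded_cell.isCompact_closure

/-- A continuous lattice-periodic function is bounded. -/
lemma Periodic.exists_bound {E : Type} [SeminormedAddCommGroup E] {f : Plane → E} (hf : Periodic f)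
    (hc : Continuous f) : ∃ C, ∀ x, ‖f x‖ ≤ C := by
  obtain ⟨C, hC⟩ := isCompact_closure_cell.exists_bound_of_continuousOn hc.continuousOn
  exact ⟨C, fun x => by rw [← hf.wrap x]; exact hC _ (subset_closure (wrap_mem x))⟩

lemma Periodic.memLp {f : Plane → ℂ} (hf : Periodic f) (hc : Continuous f) :
    MemLp f 2 cellMeasure := by
  obtain ⟨C, hC⟩ := hf.exists_bound hc
  exact MemLp.of_bound hc.aestronglyMeasurable C (Filter.Eventually.of_forall hC)

lemma Periodic.fderiv {f : Plane → ℂ} (hf : Periodic f) (v : Plane) :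
    Periodic fun x => fderiv ℝ f x v := fun x => by
  have h1 : (fun y => f (y + r₁)) = f := funext fun y => (hf y).1
  have h2 : (fun y => f (y + r₂)) = f := funext fun y => (hf y).2
  beta_reduce
  constructor
  · rw [← fderiv_comp_add_right, h1]
  · rw [← fderiv_comp_add_right, h2]

/-- The integral of f(x + tv) over the cell does not depend on t. Differentiating under the integral
at t = 0 gives the claim without boundary terms. -/
lemma integral_fderiv_eq_zero {f : Plane → ℂ} (hf : Periodic f) (hs : ContDiff ℝ ∞ f) (v : Plane) :
    ∫ x in cell, fderiv ℝ f x v = 0 := by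
  have hdc : Continuous fun x => fderiv ℝ f x v :=
    (hs.continuous_fderiv (by simp)).clm_apply continuous_const
  obtain ⟨C, hC⟩ := (hf.fderiv v).exists_bound hdc
  have hline (x : Plane) (t : ℝ) : Continuous fun y : Plane => y + t • v := by fun_prop
  have h := hasDerivAt_integral_of_dominated_loc_of_deriv_le (μ := cellMeasure) (𝕜 := ℝ)
    (F := fun (t : ℝ) x => f (x + t • v)) (F' := fun (t : ℝ) x => fderiv ℝ f (x + t • v) v)
    (x₀ := 0) (s := Set.univ) (bound := fun _ => C) Filter.univ_mem
    (Filter.Eventually.of_forall fun t =>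
      (hs.continuous.comp (hline 0 t)).aestronglyMeasurable)
    (by simpa using (hf.memLp hs.continuous).integrable (by norm_num))
    ((hdc.comp (hline 0 0)).aestronglyMeasurable)
    (Filter.Eventually.of_forall fun x t _ => hC _) (integrable_const _)
    (Filter.Eventually.of_forall fun x t _ => by
      have h1 : HasDerivAt (fun t : ℝ => x + t • v) v t := by
        simpa using ((hasDerivAt_id t).smul_const v).const_add x
      have h2 := ((hs.differentiable (by simp)) (x + t • v)).hasFDerivAt
      exact h2.comp_hasDerivAt t h1)
  have hconst : (fun t : ℝ => ∫ x in cell, f (x + t • v)) = fun _ => ∫ x in cell, f x :=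
    funext fun t => integral_comp_wrap (measurePreserving_wrap_add _)
      hs.continuous.aestronglyMeasurable hf
  have h2 := h.2
  rw [hconst] at h2
  simpa using h2.unique (hasDerivAt_const _ _)

lemma fderiv_expo (n : Fin 2 → ℤ) (x : Plane) (i : Fin 2) :
    fderiv ℝ (expo n) x (EuclideanSpace.single i 1) = Complex.I * freq n i * expo n x := by
  have h (j : Fin 2) : HasFDerivAt (fun y : Plane => y j) (EuclideanSpace.proj (𝕜 := ℝ) j) x :=
    (EuclideanSpace.proj (𝕜 := ℝ) j).hasFDerivAt
  have h1 := ((h 0).const_mul (freq n 0)).add ((h 1).const_mul (freq n 1))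
  have h2 := ((Complex.ofRealCLM.hasFDerivAt.comp x h1).const_mul Complex.I).cexp
  have h3 : HasFDerivAt (expo n) _ x := h2
  rw [h3.fderiv]
  fin_cases i <;> simp [expo] <;> ring

lemma integrable_conj_expo_mul {f : Plane → ℂ} (hf : MemLp f 2 cellMeasure) (n : Fin 2 → ℤ) :
    Integrable (fun x => (starRingEnd ℂ) (expo n x) * f x) cellMeasure := by
  refine (hf.integrable (by norm_num)).bdd_mul (c := 1)
    (Complex.continuous_conj.comp (continuous_expo n)).aestronglyMeasurable ?_
  exact Filter.Eventually.of_forall fun x => by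
    exact (RCLike.norm_conj _).trans_le (norm_expo n x).le

lemma coef_add {f g : Plane → ℂ} (hf : MemLp f 2 cellMeasure) (hg : MemLp g 2 cellMeasure)
    (n : Fin 2 → ℤ) : coef (fun x => f x + g x) n = coef f n + coef g n := by
  simp only [coef, mul_add]
  exact integral_add (integrable_conj_expo_mul hf n) (integrable_conj_expo_mul hg n)

lemma coef_const_mul (c : ℂ) (f : Plane → ℂ) (n : Fin 2 → ℤ) :
    coef (fun x => c * f x) n = c * coef f n := by
  simp only [coef, mul_left_comm _ c]
  exact integral_const_mul _ _

/-- The Fourier symbol of `-(∇ + iK)²`. -/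
def symb (n : Fin 2 → ℤ) : ℝ := ∑ j, (freq n j + diracK j) ^ 2

lemma symb_nonneg (n : Fin 2 → ℤ) : 0 ≤ symb n := Finset.sum_nonneg fun _ _ => sq_nonneg _

lemma HasWeakPartial.coef_eq {i : Fin 2} {f g : Plane → ℂ} (h : HasWeakPartial i f g)
    (n : Fin 2 → ℤ) : coef g n = Complex.I * freq n i * coef f n := by
  have h1 := h.integral_eq (expo (-n)) (contDiff_expo _) (periodic_expo _)
  simp only [fderiv_expo, freq_neg] at h1
  have h2 : coef g n = ∫ x in cell, g x * expo (-n) x := by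
    simp only [coef, conj_expo, mul_comm]
  have h3 : ∫ x in cell, f x * (Complex.I * ((-freq n) i : ℝ) * expo (-n) x)
      = (Complex.I * ((-freq n) i : ℝ)) * coef f n := by
    rw [coef, ← integral_const_mul]
    refine integral_congr_ae (Filter.Eventually.of_forall fun x => ?_)
    simp only [conj_expo]
    ring
  rw [h2, ← neg_neg (∫ x in cell, g x * expo (-n) x), ← h1, h3]
  simp

/-- The Fourier form of the eigenvalue equation. -/
lemma IsEigenfunction.coef_eq {W : Plane → ℝ} {E : ℂ} {f : Plane → ℂ} (h : IsEigenfunction W E f) :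
    MemL2 f ∧ MemLp (fun x => (E - W x) * f x) 2 cellMeasure ∧
      ∀ n, symb n * coef f n = coef (fun x => (E - W x) * f x) n := by
  obtain ⟨g, hh, hj, heq⟩ := h.equation
  have hf : MemL2 f := (hj.grad 0).memL2
  have hg (j : Fin 2) := (hj.grad j).memL2_partial.memLp
  have hh' (j : Fin 2) := (hj.hess j j).memL2_partial.memLp
  let t (j : Fin 2) (x : Plane) : ℂ :=
    (-1) * hh j j x + ((-(2 * Complex.I * (diracK j : ℂ))) * g j x + (diracK j : ℂ) ^ 2 * f x)
  have ht (j : Fin 2) : MemLp (t j) 2 cellMeasure :=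
    ((hh' j).const_mul _).add (((hg j).const_mul _).add (hf.memLp.const_mul _))
  have hcoef (j : Fin 2) (n : Fin 2 → ℤ) :
      coef (t j) n = ((freq n j + diracK j : ℝ) : ℂ) ^ 2 * coef f n := by
    rw [show coef (t j) n = _ from
        coef_add ((hh' j).const_mul _) (((hg j).const_mul _).add (hf.memLp.const_mul _)) n,
      show coef ((fun x => _ * g j x) + fun x => _ * f x) n = _ from
        coef_add ((hg j).const_mul _) (hf.memLp.const_mul _) n, coef_const_mul, coef_const_mul,
      coef_const_mul, (hj.hess j j).coef_eq, (hj.grad j).coef_eq]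
    push_cast
    linear_combination (-(freq n j : ℂ) ^ 2 - 2 * diracK j * freq n j) * coef f n * Complex.I_sq
  -- Neither boundedness nor measurability of W is assumed: that (E − W) f is square integrable is
  -- read off from the differential side of the equation.
  have hae : (fun x => (E - W x) * f x) =ᵐ[cellMeasure] fun x => t 0 x + t 1 x := by
    filter_upwards [ae_cell_of_ae heq] with x hx
    rw [Fin.sum_univ_two] at hx
    simp only [t]
    linear_combination -hx
  refine ⟨hf, (memLp_congr_ae hae).2 ((ht 0).add (ht 1)), fun n => ?_⟩
  rw [coef_congr hae, coef_add (ht 0) (ht 1), hcoef, hcoef, symb, Fin.sum_univ_two]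
  push_cast
  ring

lemma coef_fderiv {ζ : Plane → ℂ} (hp : Periodic ζ) (hs : ContDiff ℝ ∞ ζ) (i : Fin 2)
    (n : Fin 2 → ℤ) :
    coef (fun x => fderiv ℝ ζ x (EuclideanSpace.single i 1)) n
      = Complex.I * freq n i * coef ζ n := by
  set v : Plane := EuclideanSpace.single i 1
  have hprod : Periodic fun x => expo (-n) x * ζ x := fun x => by
    have h1 := periodic_expo (-n) x
    have h2 := hp x
    simp only [h1.1, h1.2, h2.1, h2.2, and_self]
  have h := integral_fderiv_eq_zero hprod ((contDiff_expo (-n)).mul hs) v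
  have hd (x : Plane) : fderiv ℝ (fun x => expo (-n) x * ζ x) x v
      = (starRingEnd ℂ) (expo n x) * fderiv ℝ ζ x v
        + (-(Complex.I * freq n i)) * ((starRingEnd ℂ) (expo n x) * ζ x) := by
    rw [fderiv_fun_mul ((contDiff_expo (-n)).differentiable (by simp) x)
      (hs.differentiable (by simp) x)]
    simp only [add_apply, smul_apply, smul_eq_mul]
    rw [fderiv_expo, freq_neg, conj_expo]
    simp
    ring
  have hdc : Continuous fun x => fderiv ℝ ζ x v :=
    (hs.continuous_fderiv (by simp)).clm_apply continuous_const
  simp only [hd] at h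
  rw [integral_add (integrable_conj_expo_mul ((hp.fderiv v).memLp hdc) n)
    ((integrable_conj_expo_mul (hp.memLp hs.continuous) n).const_mul _), integral_const_mul] at h
  rw [coef, coef]
  linear_combination h

/-- The periodic function represented by an element of `L²(ℝ²/Γ)`. -/
def lift (u : Hil) (x : Plane) : ℂ := u (wrap x)

lemma lift_ae (u : Hil) : lift u =ᵐ[cellMeasure] u := by
  filter_upwards [ae_restrict_mem measurableSet_cell] with x hx
  rw [lift, wrap_eq_self hx]

lemma memL2_lift (u : Hil) : MemL2 (lift u) :=
  ⟨wrap_periodic u, (memLp_congr_ae (lift_ae u)).2 (Lp.memLp u)⟩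

lemma toLp_lift (u : Hil) : (memL2_lift u).memLp.toLp (lift u) = u := by
  rw [← Lp.toLp_coeFn u (Lp.memLp u)]
  exact (MemLp.toLp_eq_toLp_iff _ _).2 (by simpa using lift_ae u)

lemma inner_eq_tsum (u v : Hil) :
    inner ℂ u v = ∑' n, (starRingEnd ℂ) (fourierHB.repr u n) * fourierHB.repr v n := by
  rw [← fourierHB.tsum_inner_mul_inner]
  refine tsum_congr fun n => ?_
  rw [HilbertBasis.repr_apply_apply, HilbertBasis.repr_apply_apply, inner_conj_symm]

/-- By Parseval the defining identity can be checked frequency by frequency. The sign of the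
integration by parts comes from conjugating the factor i·`freq n i`. -/
lemma hasWeakPartial_lift {i : Fin 2} {u v : Hil}
    (h : ∀ n, fourierHB.repr v n = Complex.I * freq n i * fourierHB.repr u n) :
    HasWeakPartial i (lift u) (lift v) := by
  refine ⟨memL2_lift u, memL2_lift v, fun η hη hp => ?_⟩
  set e : Plane := EuclideanSpace.single i 1
  let ζ : Plane → ℂ := fun x => (starRingEnd ℂ) (η x)
  have hζ : ContDiff ℝ ∞ ζ := Complex.conjCLE.contDiff.comp hη
  have hζp : Periodic ζ := fun x => by simp only [ζ, (hp x).1, (hp x).2, and_self]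
  have hd (x : Plane) : fderiv ℝ ζ x e = (starRingEnd ℂ) (fderiv ℝ η x e) := by
    have h1 : HasFDerivAt ζ _ x := Complex.conjCLE.hasFDerivAt.comp x
      ((hη.differentiable (by simp)) x).hasFDerivAt
    rw [h1.fderiv]
    simp
  have hdc : Continuous fun x => fderiv ℝ ζ x e :=
    (hζ.continuous_fderiv (by simp)).clm_apply continuous_const
  have m1 : MemLp (fun x => fderiv ℝ ζ x e) 2 cellMeasure := (hζp.fderiv e).memLp hdc
  have m2 : MemLp ζ 2 cellMeasure := hζp.memLp hζ.continuous
  have e1 : ∫ x in cell, lift u x * fderiv ℝ η x e = inner ℂ (m1.toLp _) u := by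
    conv_rhs => rw [← toLp_lift u]
    rw [inner_toLp]
    refine integral_congr_ae (Filter.Eventually.of_forall fun x => ?_)
    simp only [hd, Complex.conj_conj, mul_comm]
  have e2 : ∫ x in cell, lift v x * η x = inner ℂ (m2.toLp _) v := by
    conv_rhs => rw [← toLp_lift v]
    rw [inner_toLp]
    refine integral_congr_ae (Filter.Eventually.of_forall fun x => ?_)
    simp only [ζ, Complex.conj_conj, mul_comm]
  rw [e1, e2, inner_eq_tsum, inner_eq_tsum, ← tsum_neg]
  refine tsum_congr fun n => ?_
  rw [repr_toLp, repr_toLp, coef_fderiv hζp hζ, h]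
  simp
  ring

/-- From k = (k + K) − K one gets k² ≤ 2(k + K)² + 2K². This control of second derivatives by the
symbol is what yields H² regularity. -/
lemma freq_sq_le (n : Fin 2 → ℤ) (i : Fin 2) :
    freq n i ^ 2 ≤ (2 + 2 * (4 * Real.pi / 3) ^ 2) * (symb n + 1) := by
  have h1 : (freq n i + diracK i) ^ 2 ≤ symb n :=
    Finset.single_le_sum (f := fun j => (freq n j + diracK j) ^ 2) (fun _ _ => sq_nonneg _)
      (Finset.mem_univ i)
  have h2 : (diracK i) ^ 2 ≤ (4 * Real.pi / 3) ^ 2 := by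
    fin_cases i
    · simp [diracK]; positivity
    · simp [diracK]
  nlinarith [sq_nonneg (freq n i + 2 * diracK i), symb_nonneg n,
    mul_nonneg (sq_nonneg (4 * Real.pi / 3)) (symb_nonneg n)]

/-- Coefficients dominated by those of an `L²` function are coefficients of an `L²` function. -/
lemma exists_repr_eq {c : (Fin 2 → ℤ) → ℂ} {C : ℝ} (w : Hil)
    (h : ∀ n, ‖c n‖ ≤ C * ‖fourierHB.repr w n‖) : ∃ v : Hil, ∀ n, fourierHB.repr v n = c n := by
  have hw := (fourierHB.repr w).2.summable (by norm_num : 0 < (2 : ℝ≥0∞).toReal)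
  have hc : Memℓp c 2 := by
    refine memℓp_gen (Summable.of_nonneg_of_le (fun _ => by positivity) (fun n => ?_)
      (hw.mul_left (C ^ 2)))
    simp only [ENNReal.toReal_ofNat, Real.rpow_ofNat]
    rw [← mul_pow]
    exact pow_le_pow_left₀ (norm_nonneg _) (h n) 2
  exact ⟨fourierHB.repr.symm ⟨c, hc⟩, fun n => by rw [LinearIsometryEquiv.apply_symm_apply]⟩

/-- A nonzero solution of the Fourier form of the eigenvalue equation is an eigenfunction. -/
lemma isEigenfunction_lift {W : Plane → ℝ} (hW : Periodic W) {E : ℂ} {u w : Hil} (hu : u ≠ 0)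
    (hw : w =ᵐ[cellMeasure] fun x => (E - W x) * u x)
    (h : ∀ n, symb n * fourierHB.repr u n = fourierHB.repr w n) :
    IsEigenfunction W E (lift u) := by
  -- Elliptic regularity: the coefficients of w + u are `symb n + 1` times those of u, so they
  -- dominate the coefficients of all first and second derivatives of u.
  have hdom (n : Fin 2 → ℤ) : (symb n + 1) * ‖fourierHB.repr u n‖
      = ‖fourierHB.repr (w + u) n‖ := by
    rw [map_add, lp.coeFn_add, Pi.add_apply, ← h]
    rw [show (symb n : ℂ) * fourierHB.repr u n + fourierHB.repr u n
      = ((symb n + 1 : ℝ) : ℂ) * fourierHB.repr u n by push_cast; ring, norm_mul,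
      Complex.norm_real, Real.norm_of_nonneg (by linarith [symb_nonneg n])]
  set C : ℝ := 2 + 2 * (4 * Real.pi / 3) ^ 2
  have hC : 2 ≤ C := le_add_of_nonneg_right (by positivity)
  have hg (i : Fin 2) : ∃ v : Hil, ∀ n,
      fourierHB.repr v n = Complex.I * freq n i * fourierHB.repr u n := by
    refine exists_repr_eq (C := C) (w + u) fun n => ?_
    rw [← hdom, ← mul_assoc, norm_mul, norm_mul, Complex.norm_I, one_mul, Complex.norm_real]
    refine mul_le_mul_of_nonneg_right ?_ (norm_nonneg _)
    rw [Real.norm_eq_abs]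
    have h1 : freq n i ^ 2 ≤ C * (symb n + 1) := freq_sq_le n i
    have h2 : 0 ≤ C * symb n := mul_nonneg (by linarith) (symb_nonneg n)
    linarith [sq_nonneg (|freq n i| - 1), sq_abs (freq n i)]
  choose g hg using hg
  have hh (i j : Fin 2) : ∃ v : Hil, ∀ n,
      fourierHB.repr v n = Complex.I * freq n j * fourierHB.repr (g i) n := by
    refine exists_repr_eq (C := C) (w + u) fun n => ?_
    rw [hg, ← hdom, ← mul_assoc C]
    simp only [norm_mul, Complex.norm_I, one_mul, Complex.norm_real, Real.norm_eq_abs]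
    rw [← mul_assoc]
    refine mul_le_mul_of_nonneg_right ?_ (norm_nonneg _)
    have h1 : freq n i ^ 2 ≤ C * (symb n + 1) := freq_sq_le n i
    have h2 : freq n j ^ 2 ≤ C * (symb n + 1) := freq_sq_le n j
    linarith [sq_nonneg (|freq n i| - |freq n j|), sq_abs (freq n i), sq_abs (freq n j)]
  choose hs hhs using hh
  have hper : Periodic (lift u) := (memL2_lift u).periodic
  refine ⟨fun h0 => hu ?_, fun i => lift (g i), fun i j => lift (hs i j),
    ⟨fun i => hasWeakPartial_lift (hg i), fun i j => hasWeakPartial_lift (hhs i j)⟩, ?_⟩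
  · rw [Lp.eq_zero_iff_ae_eq_zero]
    exact (lift_ae u).symm.trans (ae_restrict_of_ae h0)
  · refine ae_of_ae_cell (fun x => ?_) ?_
    · have p1 (v : Hil) := (memL2_lift v).periodic x
      simp only [(p1 _).1, (p1 _).2, (hW x).1, (hW x).2, and_self]
    let z (j : Fin 2) : Hil := hs j j + (2 * Complex.I * (diracK j : ℂ)) • g j
      - ((diracK j : ℂ) ^ 2) • u
    have hz : w = -(z 0 + z 1) := by
      apply fourierHB.repr.injective
      ext n
      rw [← h]
      simp only [z, map_neg, map_add, map_sub, map_smul, lp.coeFn_neg, lp.coeFn_add, lp.coeFn_sub,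
        lp.coeFn_smul, Pi.neg_apply, Pi.add_apply, Pi.sub_apply, Pi.smul_apply, smul_eq_mul, hhs,
        hg]
      rw [symb, Fin.sum_univ_two]
      push_cast
      linear_combination ((freq n 0 : ℂ) ^ 2 + freq n 1 ^ 2 + 2 * diracK 0 * freq n 0
        + 2 * diracK 1 * freq n 1) * fourierHB.repr u n * Complex.I_sq
    have hz' (j : Fin 2) : ∀ᵐ x ∂cellMeasure, z j x = hs j j x
        + (2 * Complex.I * (diracK j : ℂ)) * g j x - (diracK j : ℂ) ^ 2 * u x := by
      filter_upwards [Lp.coeFn_sub (hs j j + (2 * Complex.I * (diracK j : ℂ)) • g j)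
          (((diracK j : ℂ) ^ 2) • u),
        Lp.coeFn_add (hs j j) ((2 * Complex.I * (diracK j : ℂ)) • g j),
        Lp.coeFn_smul (2 * Complex.I * (diracK j : ℂ)) (g j),
        Lp.coeFn_smul ((diracK j : ℂ) ^ 2) u] with x a1 a2 a3 a4
      simp only [Pi.sub_apply, Pi.add_apply, Pi.smul_apply, smul_eq_mul] at a1 a2 a3 a4
      rw [a1, a2, a3, a4]
    have hw2 : ∀ᵐ x ∂cellMeasure, w x = -(z 0 x + z 1 x) := by
      rw [hz]
      filter_upwards [Lp.coeFn_neg (z 0 + z 1), Lp.coeFn_add (z 0) (z 1)] with x a1 a2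
      rw [a1, Pi.neg_apply, a2, Pi.add_apply]
    filter_upwards [hw, hw2, hz' 0, hz' 1, lift_ae u, lift_ae (g 0), lift_ae (g 1),
      lift_ae (hs 0 0), lift_ae (hs 1 1)] with x a1 a2 a3 a4 b1 b2 b3 b4 b5
    rw [Fin.sum_univ_two, b1, b2, b3, b4, b5]
    rw [a1, a3, a4] at a2
    linear_combination -a2

end Honeycomb

end

/-! ### The resolvent: compactness, sup bounds and the spectral gap. -/

noncomputable section

namespace Honeycomb

open scoped ENNReal Topology
open Filter

/-- Multiplication by a bounded function as a bounded operator on `L²(ℝ²/Γ)`. -/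
lemma exists_mulOp {w : Plane → ℂ} (hw : AEStronglyMeasurable w cellMeasure) {C : ℝ}
    (hC : ∀ x, ‖w x‖ ≤ C) : ∃ Q : Hil →L[ℂ] Hil, ∀ u, Q u =ᵐ[cellMeasure] fun x => w x * u x := by
  have hle (u : Hil) : ∀ᵐ x ∂cellMeasure, ‖w x * u x‖ ≤ C * ‖u x‖ :=
    Eventually.of_forall fun x => by
      rw [norm_mul]
      exact mul_le_mul_of_nonneg_right (hC x) (norm_nonneg _)
  have hm (u : Hil) : MemLp (fun x => w x * u x) 2 cellMeasure :=
    (Lp.memLp u).of_le_mul (hw.mul (Lp.aestronglyMeasurable u)) (hle u)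
  let Q : Hil →ₗ[ℂ] Hil :=
    { toFun := fun u => (hm u).toLp _
      map_add' := fun u v => by
        rw [← MemLp.toLp_add, MemLp.toLp_eq_toLp_iff]
        filter_upwards [Lp.coeFn_add u v] with x hx
        rw [hx, Pi.add_apply, Pi.add_apply, mul_add]
      map_smul' := fun c u => by
        rw [RingHom.id_apply, ← MemLp.toLp_const_smul, MemLp.toLp_eq_toLp_iff]
        filter_upwards [Lp.coeFn_smul c u] with x hx
        rw [hx, Pi.smul_apply, Pi.smul_apply, smul_eq_mul, smul_eq_mul]
        ring }
  refine ⟨Q.mkContinuous C fun u => ?_, fun u => (hm u).coeFn_toLp⟩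
  refine Lp.norm_le_mul_norm_of_ae_le_mul ?_
  filter_upwards [hle u, (hm u).coeFn_toLp] with x h1 h2
  exact (congrArg norm h2).trans_le h1

lemma norm_le_of_repr_le {u v : Hil} {c : ℝ}
    (h : ∀ n, ‖fourierHB.repr u n‖ ≤ c * ‖fourierHB.repr v n‖) : ‖u‖ ≤ |c| * ‖v‖ := by
  rw [← fourierHB.repr.norm_map u, ← fourierHB.repr.norm_map v, ← Real.norm_eq_abs,
    show ‖c‖ = ‖(c : ℂ)‖ by simp, ← norm_smul]
  refine lp.norm_mono (by norm_num) fun n => (h n).trans ?_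
  rw [lp.coeFn_smul, Pi.smul_apply, norm_smul, Complex.norm_real]
  exact mul_le_mul_of_nonneg_right (le_abs_self c) (norm_nonneg _)

/-- The multiplier of the resolvent `(1 - (∇ + iK)²)⁻¹`. -/
def resSymb (n : Fin 2 → ℤ) : ℝ := (symb n + 1)⁻¹

lemma resSymb_pos (n : Fin 2 → ℤ) : 0 < resSymb n :=
  inv_pos.2 (by linarith [symb_nonneg n])

lemma resSymb_le_one (n : Fin 2 → ℤ) : resSymb n ≤ 1 :=
  inv_le_one_of_one_le₀ (by linarith [symb_nonneg n])

lemma symb_add_one_mul (n : Fin 2 → ℤ) : (symb n + 1) * resSymb n = 1 :=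
  mul_inv_cancel₀ (by linarith [symb_nonneg n])

lemma le_symb_add_one (n : Fin 2 → ℤ) :
    (2 / 3) * (1 + (n 0 : ℝ) ^ 2 + (n 1 : ℝ) ^ 2) ≤ symb n + 1 := by
  have hs : Real.sqrt 3 ^ 2 = 3 := Real.sq_sqrt (by norm_num)
  have hs0 : Real.sqrt 3 ≠ 0 := by positivity
  have h : symb n = (2 * Real.pi) ^ 2
      * (((n 0 : ℝ) + n 1) ^ 2 / 3 + ((n 0 : ℝ) - n 1 + 2 / 3) ^ 2) := by
    simp only [symb, Fin.sum_univ_two, freq, diracK]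
    simp
    rw [div_pow, hs]
    ring
  have h1 : (1 : ℝ) ≤ (2 * Real.pi) ^ 2 := by nlinarith [Real.pi_gt_three]
  have h2 : 0 ≤ ((n 0 : ℝ) + n 1) ^ 2 / 3 + ((n 0 : ℝ) - n 1 + 2 / 3) ^ 2 := by positivity
  have h3 := mul_le_mul_of_nonneg_right h1 h2
  rw [h]
  nlinarith [sq_nonneg ((n 0 : ℝ) - n 1 + 1)]

/-- The symbol grows quadratically on a two-dimensional lattice, so the squares decay with exponent
4 > 2. The comparison series is a product of two one-dimensional ones, via (1 + a + b)² ≥ (1 + a)(1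
+ b). Both the compactness of the resolvent and its L² to L^∞ bound rest on this. -/
lemma summable_resSymb_sq : Summable fun n => resSymb n ^ 2 := by
  have h1 : Summable fun k : ℤ => (1 + (k : ℝ) ^ 2)⁻¹ := by
    have h0 : Summable fun k : ℤ => 1 / (k : ℝ) ^ 2 :=
      Real.summable_one_div_int_pow.2 (by norm_num)
    refine (summable_of_ne_finset_zero (f := fun k : ℤ => if k = 0 then (1 : ℝ) else 0) (s := {0})
      (fun k hk => by simp_all) |>.add h0).of_nonneg_of_le (fun k => by positivity) fun k => ?_
    by_cases hk : k = 0
    · simp [hk]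
    · have : (0 : ℝ) < (k : ℝ) ^ 2 := by positivity
      simp only [hk, if_false, zero_add, one_div]
      exact inv_anti₀ this (by linarith)
  have h2 : Summable fun p : ℤ × ℤ => (1 + (p.1 : ℝ) ^ 2)⁻¹ * (1 + (p.2 : ℝ) ^ 2)⁻¹ :=
    h1.mul_of_nonneg h1 (fun k => by positivity) (fun k => by positivity)
  have h3 := (finTwoArrowEquiv ℤ).summable_iff.2 h2
  refine (h3.mul_left (9 / 4)).of_nonneg_of_le (fun n => by positivity) fun n => ?_
  have hle := le_symb_add_one n
  change ((symb n + 1)⁻¹) ^ 2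
    ≤ 9 / 4 * ((1 + (n 0 : ℝ) ^ 2)⁻¹ * (1 + (n 1 : ℝ) ^ 2)⁻¹)
  set s := symb n + 1
  set a := (n 0 : ℝ) ^ 2 with ha
  set b := (n 1 : ℝ) ^ 2 with hb
  have ha0 : 0 ≤ a := sq_nonneg _
  have hb0 : 0 ≤ b := sq_nonneg _
  have hs : 0 < s := by linarith
  rw [← mul_inv, ← inv_inv (9 / 4 : ℝ), ← mul_inv, inv_pow]
  refine inv_anti₀ (by positivity) ?_
  have : (2 / 3 * (1 + a + b)) ^ 2 ≤ s ^ 2 := pow_le_pow_left₀ (by positivity) hle 2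
  nlinarith [mul_nonneg ha0 hb0]

/-- The resolvent `(1 - (∇ + iK)²)⁻¹` on `L²(ℝ²/Γ)`. -/
lemma exists_resolvent : ∃ G : Hil →L[ℂ] Hil,
    ∀ f n, fourierHB.repr (G f) n = resSymb n * fourierHB.repr f n := by
  have h (f : Hil) : ∃ v : Hil, ∀ n, fourierHB.repr v n = resSymb n * fourierHB.repr f n := by
    refine exists_repr_eq (C := 1) f fun n => ?_
    rw [norm_mul, Complex.norm_real, Real.norm_of_nonneg (resSymb_pos n).le]
    exact mul_le_mul_of_nonneg_right (resSymb_le_one n) (norm_nonneg _)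
  choose G hG using h
  let G' : Hil →ₗ[ℂ] Hil :=
    { toFun := G
      map_add' := fun u v => by
        apply fourierHB.repr.injective
        ext n
        simp only [map_add, lp.coeFn_add, Pi.add_apply, hG, mul_add]
      map_smul' := fun c u => by
        apply fourierHB.repr.injective
        ext n
        simp only [map_smul, lp.coeFn_smul, Pi.smul_apply, hG, smul_eq_mul, RingHom.id_apply]
        ring }
  refine ⟨G'.mkContinuous |1| fun f => norm_le_of_repr_le fun n => ?_, hG⟩
  change ‖fourierHB.repr (G f) n‖ ≤ _
  rw [hG, norm_mul, Complex.norm_real, Real.norm_of_nonneg (resSymb_pos n).le]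
  exact mul_le_mul_of_nonneg_right (resSymb_le_one n) (norm_nonneg _)

/-- The multipliers tend to zero, so discarding the frequencies with multiplier below δ/2 leaves a
finite-rank operator within δ/2 in operator norm. -/
lemma isCompactOperator_resolvent {G : Hil →L[ℂ] Hil}
    (hG : ∀ f n, fourierHB.repr (G f) n = resSymb n * fourierHB.repr f n) :
    IsCompactOperator G := by
  classical
  refine isClosed_setOfPred_isCompactOperator.closure_subset (Metric.mem_closure_iff.2 fun δ hδ => ?_)
  have hfin : {n | ¬ resSymb n ^ 2 < (δ / 2) ^ 2}.Finite :=
    (summable_resSymb_sq.tendsto_cofinite_zero.eventually (gt_mem_nhds (by positivity)))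
  let S : Finset (Fin 2 → ℤ) := hfin.toFinset
  let GS : Hil →L[ℂ] Hil := ∑ n ∈ S, (resSymb n : ℂ) •
    (ContinuousLinearMap.toSpanSingleton ℂ (fourierHB n)).comp (innerSL ℂ (fourierHB n))
  have hGS (f : Hil) (m : Fin 2 → ℤ) :
      fourierHB.repr (GS f) m = if m ∈ S then resSymb m * fourierHB.repr f m else 0 := by
    have h1 : GS f = ∑ n ∈ S, (resSymb n * fourierHB.repr f n : ℂ) • fourierHB n := by
      simp only [GS, sum_apply, smul_apply,
        ContinuousLinearMap.comp_apply, ContinuousLinearMap.toSpanSingleton_apply,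
        innerSL_apply_apply, HilbertBasis.repr_apply_apply, smul_smul]
    rw [h1, HilbertBasis.repr_apply_apply, inner_sum]
    simp only [inner_smul_right, orthonormal_iff_ite.1 fourierHB.orthonormal, mul_ite, mul_one,
      mul_zero, Finset.sum_ite_eq]
  refine ⟨GS, ?_, ?_⟩
  · change GS ∈ compactOperator (RingHom.id ℂ) Hil Hil
    refine Submodule.sum_mem _ fun n _ => Submodule.smul_mem _ _ ?_
    have h1 : IsCompactOperator (ContinuousLinearMap.toSpanSingleton ℂ (fourierHB n)) :=
      isCompactOperator_of_locallyCompactSpace_rng _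
    exact h1.comp_clm (innerSL ℂ (fourierHB n))
  · rw [dist_eq_norm]
    refine lt_of_le_of_lt (ContinuousLinearMap.opNorm_le_bound _ (by positivity : 0 ≤ δ / 2)
      fun f => ?_) (half_lt_self hδ)
    rw [← abs_of_pos (half_pos hδ)]
    refine norm_le_of_repr_le fun n => ?_
    rw [sub_apply, map_sub, lp.coeFn_sub, Pi.sub_apply, hG, hGS]
    split_ifs with h
    · rw [sub_self, norm_zero]; positivity
    · rw [sub_zero, norm_mul, Complex.norm_real, Real.norm_of_nonneg (resSymb_pos n).le]
      refine mul_le_mul_of_nonneg_right ?_ (norm_nonneg _)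
      simp only [S, Set.Finite.mem_toFinset, Set.mem_ofPred_eq, not_not] at h
      exact (lt_of_pow_lt_pow_left₀ 2 (by positivity) h).le

/-- The range of the resolvent consists of bounded functions. -/
lemma exists_sup_bound : ∃ C : ℝ, 0 ≤ C ∧ ∀ u f : Hil,
    (∀ n, fourierHB.repr u n = resSymb n * fourierHB.repr f n) →
      ∀ᵐ x ∂cellMeasure, ‖u x‖ ≤ C * ‖f‖ := by
  set B : ℝ := ∑' n, resSymb n ^ 2
  refine ⟨(Real.sqrt area)⁻¹ * Real.sqrt B, by positivity, fun u f h => ?_⟩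
  have hsum := fourierHB.hasSum_repr u
  -- Almost everywhere convergence of the partial Fourier sums holds only along a sequence of finite
  -- sets. This is enough, because Cauchy–Schwarz against `resSymb` bounds all finite sums
  -- uniformly.
  obtain ⟨ns, -, hns⟩ := (tendstoInMeasure_of_tendsto_Lp hsum).exists_seq_tendsto_ae'
  have hfin (S : Finset (Fin 2 → ℤ)) : ∀ᵐ x ∂cellMeasure,
      ‖(∑ n ∈ S, fourierHB.repr u n • fourierHB n : Hil) x‖
        ≤ (Real.sqrt area)⁻¹ * Real.sqrt B * ‖f‖ := by
    have h1 : ∑ n ∈ S, ‖fourierHB.repr u n‖ ≤ Real.sqrt B * ‖f‖ := by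
      have h2 : ∑ n ∈ S, ‖fourierHB.repr u n‖ = ∑ n ∈ S, resSymb n * ‖fourierHB.repr f n‖ :=
        Finset.sum_congr rfl fun n _ => by
          rw [h, norm_mul, Complex.norm_real, Real.norm_of_nonneg (resSymb_pos n).le]
      rw [h2]
      refine (Real.sum_mul_le_sqrt_mul_sqrt _ _ _).trans ?_
      refine mul_le_mul (Real.sqrt_le_sqrt (summable_resSymb_sq.sum_le_tsum S
        fun _ _ => sq_nonneg _)) ?_ (Real.sqrt_nonneg _) (Real.sqrt_nonneg _)
      refine Real.sqrt_le_iff.2 ⟨norm_nonneg _, ?_⟩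
      simp only [HilbertBasis.repr_apply_apply]
      exact fourierHB.orthonormal.sum_inner_products_le f
    have h2 (n : Fin 2 → ℤ) : ∀ᵐ x ∂cellMeasure, ‖(fourierHB.repr u n • fourierHB n : Hil) x‖
        ≤ ‖fourierHB.repr u n‖ * (Real.sqrt area)⁻¹ := by
      rw [fourierHB_apply, expoLp]
      filter_upwards [Lp.coeFn_smul (fourierHB.repr u n)
          (((Real.sqrt area : ℝ) : ℂ)⁻¹ • (memLp_expo n).toLp (expo n)),
        Lp.coeFn_smul ((Real.sqrt area : ℝ) : ℂ)⁻¹ ((memLp_expo n).toLp (expo n)),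
        (memLp_expo n).coeFn_toLp] with x a1 a2 a3
      rw [a1, Pi.smul_apply, a2, Pi.smul_apply, a3, norm_smul, norm_smul, norm_expo, norm_inv,
        Complex.norm_real, Real.norm_of_nonneg (Real.sqrt_nonneg _), mul_one]
    have h3 : ∀ᵐ x ∂cellMeasure, (∑ n ∈ S, fourierHB.repr u n • fourierHB n : Hil) x
        = ∑ n ∈ S, (fourierHB.repr u n • fourierHB n : Hil) x := by
      induction S using Finset.induction_on with
      | empty =>
        simp only [Finset.sum_empty]
        exact Lp.coeFn_zero _ _ _
      | insert n S hn ih =>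
        have ih' := ih (by
          rw [Finset.sum_insert hn] at h1
          linarith [norm_nonneg (fourierHB.repr u n)])
        simp only [Finset.sum_insert hn]
        filter_upwards [ih', Lp.coeFn_add (fourierHB.repr u n • fourierHB n : Hil)
          (∑ n ∈ S, fourierHB.repr u n • fourierHB n)] with x a1 a2
        rw [a2, Pi.add_apply, a1]
    filter_upwards [h3, ae_all_iff.2 h2] with x a1 a2
    rw [a1]
    refine (norm_sum_le _ _).trans ((Finset.sum_le_sum fun n _ => a2 n).trans ?_)
    rw [← Finset.sum_mul, mul_comm, mul_assoc]
    exact mul_le_mul_of_nonneg_left h1 (by positivity)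
  filter_upwards [hns, ae_all_iff.2 fun i => hfin (ns i)] with x a1 a2
  exact le_of_tendsto a1.norm (Eventually.of_forall a2)

/-- If `1 - C` is injective on a closed subspace, with `C` compact, then it is bounded below
there. -/
lemma IsCompactOperator.exists_norm_le {H : Type*} [NormedAddCommGroup H] [NormedSpace ℂ H]
    {C : H →L[ℂ] H} (hC : IsCompactOperator C) {N : Submodule ℂ H} (hN : IsClosed (N : Set H))
    (h : ∀ u ∈ N, C u = u → u = 0) : ∃ c : ℝ, 0 ≤ c ∧ ∀ u ∈ N, ‖u‖ ≤ c * ‖u - C u‖ := by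
  by_contra! hcon
  -- If no bound holds, there are unit vectors in N that C almost fixes. Compactness of C makes a
  -- subsequence converge to a unit vector of N fixed by C.
  have h1 (k : ℕ) : ∃ v ∈ N, ‖v‖ = 1 ∧ ‖v - C v‖ ≤ ((k : ℝ) + 1)⁻¹ := by
    obtain ⟨u, hu, hlt⟩ := hcon (k + 1) (by positivity)
    have hu0 : 0 < ‖u‖ := lt_of_le_of_lt (by positivity) hlt
    refine ⟨((‖u‖⁻¹ : ℝ) : ℂ) • u, N.smul_mem _ hu, ?_, ?_⟩
    · rw [norm_smul, Complex.norm_real, norm_inv, norm_norm, inv_mul_cancel₀ hu0.ne']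
    · rw [map_smul, ← smul_sub, norm_smul, Complex.norm_real, norm_inv, norm_norm,
        inv_mul_le_iff₀ hu0, ← div_eq_mul_inv, le_div_iff₀ (by positivity), mul_comm]
      exact hlt.le
  choose v hvN hv1 hv using h1
  have hcpt := hC.isCompact_closure_image_closedBall (σ₁₂ := RingHom.id ℂ) (f := C.toLinearMap) 1
  have hmem (k : ℕ) : C (v k) ∈ closure (C '' Metric.closedBall 0 1) :=
    subset_closure ⟨v k, by simp [hv1], rfl⟩
  obtain ⟨w, -, ψ, hψ, hw⟩ := hcpt.tendsto_subseq hmem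
  have hdiff : Tendsto (fun k => v (ψ k) - C (v (ψ k))) atTop (𝓝 0) := by
    refine squeeze_zero_norm (fun k => hv (ψ k)) ?_
    have : Tendsto (fun k : ℕ => ((k : ℝ) + 1)⁻¹) atTop (𝓝 0) :=
      tendsto_inv_atTop_zero.comp (tendsto_atTop_add_const_right _ _ tendsto_natCast_atTop_atTop)
    exact this.comp hψ.tendsto_atTop
  have hvw : Tendsto (fun k => v (ψ k)) atTop (𝓝 w) := by
    have := hdiff.add hw
    simpa using this
  have hwN : w ∈ N := hN.mem_of_tendsto hvw (Eventually.of_forall fun k => hvN _)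
  have hCw : C w = w := tendsto_nhds_unique ((C.continuous.tendsto w).comp hvw) hw
  have hw1 : ‖w‖ = 1 := tendsto_nhds_unique hvw.norm (by simp [hv1])
  rw [h w hwN hCw, norm_zero] at hw1
  exact zero_ne_one hw1

/-- `(-(∇ + iK)² + Q) u = h` on the torus. -/
def Solves (Q : Hil →L[ℂ] Hil) (u h : Hil) : Prop :=
  ∀ n, symb n * fourierHB.repr u n = fourierHB.repr (h - Q u) n

lemma Solves.add {Q : Hil →L[ℂ] Hil} {u h v k : Hil} (h1 : Solves Q u h) (h2 : Solves Q v k) :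
    Solves Q (u + v) (h + k) := fun n => by
  have e : h + k - Q (u + v) = (h - Q u) + (k - Q v) := by rw [map_add]; abel
  rw [e, map_add, map_add, lp.coeFn_add, lp.coeFn_add, Pi.add_apply, Pi.add_apply, ← h1, ← h2]
  ring

lemma Solves.smul {Q : Hil →L[ℂ] Hil} {u h : Hil} (c : ℂ) (h1 : Solves Q u h) :
    Solves Q (c • u) (c • h) := fun n => by
  have e : c • h - Q (c • u) = c • (h - Q u) := by rw [map_smul, smul_sub]
  rw [e, map_smul, map_smul, lp.coeFn_smul, lp.coeFn_smul, Pi.smul_apply, Pi.smul_apply, ← h1]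
  simp only [smul_eq_mul]
  ring

lemma Solves.sub {Q : Hil →L[ℂ] Hil} {u h v k : Hil} (h1 : Solves Q u h) (h2 : Solves Q v k) :
    Solves Q (u - v) (h - k) := by
  have := h1.add (h2.smul (-1))
  simpa [sub_eq_add_neg] using this

/-- The operator is symmetric, so the right-hand side is orthogonal to its kernel. -/
lemma Solves.inner_eq_zero {Q : Hil →L[ℂ] Hil} (hQ : ∀ u v, inner ℂ (Q u) v = inner ℂ u (Q v))
    {A u h : Hil} (hA : Solves Q A 0) (hu : Solves Q u h) : inner ℂ A h = 0 := by
  have h1 : inner ℂ (0 - Q A) u = inner ℂ A (h - Q u) := by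
    rw [inner_eq_tsum, inner_eq_tsum]
    refine tsum_congr fun n => ?_
    rw [← hA, ← hu, map_mul, Complex.conj_ofReal]
    ring
  rw [zero_sub, inner_neg_left, inner_sub_right, hQ] at h1
  linear_combination -h1

/-- Adding u to both sides puts the equation in the resolvent form u = G(h + u − Qu), through which
sup bounds and compactness enter. -/
lemma Solves.repr_eq {Q : Hil →L[ℂ] Hil} {u h : Hil} (hu : Solves Q u h) (n : Fin 2 → ℤ) :
    fourierHB.repr u n = resSymb n * fourierHB.repr (h + (u - Q u)) n := by
  have e : h + (u - Q u) = (h - Q u) + u := by abel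
  have h1 : ((symb n : ℂ) + 1) * resSymb n = 1 := by exact_mod_cast symb_add_one_mul n
  rw [e, map_add, lp.coeFn_add, Pi.add_apply, ← hu]
  linear_combination -(fourierHB.repr u n) * h1

lemma Solves.exists_sup_bound (Q : Hil →L[ℂ] Hil) : ∃ C : ℝ, 0 ≤ C ∧ ∀ u h, Solves Q u h →
    ∀ᵐ x ∂cellMeasure, ‖u x‖ ≤ C * (‖u‖ + ‖h‖) := by
  obtain ⟨C, hC0, hC⟩ := Honeycomb.exists_sup_bound
  refine ⟨C * (1 + ‖Q‖), by positivity, fun u h hu => ?_⟩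
  filter_upwards [hC u _ hu.repr_eq] with x hx
  refine hx.trans ?_
  rw [mul_assoc]
  refine mul_le_mul_of_nonneg_left ?_ hC0
  have h1 := norm_add_le h (u - Q u)
  have h2 := norm_sub_le u (Q u)
  have h3 := Q.le_opNorm u
  nlinarith [mul_nonneg (norm_nonneg Q) (norm_nonneg h)]

/-- The spectral gap. -/
lemma Solves.exists_gap (Q : Hil →L[ℂ] Hil) {N : Submodule ℂ Hil} (hN : IsClosed (N : Set Hil))
    (h0 : ∀ u ∈ N, Solves Q u 0 → u = 0) :
    ∃ c : ℝ, 0 ≤ c ∧ ∀ u ∈ N, ∀ h, Solves Q u h → ‖u‖ ≤ c * ‖h‖ := by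
  obtain ⟨G, hG⟩ := exists_resolvent
  have hcpt : IsCompactOperator (G.comp (ContinuousLinearMap.id ℂ Hil - Q)) :=
    (isCompactOperator_resolvent hG).comp_clm _
  obtain ⟨c, hc0, hc⟩ := IsCompactOperator.exists_norm_le hcpt hN (fun u hu huC => h0 u hu fun n => by
    have h1 : (symb n + 1 : ℂ) * resSymb n = 1 := by exact_mod_cast symb_add_one_mul n
    have h2 : fourierHB.repr u n = resSymb n * fourierHB.repr (u - Q u) n := by
      rw [← hG]
      exact congrArg (fun v => fourierHB.repr v n) huC.symm
    rw [map_sub, lp.coeFn_sub, Pi.sub_apply] at h2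
    rw [zero_sub, map_neg, lp.coeFn_neg, Pi.neg_apply]
    linear_combination (symb n + 1 : ℂ) * h2
      + (fourierHB.repr u n - fourierHB.repr (Q u) n) * h1)
  refine ⟨c * ‖G‖, by positivity, fun u hu h hs => ?_⟩
  -- With C = G(1 − Q) compact, the equation reads u − Cu = Gh. Fixed points of C are exactly the
  -- solutions with h = 0, so the hypothesis on N gives the lower bound.
  have e : u - (G.comp (ContinuousLinearMap.id ℂ Hil - Q)) u = G h := by
    have h1 : u = G (h + (u - Q u)) := by
      apply fourierHB.repr.injective
      ext n
      rw [hG, hs.repr_eq]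
    rw [map_add] at h1
    exact sub_eq_of_eq_add h1
  have h1 := hc u hu
  rw [e] at h1
  rw [mul_assoc]
  exact h1.trans (mul_le_mul_of_nonneg_left (G.le_opNorm h) hc0)

end Honeycomb

end

/-! ### The nonlinear potential and its cubic leading part. -/

noncomputable section

namespace Honeycomb

open scoped ENNReal Topology
open Filter

section Nonlinearity

variable {V : Plane → ℝ → ℝ} {VL K : Plane → ℝ}

lemma IsNonlinearPotential.apply_zero (hV : IsNonlinearPotential V VL K) (x : Plane) :
    V x 0 = VL x := by
  obtain ⟨C, r, hr, h⟩ := hV.expansion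
  have := h x 0 ⟨le_rfl, hr.le⟩
  simp only [mul_zero, sub_zero, ne_eq, OfNat.ofNat_ne_zero, not_false_eq_true, zero_pow] at this
  exact sub_eq_zero.1 (abs_nonpos_iff.1 this)

lemma IsNonlinearPotential.wrap (hV : IsNonlinearPotential V VL K) (x : Plane) {s : ℝ}
    (hs : 0 ≤ s) : V (wrap x) s = V x s := (hV.periodic s hs).wrap x

lemma IsNonlinearPotential.continuous (hV : IsNonlinearPotential V VL K) :
    Continuous fun p : Plane × ℝ => V p.1 (max p.2 0) :=
  hV.smooth.continuousOn.comp_continuous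
    (continuous_fst.prodMk (continuous_snd.max continuous_const))
    fun p => ⟨Set.mem_univ _, Set.mem_Ici.2 (le_max_right p.2 0)⟩

lemma IsNonlinearPotential.continuous_VL (hV : IsNonlinearPotential V VL K) : Continuous VL := by
  have h := hV.continuous.comp (continuous_id.prodMk (continuous_const (y := (0 : ℝ))))
  simpa [Function.comp_def, hV.apply_zero] using h

lemma IsNonlinearPotential.exists_bound_VL (hV : IsNonlinearPotential V VL K) :
    ∃ C, ∀ x, |VL x| ≤ C :=
  hV.honeycomb_VL.periodic.exists_bound hV.continuous_VL

lemma IsNonlinearPotential.exists_bound (hV : IsNonlinearPotential V VL K) (R : ℝ) :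
    ∃ C, 0 ≤ C ∧ ∀ x, ∀ s ∈ Set.Icc 0 R, |V x s| ≤ C := by
  obtain ⟨C, hC⟩ := (isCompact_closure_cell.prod (isCompact_Icc (a := (0 : ℝ)) (b := R))
    ).exists_bound_of_continuousOn hV.continuous.continuousOn
  refine ⟨max C 0, le_max_right _ _, fun x s hs => le_trans ?_ (le_max_left _ _)⟩
  have := hC (Honeycomb.wrap x, s) ⟨subset_closure (wrap_mem x), hs⟩
  rwa [max_eq_left hs.1, hV.wrap x hs.1] at this

/-- No regularity of K is postulated. It is the pointwise limit of the continuous difference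
quotients (V(x,s) − V_L(x))/s along a sequence s → 0. -/
lemma IsNonlinearPotential.measurable_K (hV : IsNonlinearPotential V VL K) : Measurable K := by
  obtain ⟨C, r, hr, h⟩ := hV.expansion
  let s (k : ℕ) : ℝ := r / (k + 1)
  have hs0 (k : ℕ) : 0 < s k := by positivity
  have hsr (k : ℕ) : s k ≤ r := div_le_self hr.le (by simp)
  have hs : Tendsto s atTop (𝓝 0) := tendsto_const_nhds.div_atTop
    (tendsto_atTop_add_const_right _ _ tendsto_natCast_atTop_atTop)
  refine measurable_of_tendsto_metrizable (f := fun k x => (V x (s k) - VL x) / s k) (fun k => ?_) ?_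
  · have h1 := hV.continuous.comp (continuous_id.prodMk (continuous_const (y := s k)))
    simp only [Function.comp_def, max_eq_left (hs0 k).le] at h1
    exact (h1.measurable.sub hV.continuous_VL.measurable).div_const _
  · rw [tendsto_pi_nhds]
    intro x
    rw [tendsto_iff_norm_sub_tendsto_zero]
    refine squeeze_zero (fun _ => norm_nonneg _) (fun k => ?_) (by simpa using hs.const_mul C)
    have h1 := h x (s k) ⟨(hs0 k).le, hsr k⟩
    rw [Real.norm_eq_abs, div_sub' (hs0 k).ne', abs_div, abs_of_pos (hs0 k),
      div_le_iff₀ (hs0 k)]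
    rw [mul_comm (s k)]
    exact h1.trans_eq (by ring)

/-- The expansion evaluated at s = r expresses r·K through bounded quantities. -/
lemma IsNonlinearPotential.exists_bound_K (hV : IsNonlinearPotential V VL K) :
    ∃ C, 0 ≤ C ∧ ∀ x, |K x| ≤ C := by
  obtain ⟨C, r, hr, h⟩ := hV.expansion
  obtain ⟨C1, h10, h1⟩ := hV.exists_bound r
  obtain ⟨C2, h2⟩ := hV.exists_bound_VL
  have h20 : 0 ≤ C2 := (abs_nonneg _).trans (h2 0)
  refine ⟨(C1 + C2 + |C| * r ^ 2) / r, by positivity, fun x => ?_⟩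
  rw [le_div_iff₀ hr, ← abs_of_pos hr, ← abs_mul, abs_of_pos hr]
  have a1 := h x r ⟨hr.le, le_rfl⟩
  have a2 := h1 x r ⟨hr.le, le_rfl⟩
  have a3 := h2 x
  have a4 : C * r ^ 2 ≤ |C| * r ^ 2 := mul_le_mul_of_nonneg_right (le_abs_self C) (sq_nonneg r)
  rw [abs_le] at *
  constructor <;> linarith

/-- The expansion of the nonlinear potential may be differentiated once. -/
lemma IsNonlinearPotential.lipschitz (hV : IsNonlinearPotential V VL K) {τ : ℝ} (hτ : 0 < τ) :
    ∃ ρ : ℝ, 0 < ρ ∧ ∀ x, ∀ s ∈ Set.Icc 0 ρ, ∀ s' ∈ Set.Icc 0 ρ,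
      |V x s - V x s' - K x * (s - s')| ≤ τ * |s - s'| := by
  obtain ⟨C, r, hr, hexp⟩ := hV.expansion
  set F : Plane × ℝ → ℝ := fun p => V p.1 p.2
  set U : Set (Plane × ℝ) := Set.univ ×ˢ Set.Ici 0
  have hU : UniqueDiffOn ℝ U := uniqueDiffOn_univ.prod (uniqueDiffOn_Ici 0)
  let D : Plane × ℝ → ℝ := fun p => fderivWithin ℝ F U p (0, 1)
  have hDc : ContinuousOn D U :=
    (hV.smooth.continuousOn_fderivWithin hU (by simp)).clm_apply continuousOn_const
  have hderiv (x : Plane) {s : ℝ} (hs : 0 ≤ s) :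
      HasDerivWithinAt (V x) (D (x, s)) (Set.Ici 0) s := by
    have h1 : HasFDerivWithinAt F (fderivWithin ℝ F U (x, s)) U (x, s) :=
      ((hV.smooth.differentiableOn (by simp)) (x, s) ⟨Set.mem_univ _, hs⟩).hasFDerivWithinAt
    have h2 : HasDerivWithinAt (fun t : ℝ => (x, t)) ((0 : Plane), (1 : ℝ)) (Set.Ici 0) s :=
      (hasDerivWithinAt_const _ _ _).prodMk (hasDerivWithinAt_id _ _)
    exact h1.comp_hasDerivWithinAt s h2 fun t ht => ⟨Set.mem_univ _, ht⟩
  -- The O(s²) bound by itself says nothing about differences in s. The Lipschitz estimate comes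
  -- from uniform continuity of ∂ₛV on a compact set and the mean value inequality.
  have hunif := (isCompact_closure_cell.prod (isCompact_Icc (a := (0 : ℝ)) (b := 1))
    ).uniformContinuousOn_of_continuous (hDc.mono fun p hp => ⟨Set.mem_univ _, hp.2.1⟩)
  -- One third of τ pays for the oscillation of ∂ₛV, the other two for identifying ∂ₛV(x,0) with
  -- K(x) through a difference quotient at one small s.
  obtain ⟨ρ₀, hρ₀, hD⟩ := Metric.uniformContinuousOn_iff.1 hunif (τ / 3) (by positivity)
  set ρ : ℝ := min (ρ₀ / 2) 1
  have hρ : 0 < ρ := by positivity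
  have hρ1 : ρ ≤ 1 := min_le_right _ _
  have hmvt (x : Plane) (hx : x ∈ closure cell) (s : ℝ) (hs : s ∈ Set.Icc 0 ρ) (s' : ℝ)
      (hs' : s' ∈ Set.Icc 0 ρ) : |V x s - V x s' - D (x, 0) * (s - s')| ≤ τ / 3 * |s - s'| := by
    have h := (convex_Icc (0 : ℝ) ρ).norm_image_sub_le_of_norm_hasDerivWithin_le
      (f := fun t => V x t - D (x, 0) * t) (f' := fun t => D (x, t) - D (x, 0) * 1) (C := τ / 3)
      (fun t ht => (((hderiv x ht.1).mono Set.Icc_subset_Ici_self).sub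
        ((hasDerivWithinAt_id _ _).const_mul _)))
      (fun t ht => by
        rw [mul_one, ← dist_eq_norm]
        refine (hD _ ⟨hx, ht.1, ht.2.trans hρ1⟩ _ ⟨hx, le_rfl, zero_le_one⟩ ?_).le
        rw [Prod.dist_eq, dist_self, Real.dist_eq, sub_zero, abs_of_nonneg ht.1, max_lt_iff]
        exact ⟨hρ₀, lt_of_le_of_lt (ht.2.trans (min_le_left _ _)) (half_lt_self hρ₀)⟩)
      hs' hs
    rw [Real.norm_eq_abs, Real.norm_eq_abs] at h
    refine le_of_eq_of_le ?_ h
    congr 1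
    ring
  have hK (x : Plane) (hx : x ∈ closure cell) : |K x - D (x, 0)| ≤ 2 * (τ / 3) := by
    set s : ℝ := min (min ρ r) (τ / 3 / (|C| + 1))
    have hs : 0 < s := by positivity
    have hsρ : s ≤ ρ := (min_le_left _ _).trans (min_le_left _ _)
    have hsr : s ≤ r := (min_le_left _ _).trans (min_le_right _ _)
    have hsC : C * s ≤ τ / 3 := by
      have h1 : s ≤ τ / 3 / (|C| + 1) := min_le_right _ _
      rw [le_div_iff₀ (by positivity)] at h1
      nlinarith [le_abs_self C]
    have h1 := hmvt x hx s ⟨hs.le, hsρ⟩ 0 ⟨le_rfl, hρ.le⟩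
    have h2 := hexp x s ⟨hs.le, hsr⟩
    rw [hV.apply_zero, sub_zero, abs_of_pos hs] at h1
    have h3 : C * s ^ 2 ≤ τ / 3 * s := by nlinarith
    refine le_of_mul_le_mul_right ?_ hs
    rw [← abs_of_pos hs, ← abs_mul, abs_of_pos hs]
    rw [abs_le] at *
    constructor <;> nlinarith
  refine ⟨ρ, hρ, fun x s hs s' hs' => ?_⟩
  rw [← hV.wrap x hs.1, ← hV.wrap x hs'.1, ← hV.honeycomb_K.periodic.wrap x]
  have hx := subset_closure (wrap_mem x)
  have h1 := hmvt _ hx s hs s' hs'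
  have h2 := mul_le_mul_of_nonneg_right (hK _ hx) (abs_nonneg (s - s'))
  rw [← abs_mul] at h2
  calc _ = |(V (Honeycomb.wrap x) s - V (Honeycomb.wrap x) s'
            - D (Honeycomb.wrap x, 0) * (s - s'))
          - (K (Honeycomb.wrap x) - D (Honeycomb.wrap x, 0)) * (s - s')| := by congr 1; ring
    _ ≤ _ := (abs_sub _ _).trans (add_le_add h1 h2)
    _ = τ * |s - s'| := by ring

end Nonlinearity

/-- The cubic map `z ↦ |z|² z`. -/
def cubic (z : ℂ) : ℂ := z * z * (starRingEnd ℂ) z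

lemma cubic_eq (z : ℂ) : cubic z = ((‖z‖ ^ 2 : ℝ) : ℂ) * z := by
  rw [cubic, mul_assoc, Complex.mul_conj, Complex.normSq_eq_norm_sq, mul_comm]

lemma continuous_cubic : Continuous cubic := by
  unfold cubic
  exact (continuous_id.mul continuous_id).mul Complex.continuous_conj

lemma norm_mul₃_le {x y z : ℂ} {p q r : ℝ} (hx : ‖x‖ ≤ p) (hy : ‖y‖ ≤ q) (hz : ‖z‖ ≤ r) :
    ‖x * y * z‖ ≤ p * q * r := by
  rw [norm_mul, norm_mul]
  have hp := (norm_nonneg x).trans hx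
  have hq := (norm_nonneg y).trans hy
  gcongr

lemma norm_cubic_sub_le {z w : ℂ} {R : ℝ} (hz : ‖z‖ ≤ R) (hw : ‖w‖ ≤ R) :
    ‖cubic z - cubic w‖ ≤ 3 * R ^ 2 * ‖z - w‖ := by
  have e : cubic z - cubic w = (z - w) * z * (starRingEnd ℂ) z + w * (z - w) * (starRingEnd ℂ) z
      + w * w * (starRingEnd ℂ) (z - w) := by
    simp only [cubic, map_sub]
    ring
  rw [e]
  have hcz : ‖(starRingEnd ℂ) z‖ ≤ R := by rwa [RCLike.norm_conj]
  have h1 := norm_mul₃_le (le_refl ‖z - w‖) hz hcz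
  have h2 := norm_mul₃_le hw (le_refl ‖z - w‖) hcz
  have h3 := norm_mul₃_le hw hw (RCLike.norm_conj (z - w)).le
  refine (norm_add₃_le).trans ?_
  linarith

/-- A second-difference estimate. In the application p, p' are the kernel parts of u, u'. The factor
in front of ‖u − u'‖ carries the small σ, and the other term contains the difference of the
orthogonal parts, itself of order ε². This makes the cubic error small in Lipschitz norm. -/
lemma norm_cubic_sub_sub_le {u p u' p' : ℂ} {R σ : ℝ} (hu : ‖u‖ ≤ R) (hp : ‖p‖ ≤ R)
    (hu' : ‖u'‖ ≤ R) (hp' : ‖p'‖ ≤ R) (hσ : ‖u' - p'‖ ≤ σ) :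
    ‖(cubic u - cubic p) - (cubic u' - cubic p')‖
      ≤ 6 * R * σ * ‖u - u'‖ + (3 * R ^ 2 + 3 * R * σ) * ‖(u - p) - (u' - p')‖ := by
  set w := u - u' with hw
  set q := u' - p' with hq
  set w₁ := (u - p) - q with hw₁
  have e : (cubic u - cubic p) - (cubic u' - cubic p')
      = (w₁ * u * (starRingEnd ℂ) u + q * w * (starRingEnd ℂ) u + q * u' * (starRingEnd ℂ) w)
      + (p * w₁ * (starRingEnd ℂ) u + (w - w₁) * q * (starRingEnd ℂ) u
        + p' * q * (starRingEnd ℂ) w)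
      + (p * p * (starRingEnd ℂ) w₁ + (w - w₁) * p * (starRingEnd ℂ) q
        + p' * (w - w₁) * (starRingEnd ℂ) q) := by
    simp only [cubic, hw₁, hw, hq, map_sub]
    ring
  rw [e]
  have hcu : ‖(starRingEnd ℂ) u‖ ≤ R := by rwa [RCLike.norm_conj]
  have hcq : ‖(starRingEnd ℂ) q‖ ≤ σ := by rwa [RCLike.norm_conj]
  have hcw := (RCLike.norm_conj w).le
  have hcw₁ := (RCLike.norm_conj w₁).le
  have hww : ‖w - w₁‖ ≤ ‖w‖ + ‖w₁‖ := norm_sub_le _ _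
  have a1 := norm_mul₃_le (le_refl ‖w₁‖) hu hcu
  have a2 := norm_mul₃_le hσ (le_refl ‖w‖) hcu
  have a3 := norm_mul₃_le hσ hu' hcw
  have a4 := norm_mul₃_le hp (le_refl ‖w₁‖) hcu
  have a5 := norm_mul₃_le hww hσ hcu
  have a6 := norm_mul₃_le hp' hσ hcw
  have a7 := norm_mul₃_le hp hp hcw₁
  have a8 := norm_mul₃_le hww hp hcq
  have a9 := norm_mul₃_le hp' hww hcq
  refine (norm_add₃_le).trans ((add_le_add_three (norm_add₃_le) (norm_add₃_le)
    (norm_add₃_le)).trans ?_)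
  linarith

/-- The rescaled nonlinearity `ε⁻² (V(x, ε²|z|²) - V_L(x)) z`. -/
def scaledNL (V : Plane → ℝ → ℝ) (VL : Plane → ℝ) (ε : ℝ) (x : Plane) (z : ℂ) : ℂ :=
  (((V x (ε ^ 2 * ‖z‖ ^ 2) - VL x) / ε ^ 2 : ℝ) : ℂ) * z

/-- The rescaled nonlinearity is Lipschitz close to its cubic part. -/
lemma IsNonlinearPotential.scaledNL_sub_le {V : Plane → ℝ → ℝ} {VL K : Plane → ℝ}
    (hV : IsNonlinearPotential V VL K) {R : ℝ} (hR : 0 ≤ R) {τ : ℝ} (hτ : 0 < τ) :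
    ∃ ε₁ : ℝ, 0 < ε₁ ∧ ∀ ε, 0 < ε → ε < ε₁ → ∀ x z w, ‖z‖ ≤ R → ‖w‖ ≤ R →
      ‖(scaledNL V VL ε x z - K x * cubic z) - (scaledNL V VL ε x w - K x * cubic w)‖
        ≤ τ * ‖z - w‖ := by
  -- The error has the form m(z)z, where m varies at rate t in |z|². On |z| ≤ R the factor m costs
  -- tR² and its variation 2tR², together 3tR². The added 1 keeps the denominator positive.
  obtain ⟨ρ, hρ, h⟩ := hV.lipschitz (τ := τ / (3 * R ^ 2 + 1)) (by positivity)
  refine ⟨min 1 (ρ / (R ^ 2 + 1)), by positivity, fun ε hε hlt x z w hz hw => ?_⟩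
  have hε1 : ε < 1 := hlt.trans_le (min_le_left _ _)
  have hερ : ε * (R ^ 2 + 1) ≤ ρ := (le_div_iff₀ (by positivity)).1 (hlt.le.trans (min_le_right _ _))
  have hmem (z : ℂ) (hz : ‖z‖ ≤ R) : ε ^ 2 * ‖z‖ ^ 2 ∈ Set.Icc 0 ρ := by
    refine ⟨by positivity, ?_⟩
    have h1 : ‖z‖ ^ 2 ≤ R ^ 2 := pow_le_pow_left₀ (norm_nonneg _) hz 2
    have h2 : ε ^ 2 ≤ ε := by nlinarith
    calc ε ^ 2 * ‖z‖ ^ 2 ≤ ε * R ^ 2 := by gcongr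
      _ ≤ ρ := by linarith
  set m : ℂ → ℝ := fun z => (V x (ε ^ 2 * ‖z‖ ^ 2) - VL x) / ε ^ 2 - K x * ‖z‖ ^ 2
  have hm (z : ℂ) : scaledNL V VL ε x z - K x * cubic z = (m z : ℂ) * z := by
    rw [cubic_eq, scaledNL]
    push_cast [m]
    ring
  have hε2 : 0 < ε ^ 2 := by positivity
  have hdiff (z w : ℂ) (hz : ‖z‖ ≤ R) (hw : ‖w‖ ≤ R) :
      |m z - m w| ≤ τ / (3 * R ^ 2 + 1) * |‖z‖ ^ 2 - ‖w‖ ^ 2| := by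
    have h1 := h x _ (hmem z hz) _ (hmem w hw)
    rw [← mul_sub, abs_mul, abs_of_pos hε2] at h1
    refine le_of_mul_le_mul_left ?_ hε2
    rw [← abs_of_pos hε2, ← abs_mul, abs_of_pos hε2]
    refine le_of_eq_of_le ?_ (h1.trans_eq (by ring))
    congr 1
    simp only [m]
    field_simp
    ring
  have hm0 : m 0 = 0 := by simp [m, hV.apply_zero]
  have h0 := hdiff z 0 hz (by simpa using hR)
  rw [hm0, sub_zero, norm_zero, zero_pow two_ne_zero, sub_zero, abs_of_nonneg (sq_nonneg ‖z‖)] at h0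
  have h1 := hdiff z w hz hw
  set t := τ / (3 * R ^ 2 + 1) with ht
  have ht0 : 0 < t := by positivity
  have htτ : t * (3 * R ^ 2) ≤ τ := by
    have : t * (3 * R ^ 2 + 1) = τ := div_mul_cancel₀ _ (by positivity)
    linarith
  have h2 : |‖z‖ ^ 2 - ‖w‖ ^ 2| ≤ 2 * R * ‖z - w‖ := by
    rw [sq_sub_sq, abs_mul, abs_of_nonneg (by positivity)]
    have := abs_norm_sub_norm_le z w
    exact mul_le_mul (by linarith) this (abs_nonneg _) (by positivity)
  rw [hm, hm]
  have e : (m z : ℂ) * z - m w * w = (m z : ℂ) * (z - w) + ((m z - m w : ℝ) : ℂ) * w := by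
    push_cast; ring
  rw [e]
  refine (norm_add_le _ _).trans ?_
  rw [norm_mul, norm_mul, Complex.norm_real, Complex.norm_real, Real.norm_eq_abs, Real.norm_eq_abs]
  have h3 : |m z| ≤ t * R ^ 2 := h0.trans (by gcongr)
  have h4 : |m z - m w| ≤ t * (2 * R * ‖z - w‖) := h1.trans (by gcongr)
  calc _ ≤ t * R ^ 2 * ‖z - w‖ + t * (2 * R * ‖z - w‖) * R := by gcongr
    _ = t * (3 * R ^ 2) * ‖z - w‖ := by ring
    _ ≤ _ := by gcongr

end Honeycomb

end

/-! ### Lyapunov–Schmidt reduction: the orthogonal part and the reduced equations. -/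

noncomputable section

namespace Honeycomb

open scoped ENNReal Topology
open Filter

lemma Hil.norm_le_add_of_ae {f g h : Hil} {α β : ℝ} (hα : 0 ≤ α) (hβ : 0 ≤ β)
    (hle : ∀ᵐ x ∂cellMeasure, ‖f x‖ ≤ α * ‖g x‖ + β * ‖h x‖) : ‖f‖ ≤ α * ‖g‖ + β * ‖h‖ := by
  have hg := ((Lp.memLp g).norm.const_mul α)
  have hh := ((Lp.memLp h).norm.const_mul β)
  have h1 : ‖f‖ ≤ ‖hg.toLp _ + hh.toLp _‖ := by
    refine Lp.norm_le_norm_of_ae_le ?_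
    filter_upwards [hle, Lp.coeFn_add (hg.toLp _) (hh.toLp _), hg.coeFn_toLp, hh.coeFn_toLp]
      with x a1 a2 a3 a4
    rw [a2, Pi.add_apply, a3, a4]
    exact a1.trans (Real.le_norm_self _)
  have h2 : ‖hg.toLp _‖ ≤ α * ‖g‖ := by
    refine Lp.norm_le_mul_norm_of_ae_le_mul ?_
    filter_upwards [hg.coeFn_toLp] with x hx
    rw [hx, norm_mul, Real.norm_of_nonneg hα, norm_norm]
  have h3 : ‖hh.toLp _‖ ≤ β * ‖h‖ := by
    refine Lp.norm_le_mul_norm_of_ae_le_mul ?_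
    filter_upwards [hh.coeFn_toLp] with x hx
    rw [hx, norm_mul, Real.norm_of_nonneg hβ, norm_norm]
  exact h1.trans ((norm_add_le _ _).trans (add_le_add h2 h3))

/-- The linear operator `-(∇ + iK)² + Q` has kernel spanned by the orthonormal bounded functions
`A`, `B`, and is boundedly invertible, from `L²` to `L² ∩ L^∞`, on the orthogonal complement. -/
structure IsGapped (Q : Hil →L[ℂ] Hil) (A B : Hil) (c R : ℝ) : Prop where
  norm_A : ‖A‖ = 1
  norm_B : ‖B‖ = 1
  inner_AB : inner ℂ A B = 0
  ker_A : Solves Q A 0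
  ker_B : Solves Q B 0
  orth : ∀ u h, Solves Q u h → inner ℂ A h = 0 ∧ inner ℂ B h = 0
  nonneg : 0 ≤ c
  gap : ∀ u h, inner ℂ A u = 0 → inner ℂ B u = 0 → Solves Q u h →
    ‖u‖ ≤ c * ‖h‖ ∧ ∀ᵐ x ∂cellMeasure, ‖u x‖ ≤ c * ‖h‖
  bound_A : ∀ᵐ x ∂cellMeasure, ‖A x‖ ≤ R
  bound_B : ∀ᵐ x ∂cellMeasure, ‖B x‖ ≤ R

/-- A rescaled solution `u = φ/ε` of the nonlinear equation, with `e = (E - E₀)/ε²` and rescaled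
nonlinear term `κ`. -/
structure IsScaledSolution (V : Plane → ℝ → ℝ) (VL : Plane → ℝ) (Q : Hil →L[ℂ] Hil) (A B : Hil)
    (ε R : ℝ) (a b e : ℂ) (u κ : Hil) : Prop where
  unit : ‖a‖ ^ 2 + ‖b‖ ^ 2 = 1
  inner_A : inner ℂ A u = a
  inner_B : inner ℂ B u = b
  kappa : κ =ᵐ[cellMeasure] fun x => scaledNL V VL ε x (u x)
  solves : Solves Q u (((ε ^ 2 : ℝ) : ℂ) • (e • u - κ))
  bound : ∀ᵐ x ∂cellMeasure, ‖u x‖ ≤ R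

lemma one_le_norm_add_norm {a b : ℂ} (h : ‖a‖ ^ 2 + ‖b‖ ^ 2 = 1) : 1 ≤ ‖a‖ + ‖b‖ := by
  nlinarith [norm_nonneg a, norm_nonneg b, mul_nonneg (norm_nonneg a) (norm_nonneg b)]

lemma norm_le_one_of_unit {a b : ℂ} (h : ‖a‖ ^ 2 + ‖b‖ ^ 2 = 1) : ‖a‖ ≤ 1 ∧ ‖b‖ ≤ 1 := by
  constructor <;> nlinarith [norm_nonneg a, norm_nonneg b, sq_nonneg ‖a‖, sq_nonneg ‖b‖]

section Estimates

variable {V : Plane → ℝ → ℝ} {VL K : Plane → ℝ} {Q : Hil →L[ℂ] Hil} {A B : Hil}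
  {c R U ε CK τ : ℝ}

/-- The rescaled nonlinearity is `τ`-close to `K |z|² z` in Lipschitz norm on `|z| ≤ R`. -/
def NLClose (V : Plane → ℝ → ℝ) (VL K : Plane → ℝ) (R ε τ : ℝ) : Prop :=
  ∀ x z w, ‖z‖ ≤ R → ‖w‖ ≤ R →
      ‖(scaledNL V VL ε x z - K x * cubic z) - (scaledNL V VL ε x w - K x * cubic w)‖
        ≤ τ * ‖z - w‖

lemma NLClose.norm_sub_le (h : NLClose V VL K R ε τ) (hτ : τ ≤ 1) (hK : ∀ x, |K x| ≤ CK)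
    (x : Plane) {z w : ℂ} (hz : ‖z‖ ≤ R) (hw : ‖w‖ ≤ R) :
    ‖scaledNL V VL ε x z - scaledNL V VL ε x w‖ ≤ (3 * CK * R ^ 2 + 1) * ‖z - w‖ := by
  have e : scaledNL V VL ε x z - scaledNL V VL ε x w
      = ((scaledNL V VL ε x z - K x * cubic z) - (scaledNL V VL ε x w - K x * cubic w))
        + K x * (cubic z - cubic w) := by ring
  rw [e]
  refine (norm_add_le _ _).trans ?_
  have h1 := h x z w hz hw
  have h2 : ‖(K x : ℂ) * (cubic z - cubic w)‖ ≤ CK * (3 * R ^ 2 * ‖z - w‖) := by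
    rw [norm_mul, Complex.norm_real]
    exact mul_le_mul (hK x) (norm_cubic_sub_le hz hw) (norm_nonneg _)
      ((abs_nonneg _).trans (hK x))
  have h3 : τ * ‖z - w‖ ≤ 1 * ‖z - w‖ := mul_le_mul_of_nonneg_right hτ (norm_nonneg _)
  linarith

lemma scaledNL_zero (x : Plane) : scaledNL V VL ε x 0 = 0 := by simp [scaledNL]

lemma cubic_zero : cubic 0 = 0 := by simp [cubic]

variable {a b e a' b' e' : ℂ} {u κ u' κ' : Hil}

/-- The part of `u` orthogonal to the kernel. -/
abbrev orthPart (A B : Hil) (a b : ℂ) (u : Hil) : Hil := u - (a • A + b • B)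

namespace IsScaledSolution

lemma norm_kappa_sub_le (hu : IsScaledSolution V VL Q A B ε R a b e u κ)
    (hu' : IsScaledSolution V VL Q A B ε R a' b' e' u' κ') (hNL : NLClose V VL K R ε τ)
    (hτ : τ ≤ 1) (hK : ∀ x, |K x| ≤ CK) : ‖κ - κ'‖ ≤ (3 * CK * R ^ 2 + 1) * ‖u - u'‖ := by
  refine Lp.norm_le_mul_norm_of_ae_le_mul ?_
  filter_upwards [hu.kappa, hu'.kappa, hu.bound, hu'.bound, Lp.coeFn_sub κ κ', Lp.coeFn_sub u u']
    with x a1 a2 a3 a4 a5 a6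
  rw [a5, a6, Pi.sub_apply, Pi.sub_apply, a1, a2]
  exact hNL.norm_sub_le hτ hK x a3 a4

lemma norm_kappa_le (hu : IsScaledSolution V VL Q A B ε R a b e u κ) (hR : 0 ≤ R)
    (hNL : NLClose V VL K R ε τ)
    (hτ : τ ≤ 1) (hK : ∀ x, |K x| ≤ CK) : ‖κ‖ ≤ (3 * CK * R ^ 2 + 1) * ‖u‖ := by
  refine Lp.norm_le_mul_norm_of_ae_le_mul ?_
  filter_upwards [hu.kappa, hu.bound] with x a1 a3
  have := hNL.norm_sub_le hτ hK x a3 (w := 0) (by simpa using hR)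
  rwa [scaledNL_zero, sub_zero, sub_zero, ← a1] at this

/-- The right-hand side of a solvable equation is orthogonal to the kernel. Dividing by ε² leaves
the exact, still unexpanded, bifurcation equations. -/
lemma inner_kappa (hG : IsGapped Q A B c R) (hε : 0 < ε)
    (hu : IsScaledSolution V VL Q A B ε R a b e u κ) :
    inner ℂ A κ = e * a ∧ inner ℂ B κ = e * b := by
  obtain ⟨h1, h2⟩ := hG.orth _ _ hu.solves
  have hε2 : ((ε ^ 2 : ℝ) : ℂ) ≠ 0 := by
    have : ε ^ 2 ≠ 0 := by positivity
    exact_mod_cast this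
  rw [inner_smul_right, mul_eq_zero, or_iff_right hε2, inner_sub_right, inner_smul_right,
    sub_eq_zero] at h1 h2
  rw [← h1, ← h2, hu.inner_A, hu.inner_B]
  exact ⟨rfl, rfl⟩

lemma inner_orthPart (hG : IsGapped Q A B c R)
    (hu : IsScaledSolution V VL Q A B ε R a b e u κ) :
    inner ℂ A (orthPart A B a b u) = 0 ∧ inner ℂ B (orthPart A B a b u) = 0 := by
  have hAA : inner ℂ A A = 1 := by rw [inner_self_eq_norm_sq_to_K, hG.norm_A]; simp
  have hBB : inner ℂ B B = 1 := by rw [inner_self_eq_norm_sq_to_K, hG.norm_B]; simp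
  have hBA : inner ℂ B A = 0 := inner_eq_zero_symm.1 hG.inner_AB
  simp only [orthPart, inner_sub_right, inner_add_right, inner_smul_right, hAA, hBB, hBA,
    hG.inner_AB, hu.inner_A, hu.inner_B]
  constructor <;> ring

lemma solves_orthPart (hG : IsGapped Q A B c R)
    (hu : IsScaledSolution V VL Q A B ε R a b e u κ) :
    Solves Q (orthPart A B a b u) (((ε ^ 2 : ℝ) : ℂ) • (e • u - κ)) := by
  have h := hu.solves.sub ((hG.ker_A.smul a).add (hG.ker_B.smul b))
  simpa using h

/-- The condition |E − E₀| ≤ ε would only bound e by 1/ε. The projected equations bound |e|(|a| +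
|b|) by 2‖κ‖, and |a| + |b| ≥ 1. -/
lemma norm_e_le (hG : IsGapped Q A B c R) (hε : 0 < ε) (hR : 0 ≤ R) (hCK : 0 ≤ CK)
    (hu : IsScaledSolution V VL Q A B ε R a b e u κ) (hU : ‖u‖ ≤ U)
    (hNL : NLClose V VL K R ε τ) (hτ : τ ≤ 1) (hK : ∀ x, |K x| ≤ CK) :
    ‖e‖ ≤ 2 * ((3 * CK * R ^ 2 + 1) * U) := by
  obtain ⟨h1, h2⟩ := hu.inner_kappa hG hε
  have hk : ‖κ‖ ≤ (3 * CK * R ^ 2 + 1) * U :=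
    (hu.norm_kappa_le hR hNL hτ hK).trans (mul_le_mul_of_nonneg_left hU (by positivity))
  have a1 := norm_inner_le_norm (𝕜 := ℂ) A κ
  have a2 := norm_inner_le_norm (𝕜 := ℂ) B κ
  rw [h1, hG.norm_A, one_mul, norm_mul] at a1
  rw [h2, hG.norm_B, one_mul, norm_mul] at a2
  have a3 := mul_le_mul_of_nonneg_left (one_le_norm_add_norm hu.unit) (norm_nonneg e)
  linarith

/-- The orthogonal part solves the linear equation with a right-hand side of size ε², so the gap
applies. The pointwise version is needed because the cubic differences are estimated pointwise. -/
lemma orthPart_le (hG : IsGapped Q A B c R) (hε : 0 < ε) (hR : 0 ≤ R) (hCK : 0 ≤ CK)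
    (hu : IsScaledSolution V VL Q A B ε R a b e u κ) (hU : ‖u‖ ≤ U)
    (hNL : NLClose V VL K R ε τ) (hτ : τ ≤ 1) (hK : ∀ x, |K x| ≤ CK) :
    ‖orthPart A B a b u‖ ≤ ε ^ 2 * (c * ((3 * CK * R ^ 2 + 1) * U * (2 * U + 1))) ∧
    ∀ᵐ x ∂cellMeasure,
      ‖orthPart A B a b u x‖ ≤ ε ^ 2 * (c * ((3 * CK * R ^ 2 + 1) * U * (2 * U + 1))) := by
  have hU0 : 0 ≤ U := (norm_nonneg u).trans hU
  have hk : ‖κ‖ ≤ (3 * CK * R ^ 2 + 1) * U :=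
    (hu.norm_kappa_le hR hNL hτ hK).trans (mul_le_mul_of_nonneg_left hU (by positivity))
  have he := hu.norm_e_le hG hε hR hCK hU hNL hτ hK
  have hh : ‖((ε ^ 2 : ℝ) : ℂ) • (e • u - κ)‖
      ≤ ε ^ 2 * ((3 * CK * R ^ 2 + 1) * U * (2 * U + 1)) := by
    rw [norm_smul, Complex.norm_real, Real.norm_of_nonneg (by positivity)]
    refine mul_le_mul_of_nonneg_left ((norm_sub_le _ _).trans ?_) (by positivity)
    rw [norm_smul]
    have := mul_le_mul he hU (norm_nonneg u) (by positivity)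
    linarith
  obtain ⟨i1, i2⟩ := hu.inner_orthPart hG
  obtain ⟨g1, g2⟩ := hG.gap _ _ i1 i2 (hu.solves_orthPart hG)
  have h3 := mul_le_mul_of_nonneg_left hh hG.nonneg
  have h4 : c * (ε ^ 2 * ((3 * CK * R ^ 2 + 1) * U * (2 * U + 1)))
      = ε ^ 2 * (c * ((3 * CK * R ^ 2 + 1) * U * (2 * U + 1))) := by ring
  rw [h4] at h3
  exact ⟨g1.trans h3, g2.mono fun x hx => hx.trans h3⟩

/-- The constant in the Lipschitz dependence of the orthogonal part. -/
def lipConst (c CK R U : ℝ) : ℝ :=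
  c * ((3 * CK * R ^ 2 + 1) * (1 + 4 * U + 4 * U ^ 2))

/-- Subtracting the equations of two solutions and applying the gap gives ‖w₁‖ ≤ ε²J(d + ‖w₁‖),
where J is `lipConst` and d the distance of the pairs. Since ε²J ≤ 1/2, the term in ‖w₁‖ is absorbed
on the left. -/
lemma orthPart_sub_le (hG : IsGapped Q A B c R) (hε : 0 < ε) (hR : 0 ≤ R) (hCK : 0 ≤ CK)
    (hu : IsScaledSolution V VL Q A B ε R a b e u κ) (hU : ‖u‖ ≤ U)
    (hu' : IsScaledSolution V VL Q A B ε R a' b' e' u' κ') (hU' : ‖u'‖ ≤ U)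
    (hNL : NLClose V VL K R ε τ) (hτ : τ ≤ 1) (hK : ∀ x, |K x| ≤ CK)
    (hsmall : ε ^ 2 * lipConst c CK R U ≤ 1 / 2) :
    ‖orthPart A B a b u - orthPart A B a' b' u'‖
        ≤ ε ^ 2 * (2 * lipConst c CK R U) * (‖a - a'‖ + ‖b - b'‖) ∧
    ‖u - u'‖ ≤ 2 * (‖a - a'‖ + ‖b - b'‖) := by
  set d := ‖a - a'‖ + ‖b - b'‖ with hd
  have hd0 : 0 ≤ d := by positivity
  set L := 3 * CK * R ^ 2 + 1 with hL
  have hL0 : 0 < L := by positivity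
  have hU0 : 0 ≤ U := (norm_nonneg u).trans hU
  set w₁ := orthPart A B a b u - orthPart A B a' b' u' with hw₁
  have hw : ‖u - u'‖ ≤ d + ‖w₁‖ := by
    have e1 : u - u' = ((a - a') • A + (b - b') • B) + w₁ := by
      simp only [hw₁, orthPart]
      module
    rw [e1]
    refine (norm_add_le _ _).trans (add_le_add_left ((norm_add_le _ _).trans ?_) _)
    rw [norm_smul, norm_smul, hG.norm_A, hG.norm_B, mul_one, mul_one]
  have hk : ‖κ - κ'‖ ≤ L * ‖u - u'‖ := hu.norm_kappa_sub_le hu' hNL hτ hK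
  have he : ‖e‖ ≤ 2 * (L * U) := hu.norm_e_le hG hε hR hCK hU hNL hτ hK
  -- The energies are compared through (e − e')a' = ⟨A, κ − κ'⟩ − e(a − a') and its analogue for b'.
  -- As |a'| + |b'| ≥ 1, the sum controls e − e' even when one of the components vanishes.
  have hee : ‖e - e'‖ ≤ 2 * (L * ‖u - u'‖) + 2 * (L * U) * d := by
    obtain ⟨h1, h2⟩ := hu.inner_kappa hG hε
    obtain ⟨h1', h2'⟩ := hu'.inner_kappa hG hε
    have b1 : ‖e - e'‖ * ‖a'‖ ≤ L * ‖u - u'‖ + 2 * (L * U) * ‖a - a'‖ := by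
      rw [← norm_mul, show (e - e') * a' = inner ℂ A (κ - κ') - e * (a - a') by
        rw [inner_sub_right, h1, h1']; ring]
      refine (norm_sub_le _ _).trans (add_le_add ?_ ?_)
      · refine (norm_inner_le_norm _ _).trans ?_
        rwa [hG.norm_A, one_mul]
      · rw [norm_mul]
        exact mul_le_mul_of_nonneg_right he (norm_nonneg _)
    have b2 : ‖e - e'‖ * ‖b'‖ ≤ L * ‖u - u'‖ + 2 * (L * U) * ‖b - b'‖ := by
      rw [← norm_mul, show (e - e') * b' = inner ℂ B (κ - κ') - e * (b - b') by
        rw [inner_sub_right, h2, h2']; ring]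
      refine (norm_sub_le _ _).trans (add_le_add ?_ ?_)
      · refine (norm_inner_le_norm _ _).trans ?_
        rwa [hG.norm_B, one_mul]
      · rw [norm_mul]
        exact mul_le_mul_of_nonneg_right he (norm_nonneg _)
    have b3 := mul_le_mul_of_nonneg_left (one_le_norm_add_norm hu'.unit) (norm_nonneg (e - e'))
    rw [hd]
    linarith
  have hs : Solves Q w₁ (((ε ^ 2 : ℝ) : ℂ) • (e • (u - u') + (e - e') • u' - (κ - κ'))) := by
    have h := (hu.solves_orthPart hG).sub (hu'.solves_orthPart hG)
    convert h using 1
    module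
  have hh : ‖((ε ^ 2 : ℝ) : ℂ) • (e • (u - u') + (e - e') • u' - (κ - κ'))‖
      ≤ ε ^ 2 * (L * (1 + 4 * U + 4 * U ^ 2) * (d + ‖w₁‖)) := by
    rw [norm_smul, Complex.norm_real, Real.norm_of_nonneg (by positivity)]
    refine mul_le_mul_of_nonneg_left ?_ (by positivity)
    have c1 : ‖e • (u - u')‖ ≤ 2 * (L * U) * ‖u - u'‖ := by
      rw [norm_smul]; exact mul_le_mul_of_nonneg_right he (norm_nonneg _)
    have c2 : ‖(e - e') • u'‖ ≤ (2 * (L * ‖u - u'‖) + 2 * (L * U) * d) * U := by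
      rw [norm_smul]; exact mul_le_mul hee hU' (norm_nonneg _) (by positivity)
    have c3 : d ≤ d + ‖w₁‖ := le_add_of_nonneg_right (norm_nonneg _)
    have c4 : 0 ≤ L * (1 + 4 * U) := by positivity
    have c5 : 0 ≤ 4 * L * U ^ 2 := by positivity
    have c6 := mul_le_mul_of_nonneg_left hw c4
    have c7 := mul_le_mul_of_nonneg_left c3 c5
    have c8 : 0 ≤ 2 * L * U ^ 2 * d := by positivity
    have c9 := norm_sub_le (e • (u - u') + (e - e') • u') (κ - κ')
    have c10 := norm_add_le (e • (u - u')) ((e - e') • u')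
    linarith
  obtain ⟨i1, i2⟩ := hu.inner_orthPart hG
  obtain ⟨i1', i2'⟩ := hu'.inner_orthPart hG
  obtain ⟨g1, -⟩ := hG.gap w₁ _ (by rw [hw₁, inner_sub_right, i1, i1', sub_zero])
    (by rw [hw₁, inner_sub_right, i2, i2', sub_zero]) hs
  have g2 := g1.trans (mul_le_mul_of_nonneg_left hh hG.nonneg)
  have g3 : ‖w₁‖ ≤ ε ^ 2 * lipConst c CK R U * (d + ‖w₁‖) := by
    refine g2.trans_eq ?_
    rw [lipConst, ← hL]
    ring
  have g4 := mul_le_mul_of_nonneg_right hsmall (norm_nonneg w₁)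
  have g5 := mul_le_mul_of_nonneg_right hsmall hd0
  constructor <;> linarith

end IsScaledSolution

lemma memLp_cubicTerm (hKm : Measurable K) (hK : ∀ x, |K x| ≤ CK) {ψ : Plane → ℂ}
    (hψ : AEStronglyMeasurable ψ cellMeasure) (hR : ∀ᵐ x ∂cellMeasure, ‖ψ x‖ ≤ R) :
    MemLp (fun x => (K x : ℂ) * cubic (ψ x)) 2 cellMeasure := by
  refine MemLp.of_bound (C := CK * R ^ 3) ((Complex.measurable_ofReal.comp
    hKm).aestronglyMeasurable.mul (continuous_cubic.comp_aestronglyMeasurable hψ)) ?_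
  filter_upwards [hR] with x hx
  rw [norm_mul, Complex.norm_real, cubic]
  have h1 : ‖(starRingEnd ℂ) (ψ x)‖ ≤ R := by rwa [RCLike.norm_conj]
  refine (mul_le_mul (hK x) (norm_mul₃_le hx hx h1) (norm_nonneg _)
    ((abs_nonneg _).trans (hK x))).trans_eq (by ring)

/-- The leading part of the projection of the nonlinear term onto `F`. -/
def cubicProj (K : Plane → ℝ) (F A B : Plane → ℂ) (a b : ℂ) : ℂ :=
  ∫ x in cell, (starRingEnd ℂ) (F x) * (K x * cubic (a * A x + b * B x))

lemma kernelPart_ae (A B : Hil) (a b : ℂ) :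
    (a • A + b • B : Hil) =ᵐ[cellMeasure] fun x => a * A x + b * B x := by
  filter_upwards [Lp.coeFn_add (a • A) (b • B), Lp.coeFn_smul a A, Lp.coeFn_smul b B]
    with x h1 h2 h3
  rw [h1, Pi.add_apply, h2, h3, Pi.smul_apply, Pi.smul_apply, smul_eq_mul, smul_eq_mul]

lemma norm_kernelPart_le {R₀ : ℝ} (hA : ∀ᵐ x ∂cellMeasure, ‖A x‖ ≤ R₀)
    (hB : ∀ᵐ x ∂cellMeasure, ‖B x‖ ≤ R₀) (hab : ‖a‖ ^ 2 + ‖b‖ ^ 2 = 1) :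
    ∀ᵐ x ∂cellMeasure, ‖a * A x + b * B x‖ ≤ 2 * R₀ := by
  obtain ⟨ha, hb⟩ := norm_le_one_of_unit hab
  filter_upwards [hA, hB] with x h1 h2
  refine (norm_add_le _ _).trans ?_
  rw [norm_mul, norm_mul]
  have := mul_le_mul ha h1 (norm_nonneg _) zero_le_one
  have := mul_le_mul hb h2 (norm_nonneg _) zero_le_one
  linarith

/-- The reduced equations: their remainders are small, also in Lipschitz norm. -/
theorem reduced_equations (hV : IsNonlinearPotential V VL K) (hR : 0 ≤ R) {R₀ : ℝ}
    (hR₀ : 2 * R₀ ≤ R) (hG : IsGapped Q A B c R₀) {τ : ℝ} (hτ : 0 < τ) :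
    ∃ ε₁ : ℝ, 0 < ε₁ ∧ ∀ ε, 0 < ε → ε < ε₁ →
      (∀ a b e u κ, IsScaledSolution V VL Q A B ε R a b e u κ →
        ‖e * a - cubicProj K A A B a b‖ ≤ τ ∧ ‖e * b - cubicProj K B A B a b‖ ≤ τ) ∧
      (∀ a b e u κ a' b' e' u' κ', IsScaledSolution V VL Q A B ε R a b e u κ →
        IsScaledSolution V VL Q A B ε R a' b' e' u' κ' →
        ‖(e * a - cubicProj K A A B a b) - (e' * a' - cubicProj K A A B a' b')‖
          ≤ τ * (‖a - a'‖ + ‖b - b'‖) ∧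
        ‖(e * b - cubicProj K B A B a b) - (e' * b' - cubicProj K B A B a' b')‖
          ≤ τ * (‖a - a'‖ + ‖b - b'‖)) := by
  obtain ⟨CK, hCK, hK⟩ := hV.exists_bound_K
  have hGR : IsGapped Q A B c R :=
    { hG with
      bound_A := hG.bound_A.mono fun x hx => hx.trans (by linarith)
      bound_B := hG.bound_B.mono fun x hx => hx.trans (by linarith) }
  obtain ⟨U, hU0, hU⟩ : ∃ U : ℝ, 0 ≤ U ∧ ∀ u : Hil, (∀ᵐ x ∂cellMeasure, ‖u x‖ ≤ R) → ‖u‖ ≤ U :=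
    ⟨_, by positivity, fun u hu => Lp.norm_le_of_ae_bound hR hu⟩
  set J := IsScaledSolution.lipConst c CK R U with hJ
  have hc := hG.nonneg
  have hJ0 : 0 ≤ J := by rw [hJ, IsScaledSolution.lipConst]; positivity
  set S := c * ((3 * CK * R ^ 2 + 1) * U * (2 * U + 1)) with hS
  have hS0 : 0 ≤ S := by positivity
  -- The non-cubic error contributes τ₁‖u‖ ≤ τ₁U to the size and τ₁‖u − u'‖ ≤ 2τ₁d to the Lipschitz
  -- bound. This choice keeps both within half of the allowance.
  set τ₁ := min 1 (τ / (4 * (U + 1))) with hτ₁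
  have hτ₁0 : 0 < τ₁ := by positivity
  have hτ₁1 : τ₁ ≤ 1 := min_le_left _ _
  have hτ₁τ : τ₁ * (4 * (U + 1)) ≤ τ := (le_div_iff₀ (by positivity)).1 (min_le_right _ _)
  obtain ⟨ε₁, hε₁, hNL⟩ := hV.scaledNL_sub_le hR hτ₁0
  -- All remaining errors carry a factor ε², and Z collects their coefficients: the first summand
  -- for the Lipschitz bound, the second for the size.
  set Z := CK * (6 * R * S * 2 + (3 * R ^ 2 + 3 * R * S) * (2 * J)) + CK * (3 * R ^ 2) * S with hZ
  have hZ0 : 0 ≤ Z := by positivity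
  refine ⟨min (min 1 ε₁) (min (1 / (2 * (J + 1))) (τ / (2 * (Z + 1)))), by positivity,
    fun ε hε hlt => ?_⟩
  have l1 : ε < 1 := hlt.trans_le ((min_le_left _ _).trans (min_le_left _ _))
  have l2 : ε < ε₁ := hlt.trans_le ((min_le_left _ _).trans (min_le_right _ _))
  have l3 : ε * (2 * (J + 1)) ≤ 1 := (le_div_iff₀ (by positivity)).1
    (hlt.le.trans ((min_le_right _ _).trans (min_le_left _ _)))
  have l4 : ε * (2 * (Z + 1)) ≤ τ := (le_div_iff₀ (by positivity)).1
    (hlt.le.trans ((min_le_right _ _).trans (min_le_right _ _)))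
  have hεε : ε ^ 2 ≤ ε := by nlinarith
  have hsmall : ε ^ 2 * J ≤ 1 / 2 := by
    have := mul_le_mul_of_nonneg_right hεε hJ0
    linarith
  have hεZ : ε ^ 2 * Z ≤ τ / 2 := by
    have := mul_le_mul_of_nonneg_right hεε hZ0
    linarith
  have hεS : ε ^ 2 * S ≤ S := by
    have : ε ^ 2 ≤ 1 := by linarith
    nlinarith
  replace hNL : NLClose V VL K R ε τ₁ := hNL ε hε l2
  have hψ (a b : ℂ) (hab : ‖a‖ ^ 2 + ‖b‖ ^ 2 = 1) :
      ∀ᵐ x ∂cellMeasure, ‖a * A x + b * B x‖ ≤ R :=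
    (norm_kernelPart_le hG.bound_A hG.bound_B hab).mono fun x hx => hx.trans hR₀
  have hψm (a b : ℂ) : AEStronglyMeasurable (fun x => a * A x + b * B x) cellMeasure :=
    ((Lp.aestronglyMeasurable A).const_mul a).add ((Lp.aestronglyMeasurable B).const_mul b)
  have hP (a b : ℂ) (hab : ‖a‖ ^ 2 + ‖b‖ ^ 2 = 1) :=
    memLp_cubicTerm hV.measurable_K hK (hψm a b) (hψ a b hab)
  have hinner (F : Hil) (a b : ℂ) (hab : ‖a‖ ^ 2 + ‖b‖ ^ 2 = 1) :
      inner ℂ F ((hP a b hab).toLp _) = cubicProj K F A B a b := by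
    conv_lhs => rw [← Lp.toLp_coeFn F (Lp.memLp F)]
    exact inner_toLp _ _
  have hrem (a b e : ℂ) (u κ : Hil) (h : IsScaledSolution V VL Q A B ε R a b e u κ) :
      e * a - cubicProj K A A B a b = inner ℂ A (κ - (hP a b h.unit).toLp _) ∧
      e * b - cubicProj K B A B a b = inner ℂ B (κ - (hP a b h.unit).toLp _) := by
    rw [inner_sub_right, inner_sub_right, hinner A a b h.unit, hinner B a b h.unit, (h.inner_kappa hGR hε).1,
      (h.inner_kappa hGR hε).2]
    exact ⟨rfl, rfl⟩
  -- The remainder splits into the non-cubic part of the nonlinearity at u and the change of the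
  -- cubic part when u is replaced by its kernel part.
  have hpt (a b e : ℂ) (u κ : Hil) (h : IsScaledSolution V VL Q A B ε R a b e u κ) :
      ∀ᵐ x ∂cellMeasure, (κ - (hP a b h.unit).toLp _ : Hil) x
          = (scaledNL V VL ε x (u x) - K x * cubic (u x))
            + K x * (cubic (u x) - cubic (a * A x + b * B x)) ∧
        orthPart A B a b u x = u x - (a * A x + b * B x) := by
    filter_upwards [Lp.coeFn_sub κ ((hP a b h.unit).toLp _), (hP a b h.unit).coeFn_toLp, h.kappa,
      Lp.coeFn_sub u (a • A + b • B), kernelPart_ae A B a b] with x a1 a2 a3 a4 a5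
    rw [a1, Pi.sub_apply, a2, a3, orthPart, a4, Pi.sub_apply, a5]
    exact ⟨by ring, rfl⟩
  have hZ1 : CK * (3 * R ^ 2) * (ε ^ 2 * S) ≤ τ / 2 := by
    refine le_trans ?_ hεZ
    have : 0 ≤ CK * (6 * R * S * 2 + (3 * R ^ 2 + 3 * R * S) * (2 * J)) := by positivity
    rw [hZ]
    nlinarith [mul_nonneg (sq_nonneg ε) this]
  refine ⟨fun a b e u κ h => ?_, fun a b e u κ a' b' e' u' κ' h h' => ?_⟩
  · have hr : ‖κ - (hP a b h.unit).toLp _‖ ≤ τ := by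
      have h1 : ‖κ - (hP a b h.unit).toLp _‖ ≤ τ₁ * ‖u‖
          + CK * (3 * R ^ 2) * ‖orthPart A B a b u‖ := by
        refine Hil.norm_le_add_of_ae hτ₁0.le (by positivity) ?_
        filter_upwards [hpt a b e u κ h, h.bound, hψ a b h.unit] with x a1 a2 a3
        rw [a1.1, a1.2]
        refine (norm_add_le _ _).trans (add_le_add ?_ ?_)
        · have := hNL x (u x) 0 a2 (by simpa using hR)
          rwa [scaledNL_zero, cubic_zero, mul_zero, sub_zero, sub_zero, sub_zero] at this
        · rw [norm_mul, Complex.norm_real, mul_assoc]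
          exact mul_le_mul (hK x) (norm_cubic_sub_le a2 a3) (norm_nonneg _) hCK
      have h2 := (h.orthPart_le hGR hε hR hCK (hU u h.bound) hNL hτ₁1 hK).1
      have h3 : CK * (3 * R ^ 2) * ‖orthPart A B a b u‖ ≤ CK * (3 * R ^ 2) * (ε ^ 2 * S) :=
        mul_le_mul_of_nonneg_left h2 (by positivity)
      have h4 : τ₁ * ‖u‖ ≤ τ₁ * U := mul_le_mul_of_nonneg_left (hU u h.bound) hτ₁0.le
      linarith
    rw [(hrem a b e u κ h).1, (hrem a b e u κ h).2]
    constructor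
    · refine (norm_inner_le_norm _ _).trans ?_
      rwa [hG.norm_A, one_mul]
    · refine (norm_inner_le_norm _ _).trans ?_
      rwa [hG.norm_B, one_mul]
  · set d := ‖a - a'‖ + ‖b - b'‖ with hd
    have hd0 : 0 ≤ d := by positivity
    have hr : ‖(κ - (hP a b h.unit).toLp _) - (κ' - (hP a' b' h'.unit).toLp _)‖ ≤ τ * d := by
      have h1 : ‖(κ - (hP a b h.unit).toLp _) - (κ' - (hP a' b' h'.unit).toLp _)‖
          ≤ (τ₁ + CK * (6 * R * (ε ^ 2 * S))) * ‖u - u'‖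
          + CK * (3 * R ^ 2 + 3 * R * (ε ^ 2 * S))
            * ‖orthPart A B a b u - orthPart A B a' b' u'‖ := by
        refine Hil.norm_le_add_of_ae (by positivity) (by positivity) ?_
        filter_upwards [hpt a b e u κ h, hpt a' b' e' u' κ' h', h.bound, h'.bound,
          hψ a b h.unit, hψ a' b' h'.unit,
          (h'.orthPart_le hGR hε hR hCK (hU u' h'.bound) hNL hτ₁1 hK).2,
          Lp.coeFn_sub (κ - (hP a b h.unit).toLp _) (κ' - (hP a' b' h'.unit).toLp _),
          Lp.coeFn_sub u u', Lp.coeFn_sub (orthPart A B a b u) (orthPart A B a' b' u')]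
          with x a1 a2 a3 a4 a5 a6 a7 a8 a9 a10
        rw [a8, a9, a10, Pi.sub_apply, Pi.sub_apply, Pi.sub_apply, a1.1, a1.2, a2.1, a2.2]
        rw [a2.2] at a7
        have b1 := hNL x (u x) (u' x) a3 a4
        have b2 := mul_le_mul (hK x) (norm_cubic_sub_sub_le a3 a5 a4 a6 a7) (norm_nonneg _) hCK
        rw [← Real.norm_eq_abs, ← Complex.norm_real, ← norm_mul] at b2
        refine le_trans (le_of_eq_of_le ?_ (norm_add_le _ _)) ((add_le_add b1 b2).trans_eq ?_)
        · congr 1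
          ring
        · ring
      obtain ⟨h2, h3⟩ := h.orthPart_sub_le hGR hε hR hCK (hU u h.bound) h' (hU u' h'.bound)
        hNL hτ₁1 hK hsmall
      have h4 := mul_le_mul_of_nonneg_left h3
        (by positivity : 0 ≤ τ₁ + CK * (6 * R * (ε ^ 2 * S)))
      have h5 := mul_le_mul_of_nonneg_left h2
        (by positivity : 0 ≤ CK * (3 * R ^ 2 + 3 * R * (ε ^ 2 * S)))
      have h6 : CK * (3 * R ^ 2 + 3 * R * (ε ^ 2 * S)) * (ε ^ 2 * (2 * J) * d)
          ≤ CK * (3 * R ^ 2 + 3 * R * S) * (ε ^ 2 * (2 * J) * d) := by gcongr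
      have h7 := mul_le_mul_of_nonneg_right hεZ hd0
      have h8 : 0 ≤ ε ^ 2 * (CK * (3 * R ^ 2) * S) * d := by positivity
      have h9 : τ₁ * 4 ≤ τ := by
        have : 0 ≤ τ₁ * U := by positivity
        linarith
      have h10 := mul_le_mul_of_nonneg_right h9 hd0
      rw [hZ] at h7
      linarith
    rw [(hrem a b e u κ h).1, (hrem a b e u κ h).2, (hrem a' b' e' u' κ' h').1,
      (hrem a' b' e' u' κ' h').2, ← inner_sub_right, ← inner_sub_right]
    constructor
    · refine (norm_inner_le_norm _ _).trans ?_
      rwa [hG.norm_A, one_mul]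
    · refine (norm_inner_le_norm _ _).trans ?_
      rwa [hG.norm_B, one_mul]

end Estimates

end Honeycomb

end

/-! ### Ground states, symmetries of allowed pairs, and rescaling. -/

noncomputable section

namespace Honeycomb

open scoped ENNReal Topology
open Filter

lemma exp_mul_conj_cancel (t : ℝ) :
    (starRingEnd ℂ) (Complex.exp (Complex.I * t)) * Complex.exp (Complex.I * t) = 1 := by
  rw [mul_comm, Complex.mul_conj, Complex.normSq_eq_norm_sq, mul_comm Complex.I,
    Complex.norm_exp_ofReal_mul_I]
  simp

/-- The phases in the transformed rotation cancel in sesquilinear expressions. -/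
lemma conj_rotK_mul_rotK (f g : Plane → ℂ) (x : Plane) :
    (starRingEnd ℂ) (rotK f x) * rotK g x = (starRingEnd ℂ) (f (rot x)) * g (rot x) := by
  have h1 := exp_mul_conj_cancel (-(inner ℝ diracK x : ℝ))
  have h2 := exp_mul_conj_cancel (inner ℝ diracK (rot x) : ℝ)
  have e : Complex.I * ((-(inner ℝ diracK x : ℝ) : ℝ) : ℂ)
      = -(Complex.I * (inner ℝ diracK x : ℝ)) := by push_cast; ring
  rw [e] at h1
  simp only [rotK, map_mul]
  calc _ = ((starRingEnd ℂ) (Complex.exp (-(Complex.I * (inner ℝ diracK x : ℝ))))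
          * Complex.exp (-(Complex.I * (inner ℝ diracK x : ℝ))))
        * ((starRingEnd ℂ) (Complex.exp (Complex.I * (inner ℝ diracK (rot x) : ℝ)))
          * Complex.exp (Complex.I * (inner ℝ diracK (rot x) : ℝ)))
        * ((starRingEnd ℂ) (f (rot x)) * g (rot x)) := by ring
    _ = _ := by rw [h1, h2, one_mul, one_mul]

lemma ζ₃_pow_three : ζ₃ ^ 3 = 1 := by
  have h := (Complex.isPrimitiveRoot_exp 3 (by norm_num)).pow_eq_one
  simpa [ζ₃] using h

lemma ζ₃_ne_one : ζ₃ ≠ 1 := by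
  have h := (Complex.isPrimitiveRoot_exp 3 (by norm_num)).ne_one (by norm_num)
  simpa [ζ₃] using h

lemma ζ₃_sq_ne_one : ζ₃ ^ 2 ≠ 1 := by
  intro h
  have h3 := ζ₃_pow_three
  rw [pow_succ, h, one_mul] at h3
  exact ζ₃_ne_one h3

lemma conj_ζ₃ : (starRingEnd ℂ) ζ₃ = ζ₃ ^ 2 := by
  have hn : ‖ζ₃‖ = 1 := by
    rw [ζ₃, show (2 * Real.pi * Complex.I / 3 : ℂ) = ((2 * Real.pi / 3 : ℝ) : ℂ) * Complex.I by
      push_cast; ring, Complex.norm_exp_ofReal_mul_I]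
  have h1 : ζ₃ * (starRingEnd ℂ) ζ₃ = 1 := by
    rw [Complex.mul_conj, Complex.normSq_eq_norm_sq, hn]; simp
  have h0 : ζ₃ ≠ 0 := fun h => by rw [h, norm_zero] at hn; exact zero_ne_one hn
  refine mul_left_cancel₀ h0 ?_
  rw [h1, ← ζ₃_pow_three]
  ring

lemma Solves.of_coef {Q : Hil →L[ℂ] Hil} {u h : Hil} {f F : Plane → ℂ}
    (hf : f =ᵐ[cellMeasure] u) (hF : F =ᵐ[cellMeasure] (h - Q u : Hil))
    (hc : ∀ n, symb n * coef f n = coef F n) : Solves Q u h := fun n => by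
  have h1 := hc n
  rw [coef_eq_repr hf, coef_eq_repr hF, mul_left_comm] at h1
  exact mul_left_cancel₀ (by exact_mod_cast (Real.sqrt_ne_zero'.2 area_pos)) h1

lemma norm_toLp_sq {f : Plane → ℂ} (hf : MemLp f 2 cellMeasure) :
    ‖hf.toLp f‖ ^ 2 = ∫ x in cell, ‖f x‖ ^ 2 := by
  have h1 := inner_self_eq_norm_sq_to_K (𝕜 := ℂ) (hf.toLp f)
  rw [inner_toLp] at h1
  have h2 : ∫ x in cell, (starRingEnd ℂ) (f x) * f x = ((∫ x in cell, ‖f x‖ ^ 2 : ℝ) : ℂ) := by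
    rw [← integral_complex_ofReal]
    refine integral_congr_ae (Eventually.of_forall fun x => ?_)
    beta_reduce
    rw [mul_comm, Complex.mul_conj, Complex.normSq_eq_norm_sq]
  rw [h2] at h1
  refine Complex.ofReal_injective ?_
  rw [h1]
  simp

lemma norm_toLp_eq {f : Plane → ℂ} (hf : MemLp f 2 cellMeasure) : ‖hf.toLp f‖ = norm₂ f := by
  rw [norm₂, ← norm_toLp_sq hf, Real.sqrt_sq (norm_nonneg _)]

section Gap

variable {V : Plane → ℝ → ℝ} {VL K : Plane → ℝ} {E₀ : ℝ} {φa φb : Plane → ℂ}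

lemma IsGroundPair.memL2_a (hφ : IsGroundPair VL E₀ φa φb) : MemL2 φa := hφ.eigen_a.coef_eq.1

lemma IsGroundPair.memL2_b (hφ : IsGroundPair VL E₀ φa φb) : MemL2 φb := hφ.eigen_b.coef_eq.1

/-- The ground states as elements of `L²`. -/
abbrev IsGroundPair.A (hφ : IsGroundPair VL E₀ φa φb) : Hil := hφ.memL2_a.memLp.toLp φa

/-- The ground states as elements of `L²`. -/
abbrev IsGroundPair.B (hφ : IsGroundPair VL E₀ φa φb) : Hil := hφ.memL2_b.memLp.toLp φb

/-- The modes lie in different eigenspaces of a unitary rotation: the change of variables multiplies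
the inner product by conj(ω)² = ω ≠ 1. -/
lemma IsGroundPair.inner_eq_zero (hφ : IsGroundPair VL E₀ φa φb) : inner ℂ hφ.A hφ.B = 0 := by
  rw [inner_toLp]
  set m : Plane → ℂ := fun x => (starRingEnd ℂ) (φa x) * φb x
  have hm : AEStronglyMeasurable m cellMeasure :=
    (Complex.continuous_conj.comp_aestronglyMeasurable
      hφ.memL2_a.memLp.aestronglyMeasurable).mul hφ.memL2_b.memLp.aestronglyMeasurable
  have hp : Periodic m := fun x => by
    simp only [m, (hφ.memL2_a.periodic x).1, (hφ.memL2_a.periodic x).2,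
      (hφ.memL2_b.periodic x).1, (hφ.memL2_b.periodic x).2, and_self]
  have h1 := integral_comp_wrap measurePreserving_wrap_rot hm hp
  have h2 : ∫ x in cell, m (rot x) = ζ₃ * ∫ x in cell, m x := by
    rw [← integral_const_mul]
    refine integral_congr_ae ?_
    filter_upwards [ae_cell_of_ae hφ.rot_a, ae_cell_of_ae hφ.rot_b] with x ha hb
    simp only [m]
    rw [← conj_rotK_mul_rotK, ha, hb, map_mul, conj_ζ₃]
    linear_combination ζ₃ * (starRingEnd ℂ) (φa x) * φb x * ζ₃_pow_three
  rw [h2] at h1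
  have h3 : (ζ₃ - 1) * ∫ x in cell, m x = 0 := by linear_combination h1
  exact (mul_eq_zero.1 h3).resolve_left (sub_ne_zero.2 ζ₃_ne_one)

/-- `Q` is multiplication by `V_L - E₀`. -/
def IsShiftedPotential (Q : Hil →L[ℂ] Hil) (VL : Plane → ℝ) (E₀ : ℝ) : Prop :=
  ∀ u, Q u =ᵐ[cellMeasure] fun x => ((VL x - E₀ : ℝ) : ℂ) * u x

lemma IsNonlinearPotential.exists_shifted (hV : IsNonlinearPotential V VL K) (E₀ : ℝ) :
    ∃ Q, IsShiftedPotential Q VL E₀ := by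
  obtain ⟨C, hC⟩ := hV.exists_bound_VL
  refine exists_mulOp (C := C + |E₀|) (Complex.continuous_ofReal.comp
    (hV.continuous_VL.sub continuous_const)).aestronglyMeasurable fun x => ?_
  rw [Complex.norm_real, Real.norm_eq_abs]
  exact (abs_sub _ _).trans (by gcongr; exact hC x)

lemma IsShiftedPotential.symm {Q : Hil →L[ℂ] Hil} (hQ : IsShiftedPotential Q VL E₀) (u v : Hil) :
    inner ℂ (Q u) v = inner ℂ u (Q v) := by
  rw [L2.inner_def, L2.inner_def]
  refine integral_congr_ae ?_
  filter_upwards [hQ u, hQ v] with x h1 h2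
  rw [h1, h2, RCLike.inner_apply, RCLike.inner_apply, map_mul, Complex.conj_ofReal]
  ring

lemma IsShiftedPotential.solves_of_eigen {Q : Hil →L[ℂ] Hil} (hQ : IsShiftedPotential Q VL E₀)
    {f : Plane → ℂ} (hf : IsEigenfunction VL E₀ f) (hm : MemLp f 2 cellMeasure) :
    Solves Q (hm.toLp f) 0 := by
  obtain ⟨-, -, hc⟩ := hf.coef_eq
  refine Solves.of_coef hm.coeFn_toLp.symm ?_ hc
  rw [zero_sub]
  filter_upwards [Lp.coeFn_neg (Q (hm.toLp f)), hQ (hm.toLp f), hm.coeFn_toLp] with x h1 h2 h3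
  rw [h1, Pi.neg_apply, h2, h3]
  push_cast
  ring

/-- By elliptic regularity, an L² solution of the Fourier equation is a genuine H² eigenfunction.
The hypothesis on the eigenspace then puts it in the span it is orthogonal to. -/
lemma IsGroundPair.eq_zero_of_orthogonal (hφ : IsGroundPair VL E₀ φa φb) (hVL : Periodic VL)
    {Q : Hil →L[ℂ] Hil} (hQ : IsShiftedPotential Q VL E₀) {u : Hil}
    (hu : u ∈ (Submodule.span ℂ {hφ.A, hφ.B})ᗮ) (hs : Solves Q u 0) : u = 0 := by
  by_contra hu0
  have heig : IsEigenfunction VL E₀ (lift u) := by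
    refine isEigenfunction_lift hVL hu0 (w := 0 - Q u) ?_ hs
    rw [zero_sub]
    filter_upwards [Lp.coeFn_neg (Q u), hQ u] with x h1 h2
    rw [h1, Pi.neg_apply, h2]
    push_cast
    ring
  obtain ⟨c, d, hcd⟩ := hφ.span _ heig
  have hmem : u ∈ Submodule.span ℂ {hφ.A, hφ.B} := by
    refine Submodule.mem_span_pair.2 ⟨c, d, ?_⟩
    refine Lp.ext ?_
    filter_upwards [kernelPart_ae hφ.A hφ.B c d, hφ.memL2_a.memLp.coeFn_toLp,
      hφ.memL2_b.memLp.coeFn_toLp, ae_cell_of_ae hcd, lift_ae u] with x h1 h2 h3 h4 h5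
    rw [h1, h2, h3, ← h4, h5]
  exact hu0 (inner_self_eq_zero.1 (hu u hmem))

/-- The linear operator has a spectral gap. -/
theorem IsGroundPair.exists_isGapped (hφ : IsGroundPair VL E₀ φa φb) (hVL : Periodic VL)
    {Q : Hil →L[ℂ] Hil} (hQ : IsShiftedPotential Q VL E₀) :
    ∃ c R, IsGapped Q hφ.A hφ.B c R := by
  obtain ⟨c, hc0, hc⟩ := Solves.exists_gap Q (N := (Submodule.span ℂ {hφ.A, hφ.B})ᗮ)
    (Submodule.isClosed_orthogonal _) (fun u hu hs => hφ.eq_zero_of_orthogonal hVL hQ hu hs)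
  obtain ⟨C, hC0, hC⟩ := Solves.exists_sup_bound Q
  have hA := hQ.solves_of_eigen hφ.eigen_a hφ.memL2_a.memLp
  have hB := hQ.solves_of_eigen hφ.eigen_b hφ.memL2_b.memLp
  have hnA : ‖hφ.A‖ = 1 := by rw [norm_toLp_eq, hφ.norm_a]
  have hnB : ‖hφ.B‖ = 1 := by rw [norm_toLp_eq, hφ.norm_b]
  -- The L² gap needs c, and the sup bound C(‖u‖ + ‖h‖) becomes C(c + 1)‖h‖. The sum serves for
  -- both.
  refine ⟨c + C * (c + 1), C, hnA, hnB, hφ.inner_eq_zero, hA, hB, fun u h hs =>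
    ⟨Solves.inner_eq_zero hQ.symm hA hs, Solves.inner_eq_zero hQ.symm hB hs⟩, by positivity,
    fun u h hAu hBu hs => ?_, ?_, ?_⟩
  · have hu : u ∈ (Submodule.span ℂ {hφ.A, hφ.B})ᗮ := by
      rw [Submodule.mem_orthogonal]
      intro v hv
      obtain ⟨s, t, rfl⟩ := Submodule.mem_span_pair.1 hv
      rw [inner_add_left, inner_smul_left, inner_smul_left, hAu, hBu, mul_zero, mul_zero, add_zero]
    have h1 := hc u hu h hs
    have h2 : 0 ≤ C * (c + 1) * ‖h‖ := by positivity
    have h3 : 0 ≤ c * ‖h‖ := by positivity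
    refine ⟨by linarith, ?_⟩
    filter_upwards [hC u h hs] with x hx
    have := mul_le_mul_of_nonneg_left h1 hC0
    linarith
  · filter_upwards [hC _ _ hA] with x hx
    simpa [hnA] using hx
  · filter_upwards [hC _ _ hB] with x hx
    simpa [hnB] using hx

end Gap

/-- The Fourier form of `Allowed`. -/
def FourierAllowed (V : Plane → ℝ → ℝ) (E₀ : ℝ) (φa φb : Plane → ℂ) (M ε : ℝ) (a b : ℂ) : Prop :=
  ‖a‖ ^ 2 + ‖b‖ ^ 2 = 1 ∧
  ∃ (φ : Plane → ℂ) (E : ℂ), MemL2 φ ∧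
    (∀ n, symb n * coef φ n = coef (fun x => (E - V x (‖φ x‖ ^ 2)) * φ x) n) ∧ ‖E - E₀‖ ≤ ε ∧
    inner₂ φa φ = ε * a ∧ inner₂ φb φ = ε * b ∧
    norm₂ φ ≤ M * ε ∧ ∀ᵐ x ∂cellMeasure, ‖φ x‖ ≤ M

section Allowed

variable {V : Plane → ℝ → ℝ} {VL K : Plane → ℝ} {E₀ : ℝ} {φa φb : Plane → ℂ} {M ε : ℝ} {a b : ℂ}

/-- Weak derivatives are left behind here: gauge change and reflection then only have to be checked
on integrals. -/
lemma Allowed.fourierAllowed (h : Allowed V E₀ φa φb M ε a b) :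
    FourierAllowed V E₀ φa φb M ε a b := by
  obtain ⟨hab, φ, E, heig, hE, h1, h2, h3, h4⟩ := h
  obtain ⟨m1, -, m3⟩ := heig.coef_eq
  exact ⟨hab, φ, E, m1, m3, hE, h1, h2, h3, ae_cell_of_ae h4⟩

/-- Gauge invariance. -/
lemma FourierAllowed.const_mul {z : ℂ} (hz : ‖z‖ = 1) (h : FourierAllowed V E₀ φa φb M ε a b) :
    FourierAllowed V E₀ φa φb M ε (z * a) (z * b) := by
  obtain ⟨hab, φ, E, hm, hc, hE, h1, h2, h3, h4⟩ := h
  have hnorm (x : Plane) : ‖z * φ x‖ = ‖φ x‖ := by rw [norm_mul, hz, one_mul]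
  have hin (f : Plane → ℂ) : inner₂ f (fun x => z * φ x) = z * inner₂ f φ := by
    simp only [inner₂, mul_left_comm _ z]
    exact integral_const_mul _ _
  refine ⟨by rw [norm_mul, norm_mul, hz, one_mul, one_mul, hab], fun x => z * φ x, E,
    ⟨fun x => ?_, hm.memLp.const_mul z⟩, fun n => ?_, hE, ?_, ?_, ?_, ?_⟩
  · simp only [(hm.periodic x).1, (hm.periodic x).2, and_self]
  · have e : (fun x => (E - V x (‖z * φ x‖ ^ 2)) * (z * φ x))
        = fun x => z * ((E - V x (‖φ x‖ ^ 2)) * φ x) := by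
      funext x
      rw [hnorm]
      ring
    rw [e, coef_const_mul, coef_const_mul, ← hc]
    ring
  · rw [hin, h1]; ring
  · rw [hin, h2]; ring
  · simpa only [norm₂, hnorm] using h3
  · simpa only [hnorm] using h4

lemma Periodic.comp_neg {β : Type} {f : Plane → β} (hf : Periodic f) : Periodic fun x => f (-x) :=
  fun x => by
    have h1 := hf.add_lattice (neg_mem r₁_mem) (-x)
    have h2 := hf.add_lattice (neg_mem r₂_mem) (-x)
    rw [← neg_add] at h1 h2
    exact ⟨h1, h2⟩

lemma AEStronglyMeasurable.comp_neg {f : Plane → ℂ} (hf : AEStronglyMeasurable f cellMeasure)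
    (hp : Periodic f) : AEStronglyMeasurable (fun x => f (-x)) cellMeasure := by
  have h := hf.comp_measurePreserving measurePreserving_wrap_neg
  simpa only [Function.comp_def, hp.wrap] using h

lemma ae_comp_neg {p : Plane → Prop} (hp : Periodic p) (h : ∀ᵐ x ∂cellMeasure, p x) :
    ∀ᵐ x ∂cellMeasure, p (-x) := by
  have h := measurePreserving_wrap_neg.quasiMeasurePreserving.ae h
  simpa only [hp.wrap] using h

lemma integral_conj_comp_neg {f : Plane → ℂ} (hf : AEStronglyMeasurable f cellMeasure)
    (hp : Periodic f) :
    ∫ x in cell, (starRingEnd ℂ) (f (-x)) = (starRingEnd ℂ) (∫ x in cell, f x) := by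
  rw [integral_conj, integral_comp_wrap measurePreserving_wrap_neg hf hp]

/-- Conjugation combined with inversion fixes every exponential, so no frequency is moved. This
matters because `symb`, shifted by K, is not even in n. -/
lemma coef_conj_comp_neg {f : Plane → ℂ} (hf : AEStronglyMeasurable f cellMeasure)
    (hp : Periodic f) (n : Fin 2 → ℤ) :
    coef (fun x => (starRingEnd ℂ) (f (-x))) n = (starRingEnd ℂ) (coef f n) := by
  rw [coef, coef, ← integral_conj_comp_neg]
  · refine integral_congr_ae (Eventually.of_forall fun x => ?_)
    simp only [map_mul, expo_neg, conj_expo, neg_neg]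
  · exact (Complex.continuous_conj.comp (continuous_expo n)).aestronglyMeasurable.mul hf
  · intro x
    simp only [(hp x).1, (hp x).2, (periodic_expo n x).1, (periodic_expo n x).2, and_self]

lemma IsNonlinearPotential.aestronglyMeasurable_comp (hV : IsNonlinearPotential V VL K)
    {f : Plane → ℂ} (hf : AEStronglyMeasurable f cellMeasure) {t : ℝ} (ht : 0 ≤ t) :
    AEStronglyMeasurable (fun x => V x (t * ‖f x‖ ^ 2)) cellMeasure := by
  have h1 := hV.continuous.comp_aestronglyMeasurable
    (aestronglyMeasurable_id.prodMk ((hf.norm.pow 2).const_mul t))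
  refine h1.congr (Eventually.of_forall fun x => ?_)
  have : 0 ≤ t * ‖f x‖ ^ 2 := by positivity
  simp [max_eq_left this]

/-- Reflection symmetry. -/
lemma FourierAllowed.reflect (hV : IsNonlinearPotential V VL K)
    (hφ : IsGroundPair VL E₀ φa φb) (hVe : ∀ s, 0 ≤ s → IsHoneycomb fun x => V x s)
    (h : FourierAllowed V E₀ φa φb M ε a b) :
    FourierAllowed V E₀ φa φb M ε ((starRingEnd ℂ) b) ((starRingEnd ℂ) a) := by
  obtain ⟨hab, φ, E, hm, hc, hE, h1, h2, h3, h4⟩ := h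
  have hφm := hm.memLp.aestronglyMeasurable
  have hper : Periodic fun x => (starRingEnd ℂ) (φ (-x)) := fun x => by
    have := hm.periodic.comp_neg x
    simp only [this.1, this.2, and_self]
  have hmeas : AEStronglyMeasurable (fun x => (starRingEnd ℂ) (φ (-x))) cellMeasure :=
    Complex.continuous_conj.comp_aestronglyMeasurable (AEStronglyMeasurable.comp_neg hφm hm.periodic)
  have hbd : ∀ᵐ x ∂cellMeasure, ‖(starRingEnd ℂ) (φ (-x))‖ ≤ M := by
    have := ae_comp_neg (p := fun x => ‖φ x‖ ≤ M)
      (fun x => by simp only [(hm.periodic x).1, (hm.periodic x).2, and_self]) h4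
    simpa only [RCLike.norm_conj] using this
  have hain : inner₂ φa (fun x => (starRingEnd ℂ) (φ (-x))) = (starRingEnd ℂ) (inner₂ φb φ) := by
    rw [inner₂, inner₂, ← integral_conj_comp_neg]
    · refine integral_congr_ae ?_
      filter_upwards [ae_cell_of_ae hφ.conj_inv] with x hx
      rw [hx, map_mul]
    · exact (Complex.continuous_conj.comp_aestronglyMeasurable
        hφ.memL2_b.memLp.aestronglyMeasurable).mul hφm
    · intro x
      simp only [(hm.periodic x).1, (hm.periodic x).2, (hφ.memL2_b.periodic x).1,
        (hφ.memL2_b.periodic x).2, and_self]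
  have hbin : inner₂ φb (fun x => (starRingEnd ℂ) (φ (-x))) = (starRingEnd ℂ) (inner₂ φa φ) := by
    rw [inner₂, inner₂, ← integral_conj_comp_neg]
    · refine integral_congr_ae ?_
      have hneg := ae_comp_neg (p := fun x => φa x = (starRingEnd ℂ) (φb (-x))) (fun x => by
        have := hφ.memL2_b.periodic.comp_neg x
        simp only [this.1, this.2, (hφ.memL2_a.periodic x).1,
          (hφ.memL2_a.periodic x).2, and_self]) (ae_cell_of_ae hφ.conj_inv)
      filter_upwards [hneg] with x hx
      rw [hx, map_mul, neg_neg, Complex.conj_conj]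
    · exact (Complex.continuous_conj.comp_aestronglyMeasurable
        hφ.memL2_a.memLp.aestronglyMeasurable).mul hφm
    · intro x
      simp only [(hm.periodic x).1, (hm.periodic x).2, (hφ.memL2_a.periodic x).1,
        (hφ.memL2_a.periodic x).2, and_self]
  have hFm : AEStronglyMeasurable (fun x => (E - V x (‖φ x‖ ^ 2)) * φ x) cellMeasure := by
    have := hV.aestronglyMeasurable_comp hφm zero_le_one
    simp only [one_mul] at this
    exact (aestronglyMeasurable_const.sub
      (Complex.continuous_ofReal.comp_aestronglyMeasurable this)).mul hφm
  have hFp : Periodic fun x => (E - V x (‖φ x‖ ^ 2)) * φ x := fun x => by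
    have h5 := hV.periodic (‖φ x‖ ^ 2) (by positivity) x
    simp only at h5
    simp only [(hm.periodic x).1, (hm.periodic x).2, h5.1, h5.2, and_self]
  refine ⟨by rw [RCLike.norm_conj, RCLike.norm_conj, add_comm, hab],
    fun x => (starRingEnd ℂ) (φ (-x)), (starRingEnd ℂ) E,
    ⟨hper, MemLp.of_bound hmeas M hbd⟩, fun n => ?_, ?_, ?_, ?_, ?_, hbd⟩
  · have e : (fun x => ((starRingEnd ℂ) E - V x (‖(starRingEnd ℂ) (φ (-x))‖ ^ 2))
          * (starRingEnd ℂ) (φ (-x)))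
        = fun x => (starRingEnd ℂ) ((fun x => (E - V x (‖φ x‖ ^ 2)) * φ x) (-x)) := by
      funext x
      have h5 : V (-x) (‖φ (-x)‖ ^ 2) = V x (‖φ (-x)‖ ^ 2) :=
        (hVe (‖φ (-x)‖ ^ 2) (by positivity)).even x
      simp only [map_mul, map_sub, Complex.conj_ofReal, RCLike.norm_conj, h5]
    rw [e, coef_conj_comp_neg hFm hFp, coef_conj_comp_neg hφm hm.periodic, ← hc, map_mul,
      Complex.conj_ofReal]
  · rw [← Complex.conj_ofReal E₀, ← map_sub, RCLike.norm_conj]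
    exact hE
  · rw [hain, h2, map_mul, Complex.conj_ofReal]
  · rw [hbin, h1, map_mul, Complex.conj_ofReal]
  · have e : norm₂ (fun x => (starRingEnd ℂ) (φ (-x))) = norm₂ φ := by
      have h6 := integral_comp_wrap measurePreserving_wrap_neg (f := fun x => ((‖φ x‖ ^ 2 : ℝ) : ℂ))
        (Complex.continuous_ofReal.comp_aestronglyMeasurable (hφm.norm.pow 2)) (fun x => by
          simp only [(hm.periodic x).1, (hm.periodic x).2, and_self])
      rw [integral_complex_ofReal, integral_complex_ofReal] at h6
      simp only [norm₂, RCLike.norm_conj]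
      congr 1
      exact_mod_cast h6
    rw [e]
    exact h3

/-- Every allowed pair comes from a rescaled solution, uniformly bounded as `ε → 0`. -/
theorem FourierAllowed.exists_scaled (hV : IsNonlinearPotential V VL K)
    (hφ : IsGroundPair VL E₀ φa φb) {Q : Hil →L[ℂ] Hil} (hQ : IsShiftedPotential Q VL E₀) (M : ℝ) :
    ∃ R₁, ∀ ε, 0 < ε → ε < 1 → ∀ a b, FourierAllowed V E₀ φa φb M ε a b →
      ∀ R, R₁ ≤ R → ∃ e u κ, IsScaledSolution V VL Q hφ.A hφ.B ε R a b e u κ := by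
  obtain ⟨C, hC0, hC⟩ := Solves.exists_sup_bound Q
  obtain ⟨C₁, hC₁0, hC₁⟩ := hV.exists_bound (M ^ 2)
  obtain ⟨C₂, hC₂⟩ := hV.exists_bound_VL
  have hC₂0 : 0 ≤ C₂ := (abs_nonneg _).trans (hC₂ 0)
  -- The hypotheses bound φ only by M pointwise, not by a multiple of ε. The sup bound on u = φ/ε
  -- comes from the linear equation, with ‖u‖ ≤ M and right-hand side of norm at most (1 + C₁ +
  -- C₂)M, using |E − E₀| ≤ ε < 1.
  refine ⟨C * (M + (1 + (C₁ + C₂)) * M), fun ε hε hε1 a b h R hR => ?_⟩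
  obtain ⟨hab, φ, E, hm, hc, hE, h1, h2, h3, h4⟩ := h
  have hε0 : (ε : ℂ) ≠ 0 := by exact_mod_cast hε.ne'
  have hεu (x : Plane) : ε ^ 2 * ‖(ε : ℂ)⁻¹ * φ x‖ ^ 2 = ‖φ x‖ ^ 2 := by
    rw [norm_mul, norm_inv, Complex.norm_real, Real.norm_of_nonneg hε.le]
    field_simp
  have hm' : MemLp (fun x => (ε : ℂ)⁻¹ * φ x) 2 cellMeasure := hm.memLp.const_mul _
  set u : Hil := hm'.toLp _
  have hu := hm'.coeFn_toLp
  have hunorm : ‖u‖ ≤ M := by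
    have e : u = (ε : ℂ)⁻¹ • hm.memLp.toLp φ := MemLp.toLp_const_smul (ε : ℂ)⁻¹ hm.memLp
    rw [e, norm_smul, norm_toLp_eq, norm_inv, Complex.norm_real, Real.norm_of_nonneg hε.le,
      inv_mul_le_iff₀ hε]
    linarith
  have hwm : AEStronglyMeasurable (fun x => (((V x (‖φ x‖ ^ 2) - VL x) / ε ^ 2 : ℝ) : ℂ))
      cellMeasure := by
    have := hV.aestronglyMeasurable_comp hm.memLp.aestronglyMeasurable zero_le_one
    simp only [one_mul] at this
    have h5 := (this.sub hV.continuous_VL.aestronglyMeasurable).const_mul (ε ^ 2)⁻¹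
    simp only [div_eq_inv_mul]
    exact Complex.continuous_ofReal.comp_aestronglyMeasurable h5
  have hVb : ∀ᵐ x ∂cellMeasure, |V x (‖φ x‖ ^ 2) - VL x| ≤ C₁ + C₂ := by
    filter_upwards [h4] with x hx
    refine (abs_sub _ _).trans (add_le_add (hC₁ x _ ⟨by positivity, ?_⟩) (hC₂ x))
    exact pow_le_pow_left₀ (norm_nonneg _) hx 2
  -- The bound (C₁ + C₂)/ε² is not uniform in ε and serves only for membership in L². The
  -- combination f below has the factor ε² restored.
  have hκm : MemLp (fun x => (((V x (‖φ x‖ ^ 2) - VL x) / ε ^ 2 : ℝ) : ℂ) * u x) 2 cellMeasure := by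
    refine (Lp.memLp u).of_le_mul (c := (C₁ + C₂) / ε ^ 2)
      (hwm.mul (Lp.aestronglyMeasurable u)) ?_
    filter_upwards [hVb] with x hx
    rw [norm_mul, Complex.norm_real, Real.norm_eq_abs, abs_div, abs_of_pos (by positivity : 0 < ε ^ 2)]
    gcongr
  set κ : Hil := hκm.toLp _
  have hκ := hκm.coeFn_toLp
  set e : ℂ := (E - E₀) / ε ^ 2
  set f : Hil := ((ε ^ 2 : ℝ) : ℂ) • (e • u - κ)
  have hf : ∀ᵐ x ∂cellMeasure, f x = ((E - E₀) - ((V x (‖φ x‖ ^ 2) - VL x : ℝ) : ℂ)) * u x := by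
    filter_upwards [Lp.coeFn_smul ((ε ^ 2 : ℝ) : ℂ) (e • u - κ), Lp.coeFn_sub (e • u) κ,
      Lp.coeFn_smul e u, hκ] with x a1 a2 a3 a4
    rw [a1, Pi.smul_apply, a2, Pi.sub_apply, a3, a4, Pi.smul_apply]
    simp only [smul_eq_mul, e]
    push_cast
    field_simp
  have hs : Solves Q u f := by
    refine Solves.of_coef (F := fun x => (ε : ℂ)⁻¹ * ((E - V x (‖φ x‖ ^ 2)) * φ x)) hu.symm ?_
      fun n => ?_
    · filter_upwards [Lp.coeFn_sub f (Q u), hf, hQ u, hu] with x a1 a2 a3 a4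
      rw [a1, Pi.sub_apply, a2, a3, a4]
      push_cast
      ring
    · rw [coef_const_mul, coef_const_mul, ← hc]
      ring
  have hfn : ‖f‖ ≤ (1 + (C₁ + C₂)) * M := by
    have : ‖f‖ ≤ (1 + (C₁ + C₂)) * ‖u‖ := by
      refine Lp.norm_le_mul_norm_of_ae_le_mul ?_
      filter_upwards [hf, hVb] with x a1 a2
      rw [a1, norm_mul]
      refine mul_le_mul_of_nonneg_right ((norm_sub_le _ _).trans (add_le_add (by linarith) ?_))
        (norm_nonneg _)
      rwa [Complex.norm_real]
    exact this.trans (mul_le_mul_of_nonneg_left hunorm (by positivity))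
  have hin {g : Plane → ℂ} (hg : MemLp g 2 cellMeasure) {z : ℂ} (hz : inner₂ g φ = ε * z) :
      inner ℂ (hg.toLp g) u = z := by
    rw [inner_toLp]
    simp only [mul_left_comm _ ((ε : ℂ)⁻¹)]
    rw [integral_const_mul]
    change (ε : ℂ)⁻¹ * inner₂ g φ = z
    rw [hz, inv_mul_cancel_left₀ hε0]
  refine ⟨e, u, κ, hab, hin _ h1, hin _ h2, ?_, hs, ?_⟩
  · filter_upwards [hκ, hu] with x a1 a2
    rw [a1, scaledNL, a2, hεu]
  · filter_upwards [hC u f hs] with x hx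
    exact hx.trans ((mul_le_mul_of_nonneg_left (add_le_add hunorm hfn) hC0).trans hR)

end Allowed

end Honeycomb

end

/-! ### Overlap integrals and the rotational selection rules. -/

noncomputable section

namespace Honeycomb

open Filter

/-- The overlap integral `∫ K p̄ q r s̄`. -/
def overlap (K : Plane → ℝ) (p q r s : Plane → ℂ) : ℂ :=
  ∫ x in cell, (starRingEnd ℂ) (p x) * (K x * (q x * r x * (starRingEnd ℂ) (s x)))

/-- A bounded, measurable, periodic function in an eigenspace of the transformed rotation. -/
structure IsRotMode (f : Plane → ℂ) (z : ℂ) (R : ℝ) : Prop where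
  meas : AEStronglyMeasurable f cellMeasure
  periodic : Periodic f
  rot : ∀ᵐ x ∂cellMeasure, rotK f x = z * f x
  bound : ∀ᵐ x ∂cellMeasure, ‖f x‖ ≤ R

section Overlap

variable {K : Plane → ℝ} {p q r s : Plane → ℂ} {zp zq zr zs : ℂ} {R CK : ℝ}

lemma overlap_integrand_meas (hKm : Measurable K) (hp : IsRotMode p zp R) (hq : IsRotMode q zq R)
    (hr : IsRotMode r zr R) (hs : IsRotMode s zs R) :
    AEStronglyMeasurable
      (fun x => (starRingEnd ℂ) (p x) * (K x * (q x * r x * (starRingEnd ℂ) (s x)))) cellMeasure :=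
  (Complex.continuous_conj.comp_aestronglyMeasurable hp.meas).mul
    ((Complex.measurable_ofReal.comp hKm).aestronglyMeasurable.mul
      ((hq.meas.mul hr.meas).mul (Complex.continuous_conj.comp_aestronglyMeasurable hs.meas)))

lemma overlap_integrable (hKm : Measurable K) (hK : ∀ x, |K x| ≤ CK) (hp : IsRotMode p zp R)
    (hq : IsRotMode q zq R) (hr : IsRotMode r zr R) (hs : IsRotMode s zs R) :
    Integrable (fun x => (starRingEnd ℂ) (p x) * (K x * (q x * r x * (starRingEnd ℂ) (s x))))
      cellMeasure := by
  refine Integrable.of_bound (overlap_integrand_meas hKm hp hq hr hs) (R * (CK * (R * R * R))) ?_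
  filter_upwards [hp.bound, hq.bound, hr.bound, hs.bound] with x h1 h2 h3 h4
  have hR : 0 ≤ R := (norm_nonneg _).trans h1
  have hC : 0 ≤ CK := (abs_nonneg _).trans (hK x)
  simp only [norm_mul, RCLike.norm_conj, Complex.norm_real, Real.norm_eq_abs]
  have := hK x
  gcongr

/-- The selection rule: rotating the variable multiplies the integral by the product of the four
eigenvalues, since K is invariant and the Bloch phases cancel in pairs. -/
lemma overlap_eq_zero (hKm : Measurable K) (hKh : IsHoneycomb K) (hp : IsRotMode p zp R)
    (hq : IsRotMode q zq R) (hr : IsRotMode r zr R) (hs : IsRotMode s zs R)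
    (hz : (starRingEnd ℂ) zp * zq * zr * (starRingEnd ℂ) zs ≠ 1) : overlap K p q r s = 0 := by
  have h1 := integral_comp_wrap measurePreserving_wrap_rot
    (overlap_integrand_meas hKm hp hq hr hs) (fun x => by
      simp only [(hp.periodic x).1, (hp.periodic x).2, (hq.periodic x).1, (hq.periodic x).2,
        (hr.periodic x).1, (hr.periodic x).2, (hs.periodic x).1, (hs.periodic x).2,
        (hKh.periodic x).1, (hKh.periodic x).2, and_self])
  have h2 : ∫ x in cell, (starRingEnd ℂ) (p (rot x))
        * (K (rot x) * (q (rot x) * r (rot x) * (starRingEnd ℂ) (s (rot x))))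
      = ((starRingEnd ℂ) zp * zq * zr * (starRingEnd ℂ) zs) * overlap K p q r s := by
    rw [overlap, ← integral_const_mul]
    refine integral_congr_ae ?_
    filter_upwards [hp.rot, hq.rot, hr.rot, hs.rot] with x e1 e2 e3 e4
    have a1 := conj_rotK_mul_rotK p q x
    have a2 := conj_rotK_mul_rotK s r x
    rw [e1, e2, map_mul] at a1
    rw [e4, e3, map_mul] at a2
    rw [hKh.rot_inv]
    calc _ = K x * ((starRingEnd ℂ) (p (rot x)) * q (rot x))
          * ((starRingEnd ℂ) (s (rot x)) * r (rot x)) := by ring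
      _ = _ := by rw [← a1, ← a2]; ring
  rw [h2] at h1
  have h3 : ((starRingEnd ℂ) zp * zq * zr * (starRingEnd ℂ) zs - 1) * overlap K p q r s = 0 := by
    rw [sub_mul, one_mul, h1, overlap, sub_self]
  exact (mul_eq_zero.1 h3).resolve_left (sub_ne_zero.2 hz)

/-- Expansion of the cubic term. -/
lemma cubicProj_eq (hKm : Measurable K) (hK : ∀ x, |K x| ≤ CK) {f A B : Plane → ℂ} {zf zA zB : ℂ}
    (hf : IsRotMode f zf R) (hA : IsRotMode A zA R) (hB : IsRotMode B zB R) (a b : ℂ) :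
    cubicProj K f A B a b
      = a ^ 2 * (starRingEnd ℂ) a * overlap K f A A A
        + (a ^ 2 * (starRingEnd ℂ) b * overlap K f A A B
        + (2 * a * b * (starRingEnd ℂ) a * overlap K f A B A
        + (2 * a * b * (starRingEnd ℂ) b * overlap K f A B B
        + (b ^ 2 * (starRingEnd ℂ) a * overlap K f B B A
        + b ^ 2 * (starRingEnd ℂ) b * overlap K f B B B)))) := by
  have i1 := (overlap_integrable hKm hK hf hA hA hA).const_mul (a ^ 2 * (starRingEnd ℂ) a)
  have i2 := (overlap_integrable hKm hK hf hA hA hB).const_mul (a ^ 2 * (starRingEnd ℂ) b)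
  have i3 := (overlap_integrable hKm hK hf hA hB hA).const_mul (2 * a * b * (starRingEnd ℂ) a)
  have i4 := (overlap_integrable hKm hK hf hA hB hB).const_mul (2 * a * b * (starRingEnd ℂ) b)
  have i5 := (overlap_integrable hKm hK hf hB hB hA).const_mul (b ^ 2 * (starRingEnd ℂ) a)
  have i6 := (overlap_integrable hKm hK hf hB hB hB).const_mul (b ^ 2 * (starRingEnd ℂ) b)
  simp only [overlap, ← integral_const_mul]
  rw [← integral_add' i5 i6, ← integral_add' i4 (i5.add i6), ← integral_add' i3 (i4.add (i5.add i6)),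
    ← integral_add' i2 (i3.add (i4.add (i5.add i6))),
    ← integral_add' i1 (i2.add (i3.add (i4.add (i5.add i6)))), cubicProj]
  refine integral_congr_ae (Eventually.of_forall fun x => ?_)
  simp only [cubic, map_add, map_mul, Pi.add_apply]
  ring

end Overlap

section GroundPair

variable {V : Plane → ℝ → ℝ} {VL K : Plane → ℝ} {E₀ : ℝ} {φa φb : Plane → ℂ}

lemma overlap_eq_ofReal {p q : Plane → ℂ} :
    overlap K p p q q = ((∫ x in cell, K x * (‖p x‖ ^ 2 * ‖q x‖ ^ 2) : ℝ) : ℂ) := by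
  rw [← integral_complex_ofReal, overlap]
  refine integral_congr_ae (Eventually.of_forall fun x => ?_)
  have h (z : ℂ) : (z * (starRingEnd ℂ) z) = ((‖z‖ ^ 2 : ℝ) : ℂ) := by
    rw [Complex.mul_conj, Complex.normSq_eq_norm_sq]
  beta_reduce
  push_cast
  have h1 := h (p x)
  have h2 := h (q x)
  push_cast at h1 h2
  rw [← h1, ← h2]
  ring

/-- Inversion exchanges |φa| and |φb| and preserves K, so both reduced equations have the same
self-interaction constant. -/
lemma IsGroundPair.integral_b (hφ : IsGroundPair VL E₀ φa φb)
    (hV : IsNonlinearPotential V VL K) : ∫ x in cell, K x * ‖φb x‖ ^ 4 = Ione K φa := by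
  have h1 := integral_comp_wrap measurePreserving_wrap_neg
    (f := fun x => ((K x * ‖φb x‖ ^ 4 : ℝ) : ℂ))
    (Complex.continuous_ofReal.comp_aestronglyMeasurable
      (hV.measurable_K.aestronglyMeasurable.mul
        (hφ.memL2_b.memLp.aestronglyMeasurable.norm.pow 4))) (fun x => by
      simp only [(hφ.memL2_b.periodic x).1, (hφ.memL2_b.periodic x).2,
        (hV.honeycomb_K.periodic x).1, (hV.honeycomb_K.periodic x).2, and_self])
  rw [integral_complex_ofReal, integral_complex_ofReal] at h1
  rw [← Complex.ofReal_injective h1, Ione]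
  refine integral_congr_ae ?_
  filter_upwards [ae_cell_of_ae hφ.conj_inv] with x hx
  rw [hx, RCLike.norm_conj, hV.honeycomb_K.even]

/-- The leading parts of the reduced equations. -/
theorem IsGroundPair.cubicProj_eq (hφ : IsGroundPair VL E₀ φa φb)
    (hV : IsNonlinearPotential V VL K) {R : ℝ} (ha : ∀ᵐ x ∂cellMeasure, ‖φa x‖ ≤ R)
    (hb : ∀ᵐ x ∂cellMeasure, ‖φb x‖ ≤ R) (a b : ℂ) :
    cubicProj K φa φa φb a b
        = a * ((‖a‖ ^ 2 * Ione K φa + 2 * ‖b‖ ^ 2 * Iint K φa φb : ℝ) : ℂ) ∧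
    cubicProj K φb φa φb a b
        = b * ((‖b‖ ^ 2 * Ione K φa + 2 * ‖a‖ ^ 2 * Iint K φa φb : ℝ) : ℂ) := by
  have mA : IsRotMode φa ζ₃ R :=
    ⟨hφ.memL2_a.memLp.aestronglyMeasurable, hφ.memL2_a.periodic, ae_cell_of_ae hφ.rot_a, ha⟩
  have mB : IsRotMode φb ((starRingEnd ℂ) ζ₃) R :=
    ⟨hφ.memL2_b.memLp.aestronglyMeasurable, hφ.memL2_b.periodic, ae_cell_of_ae hφ.rot_b, hb⟩
  have hKm := hV.measurable_K
  have hKh := hV.honeycomb_K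
  obtain ⟨CK, -, hK⟩ := hV.exists_bound_K
  have h3 := ζ₃_pow_three
  -- With conj ω = ω², each unbalanced overlap acquires a power of ω whose exponent is not divisible
  -- by 3. Only the balanced overlaps, with integrand K|φ|⁴ or K|φa|²|φb|², survive.
  have hpow (n : ℕ) : ζ₃ ^ (3 * n + 1) ≠ 1 ∧ ζ₃ ^ (3 * n + 2) ≠ 1 := by
    rw [pow_add, pow_add, pow_mul, h3, one_pow, one_mul, one_mul, pow_one]
    exact ⟨ζ₃_ne_one, ζ₃_sq_ne_one⟩
  have hab : (Iint K φa φb : ℂ) = overlap K φa φa φb φb := overlap_eq_ofReal.symm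
  have hba : overlap K φb φa φb φa = overlap K φa φa φb φb := by
    rw [overlap, overlap]
    refine integral_congr_ae (Eventually.of_forall fun x => ?_)
    ring
  have haa : (Ione K φa : ℂ) = overlap K φa φa φa φa := by
    rw [overlap_eq_ofReal, Ione]
    simp only [← pow_add]
  have hbb : (Ione K φa : ℂ) = overlap K φb φb φb φb := by
    rw [overlap_eq_ofReal, ← hφ.integral_b hV]
    simp only [← pow_add]
  have hn (z : ℂ) : z * (starRingEnd ℂ) z = (‖z‖ : ℂ) ^ 2 := by
    rw [Complex.mul_conj, Complex.normSq_eq_norm_sq]; push_cast; rfl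
  have z1 : overlap K φa φa φa φb = 0 := overlap_eq_zero hKm hKh mA mA mA mB (by
    simp only [conj_ζ₃, map_pow]; convert (hpow 2).2 using 1; ring)
  have z2 : overlap K φa φa φb φa = 0 := overlap_eq_zero hKm hKh mA mA mB mA (by
    simp only [conj_ζ₃]; convert (hpow 2).1 using 1; ring)
  have z3 : overlap K φa φb φb φa = 0 := overlap_eq_zero hKm hKh mA mB mB mA (by
    simp only [conj_ζ₃]; convert (hpow 2).2 using 1; ring)
  have z4 : overlap K φa φb φb φb = 0 := overlap_eq_zero hKm hKh mA mB mB mB (by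
    simp only [conj_ζ₃, map_pow]; convert (hpow 3).1 using 1; ring)
  have z5 : overlap K φb φa φa φa = 0 := overlap_eq_zero hKm hKh mB mA mA mA (by
    simp only [conj_ζ₃, map_pow]; convert (hpow 2).2 using 1; ring)
  have z6 : overlap K φb φa φa φb = 0 := overlap_eq_zero hKm hKh mB mA mA mB (by
    simp only [conj_ζ₃, map_pow]; convert (hpow 3).1 using 1; ring)
  have z7 : overlap K φb φa φb φb = 0 := overlap_eq_zero hKm hKh mB mA mB mB (by
    simp only [conj_ζ₃, map_pow]; convert (hpow 3).2 using 1; ring)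
  have z8 : overlap K φb φb φb φa = 0 := overlap_eq_zero hKm hKh mB mB mB mA (by
    simp only [conj_ζ₃, map_pow]; convert (hpow 3).1 using 1; ring)
  rw [Honeycomb.cubicProj_eq hKm hK mA mA mB, Honeycomb.cubicProj_eq hKm hK mB mA mB,
    z1, z2, z3, z4, z5, z6, z7, z8, hba]
  push_cast
  rw [← hn, ← hn, hab]
  constructor
  · rw [haa]; ring
  · rw [hbb]; ring

end GroundPair

end Honeycomb

end

/-! ### Rigidity of the reduced equations. -/

noncomputable section

namespace Honeycomb

open Filter

/-- The angular factor `|a|² I_one + 2 |b|² I_int` of the reduced equations. -/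
def angular (I₁ I₂ : ℝ) (a b : ℂ) : ℝ := ‖a‖ ^ 2 * I₁ + 2 * ‖b‖ ^ 2 * I₂

/-- The reduced equations satisfied by allowed pairs. -/
theorem FourierAllowed.reduced {V : Plane → ℝ → ℝ} {VL K : Plane → ℝ} {E₀ : ℝ}
    {φa φb : Plane → ℂ} (hV : IsNonlinearPotential V VL K) (hφ : IsGroundPair VL E₀ φa φb)
    {I₁ I₂ : ℝ} (hI₁ : I₁ = Ione K φa) (hI₂ : I₂ = Iint K φa φb) (M : ℝ) {τ : ℝ} (hτ : 0 < τ) :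
    ∃ ε₀ : ℝ, 0 < ε₀ ∧ ∀ ε : ℝ, 0 < ε → ε < ε₀ → ∀ a b a' b' : ℂ,
      FourierAllowed V E₀ φa φb M ε a b → FourierAllowed V E₀ φa φb M ε a' b' →
      ∃ e e' : ℂ,
        (‖e * a - a * angular I₁ I₂ a b‖ ≤ τ ∧ ‖e * b - b * angular I₁ I₂ b a‖ ≤ τ) ∧
        (‖e' * a' - a' * angular I₁ I₂ a' b'‖ ≤ τ ∧ ‖e' * b' - b' * angular I₁ I₂ b' a'‖ ≤ τ) ∧
        ‖(e * a - a * angular I₁ I₂ a b) - (e' * a' - a' * angular I₁ I₂ a' b')‖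
          ≤ τ * (‖a - a'‖ + ‖b - b'‖) ∧
        ‖(e * b - b * angular I₁ I₂ b a) - (e' * b' - b' * angular I₁ I₂ b' a')‖
          ≤ τ * (‖a - a'‖ + ‖b - b'‖) := by
  obtain ⟨Q, hQ⟩ := hV.exists_shifted E₀
  obtain ⟨c, R₀, hG⟩ := hφ.exists_isGapped hV.honeycomb_VL.periodic hQ
  obtain ⟨R₁, hR₁⟩ := FourierAllowed.exists_scaled hV hφ hQ M
  set R := max 0 (max (2 * R₀) R₁)
  have hR : 0 ≤ R := le_max_left _ _
  have hRR₀ : 2 * R₀ ≤ R := (le_max_left _ _).trans (le_max_right _ _)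
  have hRR₁ : R₁ ≤ R := (le_max_right _ _).trans (le_max_right _ _)
  obtain ⟨ε₁, hε₁, h⟩ := reduced_equations hV hR hRR₀ hG hτ
  have ea := hφ.memL2_a.memLp.coeFn_toLp
  have eb := hφ.memL2_b.memLp.coeFn_toLp
  have hba : ∀ᵐ x ∂cellMeasure, ‖φa x‖ ≤ R₀ := by
    filter_upwards [hG.bound_A, ea] with x h1 h2
    rwa [← h2]
  have hbb : ∀ᵐ x ∂cellMeasure, ‖φb x‖ ≤ R₀ := by
    filter_upwards [hG.bound_B, eb] with x h1 h2
    rwa [← h2]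
  have hP {F : Hil} {f : Plane → ℂ} (hF : F =ᵐ[cellMeasure] f) (a b : ℂ) :
      cubicProj K F hφ.A hφ.B a b = cubicProj K f φa φb a b := by
    refine integral_congr_ae ?_
    filter_upwards [hF, ea, eb] with x h1 h2 h3
    rw [h1, h2, h3]
  have hA (a b : ℂ) : cubicProj K hφ.A hφ.A hφ.B a b = a * angular I₁ I₂ a b := by
    rw [hP ea, (hφ.cubicProj_eq hV hba hbb a b).1, angular, hI₁, hI₂]
  have hB (a b : ℂ) : cubicProj K hφ.B hφ.A hφ.B a b = b * angular I₁ I₂ b a := by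
    rw [hP eb, (hφ.cubicProj_eq hV hba hbb a b).2, angular, hI₁, hI₂]
  refine ⟨min 1 ε₁, by positivity, fun ε hε hlt a b a' b' h1 h2 => ?_⟩
  have l1 : ε < 1 := hlt.trans_le (min_le_left _ _)
  have l2 : ε < ε₁ := hlt.trans_le (min_le_right _ _)
  obtain ⟨e, u, κ, s⟩ := hR₁ ε hε l1 a b h1 R hRR₁
  obtain ⟨e', u', κ', s'⟩ := hR₁ ε hε l1 a' b' h2 R hRR₁
  obtain ⟨k1, k2⟩ := h ε hε l2
  have k3 := k1 _ _ _ _ _ s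
  have k4 := k1 _ _ _ _ _ s'
  have k5 := k2 _ _ _ _ _ _ _ _ _ _ s s'
  simp only [hA, hB] at k3 k4 k5
  exact ⟨e, e', k3, k4, k5⟩

/-- Rigidity of the reduced equations away from the poles. -/
lemma radial_unique {I₁ I₂ c s c' s' δ τ : ℝ} {e e' : ℂ} (hδ : 0 < δ) (hδ1 : δ ≤ 1)
    (hg : 5 * τ < 2 * δ ^ 5 * |I₁ - 2 * I₂|)
    (hcs : c ^ 2 + s ^ 2 = 1) (hcs' : c' ^ 2 + s' ^ 2 = 1)
    (hc : δ ≤ c) (hs : δ ≤ s) (hc' : δ ≤ c') (hs' : δ ≤ s')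
    (h1' : ‖e' * c' - c' * ((c' ^ 2 * I₁ + 2 * s' ^ 2 * I₂ : ℝ) : ℂ)‖ ≤ τ)
    (h2' : ‖e' * s' - s' * ((s' ^ 2 * I₁ + 2 * c' ^ 2 * I₂ : ℝ) : ℂ)‖ ≤ τ)
    (h1 : ‖e * c - c * ((c ^ 2 * I₁ + 2 * s ^ 2 * I₂ : ℝ) : ℂ)‖ ≤ τ)
    (hd1 : ‖(e * c - c * ((c ^ 2 * I₁ + 2 * s ^ 2 * I₂ : ℝ) : ℂ))
      - (e' * c' - c' * ((c' ^ 2 * I₁ + 2 * s' ^ 2 * I₂ : ℝ) : ℂ))‖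
        ≤ τ * (|c - c'| + |s - s'|))
    (hd2 : ‖(e * s - s * ((s ^ 2 * I₁ + 2 * c ^ 2 * I₂ : ℝ) : ℂ))
      - (e' * s' - s' * ((s' ^ 2 * I₁ + 2 * c' ^ 2 * I₂ : ℝ) : ℂ))‖
        ≤ τ * (|c - c'| + |s - s'|)) : c = c' := by
  set g := I₁ - 2 * I₂ with hgdef
  set r : ℂ := e * c - c * ((c ^ 2 * I₁ + 2 * s ^ 2 * I₂ : ℝ) : ℂ) with hr
  set q : ℂ := e * s - s * ((s ^ 2 * I₁ + 2 * c ^ 2 * I₂ : ℝ) : ℂ) with hq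
  set r' : ℂ := e' * c' - c' * ((c' ^ 2 * I₁ + 2 * s' ^ 2 * I₂ : ℝ) : ℂ) with hr'
  set q' : ℂ := e' * s' - s' * ((s' ^ 2 * I₁ + 2 * c' ^ 2 * I₂ : ℝ) : ℂ) with hq'
  set d := |c - c'| + |s - s'| with hd
  have hd0 : 0 ≤ d := by positivity
  have hτ0 : 0 ≤ τ := (norm_nonneg _).trans h1
  have c0 : 0 < c := hδ.trans_le hc
  have s0 : 0 < s := hδ.trans_le hs
  have c0' : 0 < c' := hδ.trans_le hc'
  have s0' : 0 < s' := hδ.trans_le hs'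
  have c1 : c ≤ 1 := by nlinarith
  have s1 : s ≤ 1 := by nlinarith
  have c1' : c' ≤ 1 := by nlinarith
  have s1' : s' ≤ 1 := by nlinarith
  -- Cross-multiplying eliminates the unknown energy, which may be complex.
  have k' : ((c' * s' * (c' ^ 2 - s' ^ 2) * g : ℝ) : ℂ) = c' * q' - s' * r' := by
    rw [hq', hr', hgdef]; push_cast; ring
  have k : (((c * s * (c ^ 2 - s ^ 2) - c' * s' * (c' ^ 2 - s' ^ 2)) * g : ℝ) : ℂ)
      = (c * (q - q') + ((c - c' : ℝ) : ℂ) * q')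
        - (s * (r - r') + ((s - s' : ℝ) : ℂ) * r') := by
    rw [hq', hr', hq, hr, hgdef]; push_cast; ring
  set p := c ^ 2 - s ^ 2 with hp
  set p' := c' ^ 2 - s' ^ 2 with hp'
  have b1 : c' * s' * |p'| * |g| ≤ 2 * τ := by
    have := congrArg norm k'
    rw [Complex.norm_real, Real.norm_eq_abs, abs_mul, abs_mul, abs_of_pos (by positivity)] at this
    rw [this]
    refine (norm_sub_le _ _).trans ?_
    rw [norm_mul, norm_mul, Complex.norm_real, Complex.norm_real, Real.norm_of_nonneg c0'.le,
      Real.norm_of_nonneg s0'.le]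
    have := mul_le_mul c1' h2' (norm_nonneg _) zero_le_one
    have := mul_le_mul s1' h1' (norm_nonneg _) zero_le_one
    linarith
  have b2 : |c * s * p - c' * s' * p'| * |g| ≤ 3 * τ * d := by
    have := congrArg norm k
    rw [Complex.norm_real, Real.norm_eq_abs, abs_mul] at this
    rw [this]
    refine (norm_sub_le _ _).trans ((add_le_add (norm_add_le _ _) (norm_add_le _ _)).trans ?_)
    simp only [norm_mul, Complex.norm_real, Real.norm_eq_abs]
    rw [abs_of_pos c0, abs_of_pos s0]
    have a1 := mul_le_mul c1 hd2 (norm_nonneg _) zero_le_one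
    have a2 := mul_le_mul s1 hd1 (norm_nonneg _) zero_le_one
    have a3 := mul_le_mul_of_nonneg_left h2' (abs_nonneg (c - c'))
    have a4 := mul_le_mul_of_nonneg_left h1' (abs_nonneg (s - s'))
    have a5 : τ * d = |c - c'| * τ + |s - s'| * τ := by rw [hd]; ring
    linarith
  have b3 : |c * s - c' * s'| ≤ d := by
    have : c * s - c' * s' = (c - c') * s + c' * (s - s') := by ring
    rw [this]
    refine (abs_add_le _ _).trans ?_
    rw [abs_mul, abs_mul, abs_of_pos s0, abs_of_pos c0']
    have := mul_le_mul_of_nonneg_left s1 (abs_nonneg (c - c'))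
    have := mul_le_mul_of_nonneg_right c1' (abs_nonneg (s - s'))
    linarith
  -- On the unit circle p − p' equals both 2(c² − c'²) and −2(s² − s'²). Averaging the two, with c +
  -- c' and s + s' at least 2δ, bounds d.
  have b4 : 2 * δ * d ≤ |p - p'| := by
    have a1 : p - p' = 2 * ((c - c') * (c + c')) := by rw [hp, hp']; linear_combination -hcs + hcs'
    have a2 : p - p' = -(2 * ((s - s') * (s + s'))) := by
      rw [hp, hp']; linear_combination hcs - hcs'
    have a3 : |p - p'| = 2 * (|c - c'| * (c + c')) := by
      rw [a1, abs_mul, abs_mul, abs_two, abs_of_pos (add_pos c0 c0')]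
    have a4 : |p - p'| = 2 * (|s - s'| * (s + s')) := by
      rw [a2, abs_neg, abs_mul, abs_mul, abs_two, abs_of_pos (add_pos s0 s0')]
    have a5 := mul_le_mul_of_nonneg_left (add_le_add hc hc') (abs_nonneg (c - c'))
    have a6 := mul_le_mul_of_nonneg_left (add_le_add hs hs') (abs_nonneg (s - s'))
    rw [hd]
    linarith
  have b5 : δ ^ 2 * (|p'| * |g|) ≤ 2 * τ := by
    refine le_trans ?_ b1
    rw [mul_assoc (c' * s')]
    refine mul_le_mul_of_nonneg_right ?_ (by positivity)
    rw [sq]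
    exact mul_le_mul hc' hs' hδ.le c0'.le
  -- Only the product csp is controlled by the remainders. Varying the factor cs costs |p'| times d,
  -- harmless because p' is already of order τ.
  have b6 : c * s * |p - p'| * |g| ≤ 3 * τ * d + |p'| * |g| * d := by
    have e1 : c * s * (p - p') = (c * s * p - c' * s' * p') - p' * (c * s - c' * s') := by ring
    have e2 : c * s * |p - p'| ≤ |c * s * p - c' * s' * p'| + |p'| * |c * s - c' * s'| := by
      rw [← abs_of_pos (mul_pos c0 s0), ← abs_mul, e1, abs_of_pos (mul_pos c0 s0), ← abs_mul]
      exact abs_sub _ _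
    have e3 := mul_le_mul_of_nonneg_right e2 (abs_nonneg g)
    have e4 := mul_le_mul_of_nonneg_left b3 (mul_nonneg (abs_nonneg p') (abs_nonneg g))
    linarith
  have b7 : δ ^ 2 * |p - p'| * |g| ≤ 3 * τ * d + |p'| * |g| * d := by
    refine le_trans ?_ b6
    gcongr
    rw [sq]
    exact mul_le_mul hc hs hδ.le c0.le
  -- The 5 is 3 from the Lipschitz remainders plus 2 from the smallness of p'. In δ⁵, four factors
  -- come from two uses of cs ≥ δ² and one from `b4`.
  have b8 : 2 * δ ^ 5 * |g| * d ≤ 5 * τ * d := by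
    have e1 : δ ^ 4 * |g| * (2 * δ * d) ≤ δ ^ 4 * |g| * |p - p'| :=
      mul_le_mul_of_nonneg_left b4 (by positivity)
    have e2 := mul_le_mul_of_nonneg_left b7 (sq_nonneg δ)
    have e3 := mul_le_mul_of_nonneg_right b5 hd0
    have e4 : δ ^ 2 * (3 * τ * d) ≤ 1 * (3 * τ * d) :=
      mul_le_mul_of_nonneg_right (by nlinarith) (by positivity)
    linarith
  have hd00 : d = 0 := by
    by_contra hne
    have hpos : 0 < d := lt_of_le_of_ne hd0 (Ne.symm hne)
    exact absurd (le_of_mul_le_mul_right b8 hpos) (not_le.2 hg)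
  have : |c - c'| = 0 := by linarith [abs_nonneg (c - c'), abs_nonneg (s - s')]
  exact sub_eq_zero.1 (abs_eq_zero.1 this)

/-- Rigidity of the reduced equations near a pole. -/
lemma pole_isolated {I₁ I₂ τ : ℝ} {a b e : ℂ} (hg : 8 * τ < |I₁ - 2 * I₂|)
    (hab : ‖a‖ ^ 2 + ‖b‖ ^ 2 = 1) (ha : ‖a‖ ≤ 1 / 2)
    (h1 : ‖e * a - a * angular I₁ I₂ a b‖ ≤ 2 * τ * ‖a‖)
    (h2 : ‖e * b - b * angular I₁ I₂ b a‖ ≤ τ) : a = 0 := by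
  by_contra ha0
  have hna : 0 < ‖a‖ := norm_pos_iff.2 ha0
  have hb : 1 / 2 ≤ ‖b‖ := by nlinarith [norm_nonneg b]
  -- A remainder bound linear in |a| survives division by a, however small a is. A plain bound by τ
  -- would not.
  have k1 : ‖e - angular I₁ I₂ a b‖ ≤ 2 * τ := by
    rw [show e * a - a * angular I₁ I₂ a b = (e - angular I₁ I₂ a b) * a by ring, norm_mul] at h1
    exact le_of_mul_le_mul_right h1 hna
  have k2 : ‖e - angular I₁ I₂ b a‖ ≤ 2 * τ := by
    rw [show e * b - b * angular I₁ I₂ b a = (e - angular I₁ I₂ b a) * b by ring, norm_mul] at h2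
    have := mul_le_mul_of_nonneg_left hb (norm_nonneg (e - angular I₁ I₂ b a))
    linarith
  have k3 : |angular I₁ I₂ b a - angular I₁ I₂ a b| ≤ 4 * τ := by
    rw [← Real.norm_eq_abs, ← Complex.norm_real]
    have : ((angular I₁ I₂ b a - angular I₁ I₂ a b : ℝ) : ℂ)
        = (e - angular I₁ I₂ a b) - (e - angular I₁ I₂ b a) := by push_cast; ring
    rw [this]
    exact (norm_sub_le _ _).trans (by linarith)
  have k4 : angular I₁ I₂ b a - angular I₁ I₂ a b
      = (‖b‖ ^ 2 - ‖a‖ ^ 2) * (I₁ - 2 * I₂) := by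
    rw [angular, angular]; ring
  -- From |a| ≤ 1/2 one gets |b|² − |a|² = 1 − 2|a|² ≥ 1/2, so |g|/2 ≤ 4τ, against 8τ < |g|.
  have k5 : 1 / 2 ≤ ‖b‖ ^ 2 - ‖a‖ ^ 2 := by nlinarith
  rw [k4, abs_mul, abs_of_nonneg (by linarith)] at k3
  have := mul_le_mul_of_nonneg_right k5 (abs_nonneg (I₁ - 2 * I₂))
  linarith

/-- Gauge freedom aligns the large component of a nearby pair with that of the pole. Their distance
is then 1 − |b| ≤ 1 − |b|² = |a|² ≤ |a|. -/
lemma exists_phase {x y : ℂ} (hx : ‖x‖ = 1) : ∃ z : ℂ, ‖z‖ = 1 ∧ z * y = ‖y‖ * x := by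
  by_cases hy : y = 0
  · exact ⟨1, norm_one, by simp [hy]⟩
  · refine ⟨‖y‖ * x / y, ?_, div_mul_cancel₀ _ hy⟩
    rw [norm_div, norm_mul, Complex.norm_real, norm_norm, hx, mul_one,
      div_self (norm_ne_zero_iff.2 hy)]

lemma norm_sub_smul_le {a b x : ℂ} (hab : ‖a‖ ^ 2 + ‖b‖ ^ 2 = 1) (hx : ‖x‖ = 1) :
    ‖(‖b‖ : ℂ) * x - x‖ ≤ ‖a‖ := by
  obtain ⟨h1, h2⟩ := norm_le_one_of_unit hab
  rw [show (‖b‖ : ℂ) * x - x = ((‖b‖ - 1 : ℝ) : ℂ) * x by push_cast; ring, norm_mul, hx, mul_one,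
    Complex.norm_real, Real.norm_eq_abs, abs_sub_comm, abs_of_nonneg (by linarith)]
  nlinarith [norm_nonneg a, norm_nonneg b]

/-- An allowed pole is isolated. -/
theorem FourierAllowed.pole {V : Plane → ℝ → ℝ} {VL K : Plane → ℝ} {E₀ : ℝ}
    {φa φb : Plane → ℂ} (hV : IsNonlinearPotential V VL K) (hφ : IsGroundPair VL E₀ φa φb)
    (hK : Ione K φa - 2 * Iint K φa φb ≠ 0) (M : ℝ) :
    ∃ ε₀ : ℝ, 0 < ε₀ ∧ ∀ ε : ℝ, 0 < ε → ε < ε₀ → ∀ a₁ b₁ a₂ b₂ : ℂ,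
      FourierAllowed V E₀ φa φb M ε a₁ b₁ → FourierAllowed V E₀ φa φb M ε a₂ b₂ →
      (a₁ = 0 → ‖a₂‖ ≤ 1 / 2 → a₂ = 0) ∧ (b₁ = 0 → ‖b₂‖ ≤ 1 / 2 → b₂ = 0) := by
  set I₁ := Ione K φa with hI₁
  set I₂ := Iint K φa φb with hI₂
  have hg0 : 0 < |I₁ - 2 * I₂| := abs_pos.2 hK
  have hτ : 0 < |I₁ - 2 * I₂| / 16 := by positivity
  obtain ⟨ε₀, hε₀, h⟩ := FourierAllowed.reduced hV hφ hI₁ hI₂ M hτ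
  refine ⟨ε₀, hε₀, fun ε hε hlt a₁ b₁ a₂ b₂ h1 h2 => ⟨fun h0 ha => ?_, fun h0 hb => ?_⟩⟩
  · have hn1 : ‖b₁‖ = 1 := by
      have := h1.1
      rw [h0, norm_zero] at this
      nlinarith [norm_nonneg b₁]
    obtain ⟨z, hz, hzb⟩ := exists_phase (y := b₂) hn1
    have h2' := h2.const_mul hz
    obtain ⟨e, e', k1, k2, k3, k4⟩ := h ε hε hlt _ _ _ _ h2' h1
    have hna : ‖z * a₂‖ = ‖a₂‖ := by rw [norm_mul, hz, one_mul]
    have hz0 : z * a₂ = 0 := by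
      refine pole_isolated (τ := |I₁ - 2 * I₂| / 16) (by linarith) h2'.1 (hna ▸ ha) (e := e) ?_ k1.2
      -- At the pole the remainder of the first equation is exactly zero, so the Lipschitz bound
      -- reads |r| ≤ τ(|a| + |b − b₁|) ≤ 2τ|a|.
      rw [h0] at k3
      simp only [mul_zero, zero_mul, sub_zero] at k3
      refine k3.trans ?_
      have := norm_sub_smul_le h2.1 hn1
      rw [hzb, hna]
      nlinarith
    exact (mul_eq_zero.1 hz0).resolve_left (fun h => by rw [h, norm_zero] at hz; exact zero_ne_one hz)
  · have hn1 : ‖a₁‖ = 1 := by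
      have := h1.1
      rw [h0, norm_zero] at this
      nlinarith [norm_nonneg a₁]
    obtain ⟨z, hz, hzb⟩ := exists_phase (y := a₂) hn1
    have h2' := h2.const_mul hz
    obtain ⟨e, e', k1, k2, k3, k4⟩ := h ε hε hlt _ _ _ _ h2' h1
    have hna : ‖z * b₂‖ = ‖b₂‖ := by rw [norm_mul, hz, one_mul]
    have hz0 : z * b₂ = 0 := by
      refine pole_isolated (τ := |I₁ - 2 * I₂| / 16) (by linarith)
        ((add_comm _ _).trans h2'.1) (hna ▸ hb) (e := e) ?_ k1.1
      rw [h0] at k4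
      simp only [mul_zero, zero_mul, sub_zero] at k4
      refine k4.trans ?_
      have := norm_sub_smul_le ((add_comm _ _).trans h2.1) hn1
      rw [hzb, hna]
      nlinarith
    exact (mul_eq_zero.1 hz0).resolve_left (fun h => by rw [h, norm_zero] at hz; exact zero_ne_one hz)

lemma angular_polar {I₁ I₂ c s : ℝ} {z w : ℂ} (hz : ‖z‖ = 1) (hw : ‖w‖ = 1) :
    angular I₁ I₂ (c * z) (s * w) = c ^ 2 * I₁ + 2 * s ^ 2 * I₂ := by
  rw [angular, norm_mul, norm_mul, hz, hw, Complex.norm_real, Complex.norm_real]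
  simp

/-- Uniqueness of the radial angle. -/
theorem FourierAllowed.radial {V : Plane → ℝ → ℝ} {VL K : Plane → ℝ} {E₀ : ℝ}
    {φa φb : Plane → ℂ} (hV : IsNonlinearPotential V VL K) (hφ : IsGroundPair VL E₀ φa φb)
    (hK : Ione K φa - 2 * Iint K φa φb ≠ 0) {δ : ℝ} (hδ : 0 < δ) (M : ℝ) :
    ∃ ε₀ : ℝ, 0 < ε₀ ∧ ∀ ε : ℝ, 0 < ε → ε < ε₀ → ∀ (c s c' s' : ℝ) (z w : ℂ),
      ‖z‖ = 1 → ‖w‖ = 1 → c ^ 2 + s ^ 2 = 1 → c' ^ 2 + s' ^ 2 = 1 →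
      δ ≤ c → δ ≤ s → δ ≤ c' → δ ≤ s' →
      FourierAllowed V E₀ φa φb M ε (c * z) (s * w) →
      FourierAllowed V E₀ φa φb M ε (c' * z) (s' * w) → c = c' := by
  set I₁ := Ione K φa with hI₁
  set I₂ := Iint K φa φb with hI₂
  have hg0 : 0 < |I₁ - 2 * I₂| := abs_pos.2 hK
  have hτ : 0 < δ ^ 5 * |I₁ - 2 * I₂| / 5 := by positivity
  obtain ⟨ε₀, hε₀, h⟩ := FourierAllowed.reduced hV hφ hI₁ hI₂ M hτ
  refine ⟨ε₀, hε₀, fun ε hε hlt c s c' s' z w hz hw hcs hcs' hc hs hc' hs' h1 h2 => ?_⟩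
  obtain ⟨e, e', k1, k2, k3, k4⟩ := h ε hε hlt _ _ _ _ h1 h2
  simp only [angular_polar hz hw, angular_polar hw hz] at k1 k2 k3 k4
  -- The two pairs have the same phases, which therefore factor out of every norm and leave real
  -- unknowns.
  have hmul (y e : ℂ) (t X : ℝ) (hy : ‖y‖ = 1) : ‖e * (t * y) - t * y * X‖ = ‖e * t - t * X‖ := by
    rw [show e * (t * y) - t * y * X = (e * t - t * X) * y by ring, norm_mul, hy, mul_one]
  have hsub (y : ℂ) (t t' : ℝ) (hy : ‖y‖ = 1) : ‖(t : ℂ) * y - t' * y‖ = |t - t'| := by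
    rw [← sub_mul, norm_mul, hy, mul_one, ← Complex.ofReal_sub, Complex.norm_real,
      Real.norm_eq_abs]
  have hmul2 (y e e' : ℂ) (t X t' X' : ℝ) (hy : ‖y‖ = 1) :
      ‖(e * (t * y) - t * y * X) - (e' * (t' * y) - t' * y * X')‖
        = ‖(e * t - t * X) - (e' * t' - t' * X')‖ := by
    rw [show (e * (t * y) - t * y * X) - (e' * (t' * y) - t' * y * X')
      = ((e * t - t * X) - (e' * t' - t' * X')) * y by ring, norm_mul, hy, mul_one]
  rw [hmul z _ _ _ hz, hmul w _ _ _ hw] at k1 k2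
  rw [hmul2 z _ _ _ _ _ _ hz, hsub z _ _ hz, hsub w _ _ hw] at k3
  rw [hmul2 w _ _ _ _ _ _ hw, hsub z _ _ hz, hsub w _ _ hw] at k4
  have hδ1 : δ ≤ 1 := by nlinarith
  -- The choice of τ makes 5τ equal to δ⁵|I₁ − 2I₂|, half of the threshold.
  exact radial_unique hδ hδ1 (by nlinarith [pow_pos hδ 5]) hcs hcs' hc hs hc' hs'
    k2.1 k2.2 k1.1 k3 k4

end Honeycomb

end

/-! ### The proposition. -/

theorem mainTheorem3
    (V : Honeycomb.Plane → ℝ → ℝ) (VL K : Honeycomb.Plane → ℝ)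
    (hV : Honeycomb.IsNonlinearPotential V VL K)
    (E₀ : ℝ) (φa φb : Honeycomb.Plane → ℂ)
    (hφ : Honeycomb.IsGroundPair VL E₀ φa φb)
    (hK : Honeycomb.Ione K φa - 2 * Honeycomb.Iint K φa φb ≠ 0) :
    -- (1) at most one radial angle for given phases, away from the poles
    (∀ δ : ℝ, 0 < δ → ∀ M : ℝ, ∃ ε₀ : ℝ, 0 < ε₀ ∧ ∀ ε : ℝ, 0 < ε → ε < ε₀ →
      ∀ α β θ θ' : ℝ, θ ∈ Set.Icc 0 (Real.pi / 2) → θ' ∈ Set.Icc 0 (Real.pi / 2) →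
        δ ≤ Real.cos θ → δ ≤ Real.sin θ → δ ≤ Real.cos θ' → δ ≤ Real.sin θ' →
        Honeycomb.Allowed V E₀ φa φb M ε
          (Real.cos θ * Complex.exp (Complex.I * α)) (Real.sin θ * Complex.exp (Complex.I * β)) →
        Honeycomb.Allowed V E₀ φa φb M ε
          (Real.cos θ' * Complex.exp (Complex.I * α)) (Real.sin θ' * Complex.exp (Complex.I * β)) →
        θ = θ') ∧
    -- (2) an allowed pole is isolated among the allowed pairs, uniformly in `ε`
    (∃ δ : ℝ, 0 < δ ∧ ∀ M : ℝ, ∃ ε₀ : ℝ, 0 < ε₀ ∧ ∀ ε : ℝ, 0 < ε → ε < ε₀ →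
      ∀ a₁ b₁ a₂ b₂ : ℂ,
        Honeycomb.Allowed V E₀ φa φb M ε a₁ b₁ → Honeycomb.Allowed V E₀ φa φb M ε a₂ b₂ →
        ((a₁ = 0 ∧ ‖a₂‖ ≤ δ) ∨ (b₁ = 0 ∧ ‖b₂‖ ≤ δ) → Honeycomb.SamePoint a₁ b₁ a₂ b₂) ∧
        ((∀ s : ℝ, 0 ≤ s → Honeycomb.IsHoneycomb fun x => V x s) →
          (a₁ = 0 ∨ b₁ = 0) → (‖a₂‖ ≤ δ ∨ ‖b₂‖ ≤ δ) →
          Honeycomb.SamePoint a₂ b₂ 1 0 ∨ Honeycomb.SamePoint a₂ b₂ 0 1)) := by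
  have hexp (t : ℝ) : ‖Complex.exp (Complex.I * t)‖ = 1 := by
    rw [mul_comm, Complex.norm_exp_ofReal_mul_I]
  refine ⟨fun δ hδ M => ?_, 1 / 2, by norm_num, fun M => ?_⟩
  · obtain ⟨ε₀, hε₀, h⟩ := Honeycomb.FourierAllowed.radial hV hφ hK hδ M
    refine ⟨ε₀, hε₀, fun ε hε hlt α β θ θ' hθ hθ' h1 h2 h3 h4 hA hA' => ?_⟩
    have hcos := h ε hε hlt _ _ _ _ _ _ (hexp α) (hexp β) (Real.cos_sq_add_sin_sq θ)
      (Real.cos_sq_add_sin_sq θ') h1 h2 h3 h4 hA.fourierAllowed hA'.fourierAllowed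
    exact Real.injOn_cos ⟨hθ.1, by linarith [hθ.2, Real.pi_pos]⟩
      ⟨hθ'.1, by linarith [hθ'.2, Real.pi_pos]⟩ hcos
  · obtain ⟨ε₀, hε₀, h⟩ := Honeycomb.FourierAllowed.pole hV hφ hK M
    refine ⟨ε₀, hε₀, fun ε hε hlt a₁ b₁ a₂ b₂ hA₁ hA₂ => ?_⟩
    have h1 := hA₁.fourierAllowed
    have h2 := hA₂.fourierAllowed
    obtain ⟨ka, kb⟩ := h ε hε hlt _ _ _ _ h1 h2
    refine ⟨?_, fun hsym h0 hle => ?_⟩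
    · rintro (⟨h0, hle⟩ | ⟨h0, hle⟩)
      · simp [Honeycomb.SamePoint, h0, ka h0 hle]
      · simp [Honeycomb.SamePoint, h0, kb h0 hle]
    -- Reflection makes the opposite pole allowed as well, so the second pair is compared with
    -- whichever pole it is close to.
    · obtain ⟨ka', kb'⟩ := h ε hε hlt _ _ _ _ (h1.reflect hV hφ hsym) h2
      have hor : a₂ = 0 ∨ b₂ = 0 := by
        rcases h0 with h0 | h0 <;> rcases hle with hle | hle
        · exact Or.inl (ka h0 hle)
        · exact Or.inr (kb' (by rw [h0, map_zero]) hle)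
        · exact Or.inl (ka' (by rw [h0, map_zero]) hle)
        · exact Or.inr (kb h0 hle)
      rcases hor with h3 | h3
      · exact Or.inr (by simp [Honeycomb.SamePoint, h3])
      · exact Or.inl (by simp [Honeycomb.SamePoint, h3])
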